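/- All graphs are finite and simple. For a graph $G$ and $S\subseteq V(G)$, $G-S$ is the subgraph induced by $V(G)\setminus S$, and $c(G-S)$ is its number of components; $S$ is a cutset of $G$ if $c(G-S)\ge 2$, and a minimal cutset if moreover no proper subset of $S$ is a cutset. The toughness of $G$ is $\min\{|S|/c(G-S) : S\subseteq V(G),\ c(G-S)\ge 2\}$ if $G$ is not complete and $\infty$ if $G$ is complete, and $G$ is $t$-tough if its toughness is at least $t$. $G$ is $(P_4\cup P_1)$-free if no induced subgraph of $G$ is isomorphic to the disjoint union of a path on four vertices and a single vertex. An $S$-matched path-cover of $G-S$ is a union of vertex-disjoint paths of $G$ (which may use vertices of $S$) that together contain all vertices of $G-S$, such that the two endvertices of each path belong to $S$; its components are these paths. Let $G$ be a $4.5$-tough $(P_4\cup P_1)$-free graph, and let $S\subseteq V(G)$ be a minimal cutset of $G$. Then (1) $G-S$ has an $S$-matched path-cover with a single component, that is, $G$ has a path with both endvertices in $S$ that contains all vertices of $G-S$; and (2) $G$ has a cycle containing all vertices of $G-S$. -/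

import Mathlib

open scoped SimpleGraph NNReal ENNReal

namespace ToughGraph

variable {V : Type*}

/-- The graph `G - S`: the subgraph of `G` induced by the vertices outside `S`. -/
abbrev del (G : SimpleGraph V) (S : Set V) : SimpleGraph (Sᶜ : Set V) :=
  G.induce Sᶜ

/-- The number of components of a finite graph. -/
noncomputable def numComponents {W : Type*} (H : SimpleGraph W) : ℕ :=
  Nat.card H.ConnectedComponent

/-- `S` is a cutset of the finite graph `G` if `G - S` has at least two components. -/
def IsCutset (G : SimpleGraph V) (S : Set V) : Prop :=
  2 ≤ numComponents (del G S)

/-- `S` is an inclusion-minimal cutset of `G`. -/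
def IsMinimalCutset (G : SimpleGraph V) (S : Set V) : Prop :=
  Minimal (IsCutset G) S

/-- The toughness of a finite graph `G`: the minimum of `|S| / c(G - S)` over all cutsets `S`.
If `G` is complete, there is no cutset and the infimum over the empty family is `∞`. -/
noncomputable def toughness (G : SimpleGraph V) : ℝ≥0∞ :=
  ⨅ (S : Set V) (_ : IsCutset G S), (S.ncard : ℝ≥0∞) / (numComponents (del G S) : ℝ≥0∞)

/-- `G` is `t`-tough if its toughness is at least `t`. -/
def IsTough (G : SimpleGraph V) (t : ℝ≥0) : Prop :=
  (t : ℝ≥0∞) ≤ toughness G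

/-- `G` is `R`-free if it has no induced subgraph isomorphic to `R`. -/
def IsFree {W : Type*} (G : SimpleGraph V) (R : SimpleGraph W) : Prop :=
  ¬ R ⊴ G

/-- The graph `P₄ ∪ P₁`: the disjoint union of a path on four vertices and a single vertex. -/
def P4unionP1 : SimpleGraph (Fin 4 ⊕ Fin 1) :=
  SimpleGraph.pathGraph 4 ⊕g SimpleGraph.pathGraph 1

/-- A path-cover, with exactly `k` components, of the subgraph of `G` with vertex set `T`:
`k` pairwise vertex-disjoint paths of `G` which together contain all vertices of `T`.
The paths may use vertices of `G` outside `T`. -/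
structure PathCover (G : SimpleGraph V) (T : Set V) (k : ℕ) where
  /-- first endvertex of each path -/
  source : Fin k → V
  /-- last endvertex of each path -/
  target : Fin k → V
  /-- the paths -/
  path : ∀ i, G.Walk (source i) (target i)
  isPath : ∀ i, (path i).IsPath
  disjoint : ∀ i j, i ≠ j → ∀ v, v ∈ (path i).support → v ∉ (path j).support
  covers : ∀ v ∈ T, ∃ i, v ∈ (path i).support

/-- A path-cover is `S`-matched if the two (distinct) endvertices of each of its paths
belong to `S`. -/
def PathCover.IsMatched {G : SimpleGraph V} {T : Set V} {k : ℕ} (Q : PathCover G T k)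
    (S : Set V) : Prop :=
  ∀ i, Q.source i ≠ Q.target i ∧ Q.source i ∈ S ∧ Q.target i ∈ S

end ToughGraph

/-! ### Families of disjoint paths as lists: linking, cutting and interleaving. -/

namespace ToughGraph
variable {V : Type*}

/-! Since `S` is a cutset, an induced P₄ in one component of G - S together with a vertex of another
component would be an induced P₄ ∪ P₁. Hence G - S is P₄-free, a cograph. By minimality of `S`, each
vertex of `S` has a neighbour in every component.

A cograph decomposes (`P4Free.exists_dec`) into pairwise nonadjacent blocks, each a single vertex,
an edge or a set spanned by a cycle, and a set `T` of connecting vertices, each of which is complete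
to every block it touches. The blocks can be linked along `T` into |B| - |T| paths, with freedom in
which block ends the vertices of `T` use up. To make all remaining path ends extend into `S`, it
suffices to match the two ends of a Hamiltonian path of each block injectively into `S ∪ T`
(`Setup.exists_cover_of_match`).

The matching exists by toughness (`Setup.exists_cover`). Forbidding P₄ ∪ P₁ forces the neighbours of
a family of blocks to be complete to some of them (`Setup.exists_complete`), so removing these
complete vertices separates the blocks, there are at least 4.5 of them per block, and Hall's theorem
with demand two applies. At most one block that is a whole component, and at most one with few
complete vertices, need separate treatment, except when two whole components make up all of G - S.
Whole components are handled by exchange arguments on a Hamiltonian cycle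
(`Setup.exists_ham_of_class`).

The result is a cover of G - S by disjoint paths with both ends in `S`, each within one component
apart from vertices of `S`. Two such paths joined by an edge can be merged (`Setup.exists_merge`),
so one path per component suffices. Finally these paths are assembled into one path and into a
cycle. With three or more components, a vertex of `S` misses vertices of at most one component, so
paths can be linked greedily (`ManyPaths.hasCycle_and_hasPath`). With two components, a path is
rotated whenever an end of it has a nonneighbour in the other path (`TwoPaths.hasPath`,
`TwoPaths.hasCycle`). -/

/-- `l` lists the vertices of a path of `G` with vertex set `N`. -/
structure IsHam (G : SimpleGraph V) (N : Finset V) (l : List V) : Prop where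
  chain : l.IsChain G.Adj
  nodup : l.Nodup
  mem : ∀ v, v ∈ l ↔ v ∈ N

/-- The two ends of a list, as a multiset. -/
def ends (l : List V) : Multiset V := (l.head?.toList ++ l.getLast?.toList : List V)

/-- The ends of all the lists of a family. -/
def allEnds (L : List (List V)) : Multiset V := (L.map ends).sum

/-- `L` is a family of vertex-disjoint paths of `G` with union `N`. -/
structure IsSystem (G : SimpleGraph V) (N : Finset V) (L : List (List V)) : Prop where
  ne : ∀ l ∈ L, l ≠ []
  chain : ∀ l ∈ L, l.IsChain G.Adj
  nodup : L.flatten.Nodup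
  mem : ∀ v, v ∈ L.flatten ↔ v ∈ N

variable {G : SimpleGraph V}

lemma ends_reverse (l : List V) : ends l.reverse = ends l := by
  simp only [ends, List.head?_reverse, List.getLast?_reverse]
  exact Multiset.coe_eq_coe.2 List.perm_append_comm

lemma ends_append {l l' : List V} (h : l ≠ []) (h' : l' ≠ []) (m : List V) :
    ends (l ++ (m ++ l')) = {l.head h, l'.getLast h'} := by
  have h2 : m ++ l' ≠ [] := by simp [h']
  simp [ends, List.head?_eq_some_head h, List.getLast?_eq_some_getLast h', List.head?_append,
    List.getLast?_append]
  rfl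

/-- A one-vertex list has its vertex as an end twice, since something can be attached on both sides
of it. -/
lemma ends_eq {l : List V} (h : l ≠ []) : ends l = {l.head h, l.getLast h} := by
  simp [ends, List.head?_eq_some_head h, List.getLast?_eq_some_getLast h]; rfl

lemma mem_of_mem_ends {l : List V} {v : V} (h : v ∈ ends l) : v ∈ l := by
  rcases eq_or_ne l [] with rfl | hl
  · simp [ends] at h
  · rw [ends_eq hl] at h
    simp only [Multiset.insert_eq_cons, Multiset.mem_cons, Multiset.mem_singleton] at h
    rcases h with rfl | rfl
    · exact List.head_mem hl
    · exact List.getLast_mem hl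

lemma allEnds_cons (l : List V) (L : List (List V)) : allEnds (l :: L) = ends l + allEnds L := by
  simp [allEnds]

lemma allEnds_append (L L' : List (List V)) : allEnds (L ++ L') = allEnds L + allEnds L' := by
  simp [allEnds]

lemma allEnds_perm {L L' : List (List V)} (h : L.Perm L') : allEnds L = allEnds L' :=
  (h.map ends).sum_eq

lemma mem_allEnds {L : List (List V)} {v : V} : v ∈ allEnds L ↔ ∃ l ∈ L, v ∈ ends l := by
  induction L with
  | nil => simp [allEnds]
  | cons l L ih => simp [allEnds_cons, ih]

lemma isChain_reverse_adj {l : List V} (h : l.IsChain G.Adj) : l.reverse.IsChain G.Adj := by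
  rw [List.isChain_reverse]
  exact h.imp fun a b h => h.symm

lemma IsHam.of_perm {N : Finset V} {c l : List V} (h : IsHam G N c) (hl : l.IsChain G.Adj)
    (p : l.Perm c) : IsHam G N l :=
  ⟨hl, p.nodup_iff.2 h.nodup, fun v => p.mem_iff.trans (h.mem v)⟩

lemma IsHam.isSystem {N : Finset V} {l : List V} (h : IsHam G N l) (hl : l ≠ []) :
    IsSystem G N [l] :=
  ⟨by simpa using hl, by simpa using h.chain, by simpa using h.nodup, by simpa using h.mem⟩

lemma IsSystem.perm {N : Finset V} {L L' : List (List V)} (h : IsSystem G N L) (p : L.Perm L') :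
    IsSystem G N L' :=
  ⟨fun l hl => h.ne l (p.mem_iff.2 hl), fun l hl => h.chain l (p.mem_iff.2 hl),
    p.flatten.nodup_iff.1 h.nodup, fun v => (p.flatten.mem_iff).symm.trans (h.mem v)⟩

lemma IsSystem.reverse_head {N : Finset V} {l : List V} {L : List (List V)}
    (h : IsSystem G N (l :: L)) : IsSystem G N (l.reverse :: L) := by
  have p : (l.reverse :: L).flatten.Perm (l :: L).flatten := by
    simpa using (List.reverse_perm l).append_right _
  refine ⟨?_, ?_, p.nodup_iff.2 h.nodup, fun v => p.mem_iff.trans (h.mem v)⟩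
  · intro m hm
    rcases List.mem_cons.1 hm with rfl | hm
    · simpa using h.ne l (by simp)
    · exact h.ne m (by simp [hm])
  · intro m hm
    rcases List.mem_cons.1 hm with rfl | hm
    · exact isChain_reverse_adj (h.chain l (by simp))
    · exact h.chain m (by simp [hm])

lemma IsSystem.append [DecidableEq V] {N N' : Finset V} {L L' : List (List V)} (h : IsSystem G N L)
    (h' : IsSystem G N' L') (hd : Disjoint N N') : IsSystem G (N ∪ N') (L ++ L') := by
  refine ⟨?_, ?_, ?_, fun v => ?_⟩
  · intro l hl
    rcases List.mem_append.1 hl with hl | hl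
    exacts [h.ne l hl, h'.ne l hl]
  · intro l hl
    rcases List.mem_append.1 hl with hl | hl
    exacts [h.chain l hl, h'.chain l hl]
  · rw [List.flatten_append]
    refine h.nodup.append h'.nodup fun v hv hv' => ?_
    exact Finset.disjoint_left.1 hd ((h.mem v).1 hv) ((h'.mem v).1 hv')
  · rw [List.flatten_append, List.mem_append, h.mem, h'.mem, Finset.mem_union]

/-- Two paths of a system can be linked by a new vertex, using up a prescribed end. -/
lemma IsSystem.link [DecidableEq V] {N : Finset V} {L : List (List V)} (h : IsSystem G N L)
    (hL : 2 ≤ L.length) {b : V} (hb : b ∉ N) (hadj : ∀ v ∈ allEnds L, G.Adj b v) (o : Option V) :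
    ∃ L', IsSystem G (insert b N) L' ∧ L'.length + 1 = L.length ∧
      allEnds L' ≤ allEnds L - (o.toList : Multiset V) := by
  -- it is enough to link at the last vertex of the first path
  suffices key : ∀ (l l' : List V) (M : List (List V)), IsSystem G N (l :: l' :: M) →
      (∀ v ∈ allEnds (l :: l' :: M), G.Adj b v) → ∃ L', IsSystem G (insert b N) L' ∧
      L'.length = M.length + 1 ∧
      ∃ hl : l ≠ [], allEnds L' ≤ allEnds (l :: l' :: M) - {l.getLast hl} by
    by_cases ho : ∃ v, o = some v ∧ v ∈ allEnds L
    · obtain ⟨v, rfl, hv⟩ := ho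
      obtain ⟨l, hl, hvl⟩ := mem_allEnds.1 hv
      obtain ⟨M, hM⟩ : ∃ M, L.Perm (l :: M) := ⟨L.erase l, List.perm_cons_erase hl⟩
      have hlen := hM.length_eq
      obtain ⟨l', M, rfl⟩ : ∃ l' M', M = l' :: M' := by
        cases M with
        | nil => simp at hlen; omega
        | cons l' M' => exact ⟨_, _, rfl⟩
      have hs := h.perm hM
      have hE := allEnds_perm hM
      have hne := h.ne l hl
      rw [ends_eq hne] at hvl
      simp only [Multiset.insert_eq_cons, Multiset.mem_cons, Multiset.mem_singleton] at hvl
      simp only [List.length_cons] at hlen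
      rcases hvl with rfl | rfl
      · have hE' : allEnds (l.reverse :: l' :: M) = allEnds (l :: l' :: M) := by
          simp only [allEnds_cons, ends_reverse]
        obtain ⟨L', h1, h2, h3, h4⟩ := key l.reverse l' M hs.reverse_head
          (by rw [hE', ← hE]; exact hadj)
        refine ⟨L', h1, by omega, ?_⟩
        rw [hE', ← hE] at h4
        simpa [List.getLast_reverse] using h4
      · obtain ⟨L', h1, h2, h3, h4⟩ := key l l' M hs (by rw [← hE]; exact hadj)
        refine ⟨L', h1, by omega, ?_⟩
        rw [← hE] at h4
        simpa using h4
    · have hsub : allEnds L - (o.toList : Multiset V) = allEnds L := by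
        cases o with
        | none => simp
        | some v =>
          have : v ∉ allEnds L := fun hv => ho ⟨v, rfl, hv⟩
          simp [Multiset.sub_singleton, this]
      rw [hsub]
      match L, hL with
      | l :: l' :: M, _ =>
        obtain ⟨L', h1, h2, h3, h4⟩ := key l l' M h hadj
        exact ⟨L', h1, by simp [h2], h4.trans tsub_le_self⟩
  intro l l' M hs ha
  have hl : l ≠ [] := hs.ne l (by simp)
  have hl' : l' ≠ [] := hs.ne l' (by simp)
  have p : ((l ++ ([b] ++ l')) :: M).flatten.Perm (b :: (l :: l' :: M).flatten) := by
    simp only [List.flatten_cons, List.append_assoc, List.cons_append, List.nil_append]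
    exact List.perm_middle
  have hbm : b ∉ (l :: l' :: M).flatten := fun hm => hb ((hs.mem b).1 hm)
  refine ⟨(l ++ ([b] ++ l')) :: M, ⟨?_, ?_, ?_, ?_⟩, by simp, hl, ?_⟩
  · intro m hm
    rcases List.mem_cons.1 hm with rfl | hm
    · simp
    · exact hs.ne m (by simp [hm])
  · intro m hm
    rcases List.mem_cons.1 hm with rfl | hm
    · have h1 : G.Adj b (l.getLast hl) := ha _ (by simp [allEnds_cons, ends_eq hl])
      have h2 : G.Adj b (l'.head hl') := ha _ (by simp [allEnds_cons, ends_eq hl'])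
      refine List.IsChain.append (hs.chain l (by simp)) (List.IsChain.append (by simp)
        (hs.chain l' (by simp)) ?_) ?_
      · simp [List.head?_eq_some_head hl', h2]
      · simp [List.getLast?_eq_some_getLast hl, h1.symm]
    · exact hs.chain m (by simp [hm])
  · rw [p.nodup_iff, List.nodup_cons]
    exact ⟨hbm, hs.nodup⟩
  · intro v
    rw [p.mem_iff, List.mem_cons, hs.mem, Finset.mem_insert]
  · have e : allEnds (l :: l' :: M) = {l.getLast hl} +
        ({l.head hl, l'.getLast hl'} + allEnds M + {l'.head hl'}) := by
      rw [allEnds_cons, allEnds_cons, ends_eq hl, ends_eq hl']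
      simp only [Multiset.insert_eq_cons, ← Multiset.singleton_add]; abel
    rw [e, add_tsub_cancel_left, allEnds_cons, ends_append hl hl']
    exact Multiset.le_add_right _ _

lemma length_le_length_flatten {L : List (List V)} (h : ∀ l ∈ L, l ≠ []) :
    L.length ≤ L.flatten.length := by
  rw [List.length_flatten]
  have := List.card_nsmul_le_sum (L.map List.length) 1 (by
    simp only [List.mem_map, forall_exists_index, and_imp, forall_apply_eq_imp_iff₂]
    exact fun a ha => List.length_pos_iff.2 (h a ha))
  simpa using this

/-- Paths of a system can be cut. -/
lemma exists_chop : ∀ (L : List (List V)) (t : ℕ), (∀ l ∈ L, l ≠ []) →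
    (∀ l ∈ L, l.IsChain G.Adj) → L.length ≤ t → t ≤ L.flatten.length →
    ∃ L' : List (List V), (∀ l ∈ L', l ≠ []) ∧ (∀ l ∈ L', l.IsChain G.Adj) ∧
      L'.length = t ∧ L'.flatten = L.flatten := by
  intro L
  induction L with
  | nil => intro t _ _ _ h; exact ⟨[], by simp, by simp, by simp at h ⊢; omega, rfl⟩
  | cons l L ih =>
    induction l with
    | nil => intro t h; simp at h
    | cons x l ihl =>
      intro t hne hch h1 h2
      simp only [List.mem_cons, forall_eq_or_imp] at hne hch
      simp only [List.length_cons, List.flatten_cons, List.cons_append, List.length_append] at h1 h2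
      -- Either the first list can stay whole, the others being cut into `t - 1` pieces, or its
      -- first vertex is cut off as a piece of its own.
      by_cases ht : t ≤ L.flatten.length + 1
      · obtain ⟨L', a, b, c, d⟩ := ih (t - 1) hne.2 hch.2 (by omega) (by omega)
        exact ⟨(x :: l) :: L', by simpa using a, by simpa using ⟨hch.1, b⟩, 
          by rw [List.length_cons]; omega, by simp [d]⟩
      · match l, ihl, hch, h2 with
        | [], _, _, h2 => simp only [List.length_nil] at h2; omega
        | y :: l, ihl, hch, h2 =>
          simp only [List.length_cons] at h2
          have h3 := length_le_length_flatten hne.2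
          obtain ⟨L', a, b, c, d⟩ := ihl (t - 1) (by simpa using hne.2)
            (by simpa using ⟨(List.isChain_cons_cons.1 hch.1).2, hch.2⟩)
            (by rw [List.length_cons]; omega)
            (by simp only [List.flatten_cons, List.length_append, List.length_cons]; omega)
          exact ⟨[x] :: L', by simpa using a, by simpa using b, by rw [List.length_cons]; omega,
            by simp [d]⟩

lemma IsSystem.length_flatten {N : Finset V} {L : List (List V)} (h : IsSystem G N L) :
    L.flatten.length = N.card := by
  classical
  rw [← List.toFinset_card_of_nodup h.nodup]
  congr 1; ext v; simp only [List.mem_toFinset]; exact h.mem v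

lemma IsSystem.length_le_card {N : Finset V} {L : List (List V)} (h : IsSystem G N L) :
    L.length ≤ N.card :=
  (length_le_length_flatten h.ne).trans h.length_flatten.le

lemma IsSystem.chop {N : Finset V} {L : List (List V)} (h : IsSystem G N L) {t : ℕ}
    (h1 : L.length ≤ t) (h2 : t ≤ N.card) : ∃ L', IsSystem G N L' ∧ L'.length = t := by
  obtain ⟨L', a, b, c, d⟩ := exists_chop L t h.ne h.chain h1 (by rw [h.length_flatten]; exact h2)
  exact ⟨L', ⟨a, b, d ▸ h.nodup, d ▸ h.mem⟩, c⟩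

/-- Two families of equally many paths, mutually completely joined, form one path. -/
lemma exists_interleave {A B : Finset V} (hAB : ∀ a ∈ A, ∀ b ∈ B, G.Adj a b) :
    ∀ (L M : List (List V)), L.length = M.length → (∀ l ∈ L, l ≠ []) → (∀ l ∈ M, l ≠ []) →
    (∀ l ∈ L, l.IsChain G.Adj) → (∀ l ∈ M, l.IsChain G.Adj) →
    (∀ v ∈ L.flatten, v ∈ A) → (∀ v ∈ M.flatten, v ∈ B) →
    ∃ l : List V, l.IsChain G.Adj ∧ l.Perm (L.flatten ++ M.flatten) ∧ (∀ x ∈ l.head?, x ∈ A) ∧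
      ∀ x ∈ l.getLast?, x ∈ B := by
  intro L
  induction L with
  | nil =>
    intro M h
    have : M = [] := by simpa using h.symm
    subst this
    intros
    exact ⟨[], by simp⟩
  | cons l L ih =>
    intro M h hL hM hL' hM' hA hB
    match M, h with
    | m :: M, h =>
      simp only [List.mem_cons, forall_eq_or_imp, List.flatten_cons, List.mem_append] at *
      obtain ⟨c, c1, c2, c3, c4⟩ := ih M (by simpa using h) hL.2 hM.2 hL'.2 hM'.2
        (fun v hv => hA v (.inr hv)) (fun v hv => hB v (.inr hv))
      refine ⟨l ++ (m ++ c), ?_, ?_, ?_, ?_⟩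
      · refine hL'.1.append (hM'.1.append c1 ?_) ?_
        · intro x hx y hy
          exact (hAB y (c3 y hy) x (hB x (.inl (List.mem_of_getLast? hx)))).symm
        · intro x hx y hy
          rw [List.head?_append_of_ne_nil _ hM.1] at hy
          exact hAB x (hA x (.inl (List.mem_of_getLast? hx))) y (hB y (.inl (List.mem_of_head? hy)))
      · have := (c2.append_left m).append_left l
        refine this.trans ?_
        rw [List.append_assoc]
        refine List.Perm.append_left l ?_
        rw [← List.append_assoc, ← List.append_assoc]
        exact List.Perm.append_right _ List.perm_append_comm
      · intro x hx
        rw [List.head?_append_of_ne_nil _ hL.1] at hx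
        exact hA x (.inl (List.mem_of_head? hx))
      · intro x hx
        rcases eq_or_ne c [] with rfl | hc
        · rw [List.getLast?_append_of_ne_nil _ (by simpa using hM.1), List.append_nil] at hx
          exact hB x (.inl (List.mem_of_getLast? hx))
        · rw [← List.append_assoc, List.getLast?_append_of_ne_nil _ hc] at hx
          exact c4 x hx

lemma exists_adj_crossing {l : List V} (h : l.IsChain G.Adj) (P : V → Prop) {v w : V} (hv : v ∈ l)
    (hw : w ∈ l) (hPv : P v) (hPw : ¬ P w) : ∃ x ∈ l, ∃ y ∈ l, P x ∧ ¬ P y ∧ G.Adj x y := by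
  induction l generalizing v w with
  | nil => simp at hv
  | cons a l ih =>
    match l with
    | [] => simp at hv hw; subst hv hw; exact absurd hPv hPw
    | b :: l =>
      have hc := List.isChain_cons_cons.1 h
      by_cases hab : P a ↔ P b
      · have H : ∀ u ∈ a :: b :: l, ∃ u' ∈ b :: l, (P u ↔ P u') := by
          intro u hu
          rcases List.mem_cons.1 hu with rfl | hu
          · exact ⟨b, by simp, hab⟩
          · exact ⟨u, hu, Iff.rfl⟩
        obtain ⟨v', hv', e⟩ := H v hv
        obtain ⟨w', hw', e'⟩ := H w hw
        obtain ⟨x, hx, y, hy, r⟩ := ih hc.2 hv' hw' (e.1 hPv) (fun h => hPw (e'.2 h))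
        exact ⟨x, by simp [hx], y, by simp [hy], r⟩
      · by_cases ha : P a
        · exact ⟨a, by simp, b, by simp, ha, fun hb => hab (by tauto), hc.1⟩
        · exact ⟨b, by simp, a, by simp, by tauto, ha, hc.1.symm⟩

end ToughGraph

/-! ### Decomposition of P₄-free graphs into blocks and connecting vertices. -/

namespace ToughGraph
variable {V : Type*}

/-- No four vertices of `N` induce a path. -/
def P4Free (G : SimpleGraph V) (N : Finset V) : Prop :=
  ∀ a ∈ N, ∀ b ∈ N, ∀ c ∈ N, ∀ d ∈ N, G.Adj a b → G.Adj b c → G.Adj c d →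
    G.Adj a c ∨ G.Adj b d ∨ G.Adj a d

/-- `N` splits into two nonempty parts without edges between them. -/
def Splits [DecidableEq V] (G : SimpleGraph V) (N : Finset V) : Prop :=
  ∃ A ⊆ N, A.Nonempty ∧ (N \ A).Nonempty ∧ ∀ a ∈ A, ∀ b ∈ N \ A, ¬ G.Adj a b

variable {G : SimpleGraph V}

lemma P4Free.mono {N N' : Finset V} (h : P4Free G N) (hN : N' ⊆ N) : P4Free G N' :=
  fun a ha b hb c hc d hd => h a (hN ha) b (hN hb) c (hN hc) d (hN hd)

/-- The path on four vertices is self-complementary: if a, b, c, d is induced in the complement,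
then c, a, d, b is induced in `G`. -/
lemma P4Free.compl {N : Finset V} (h : P4Free G N) : P4Free Gᶜ N := by
  intro a ha b hb c hc d hd hab hbc hcd
  simp only [SimpleGraph.compl_adj] at *
  by_contra! H
  obtain ⟨h1, h2, h3⟩ := H
  by_cases hac : a = c
  · subst hac; exact hcd.2 (h3 hcd.1)
  by_cases hbd : b = d
  · subst hbd; exact hab.2 (h3 hab.1)
  by_cases had : a = d
  · subst had; exact hab.2 (h2 hab.1.symm).symm
  rcases h c hc a ha d hd b hb (h1 hac).symm (h3 had) (h2 hbd).symm with h | h | h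
  · exact hcd.2 h
  · exact hab.2 h
  · exact hbc.2 h.symm

/-- If `v` is complete to `N`, it is split off in the complement. Otherwise a suitably small side of
the given splitting admits `v` on one of the two sides, because neighbours of `v` on both sides
would produce an induced P₄. -/
lemma Splits.of_insert [DecidableEq V] {N : Finset V} {v : V} (hv : v ∉ N)
    (h4 : P4Free G (insert v N)) (h : Splits G N) :
    Splits G (insert v N) ∨ Splits Gᶜ (insert v N) := by
  classical
  by_cases hc : ∃ c ∈ N, ¬ G.Adj v c
  swap
  · push Not at hc
    right
    obtain ⟨A, hA, ⟨a, ha⟩, -⟩ := h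
    have e : insert v N \ {v} = N := by rw [Finset.sdiff_singleton_eq_erase, Finset.erase_insert hv]
    refine ⟨{v}, by simp, by simp, ?_, ?_⟩
    · rw [e]; exact ⟨a, hA ha⟩
    · rw [e]
      simp only [Finset.mem_singleton, forall_eq, SimpleGraph.compl_adj]
      exact fun b hb h => h.2 (hc b hb)
  obtain ⟨c, hcN, hvc⟩ := hc
  -- The possible sides that contain the nonneighbour `c` of `v`; a smallest one is taken.
  let F : Finset (Finset V) := N.powerset.filter fun A => c ∈ A ∧ (N \ A).Nonempty ∧
    ∀ a ∈ A, ∀ b ∈ N \ A, ¬ G.Adj a b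
  have hF : F.Nonempty := by
    obtain ⟨A, hA, h1, h2, h3⟩ := h
    by_cases hcA : c ∈ A
    · exact ⟨A, by simp only [F, Finset.mem_filter, Finset.mem_powerset]; exact ⟨hA, hcA, h2, h3⟩⟩
    · refine ⟨N \ A, ?_⟩
      simp only [F, Finset.mem_filter, Finset.mem_powerset, Finset.sdiff_sdiff_eq_self hA]
      refine ⟨Finset.sdiff_subset, by simp [hcN, hcA], h1, fun a ha b hb hab => h3 b hb a ha hab.symm⟩
  obtain ⟨A, hAF, hmin⟩ := Finset.exists_min_image F Finset.card hF
  simp only [F, Finset.mem_filter, Finset.mem_powerset] at hAF hmin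
  obtain ⟨hA, hcA, hne, hno⟩ := hAF
  left
  by_cases h1 : ∃ x ∈ A, G.Adj v x
  swap
  · push Not at h1
    refine ⟨A, hA.trans (Finset.subset_insert _ _), ⟨c, hcA⟩, ⟨v, ?_⟩, ?_⟩
    · simp only [Finset.mem_sdiff, Finset.mem_insert, true_or, true_and]
      exact fun h => hv (hA h)
    · intro a ha b hb
      simp only [Finset.mem_sdiff, Finset.mem_insert] at hb
      rcases hb with ⟨rfl | hb, hb'⟩
      · exact fun h => h1 a ha h.symm
      · exact hno a ha b (by simp [hb, hb'])
  by_cases h2 : ∃ y ∈ N \ A, G.Adj v y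
  swap
  · push Not at h2
    refine ⟨N \ A, Finset.sdiff_subset.trans (Finset.subset_insert _ _), hne, ⟨c, ?_⟩, ?_⟩
    · simp [hcN, hcA]
    · intro a ha b hb
      simp only [Finset.mem_sdiff, Finset.mem_insert] at hb
      rcases hb with ⟨rfl | hb, hb'⟩
      · exact fun h => h2 a ha h.symm
      · exact fun h => hno b (by tauto) a ha h.symm
  exfalso
  obtain ⟨x0, hx0, hvx0⟩ := h1
  obtain ⟨y, hy, hvy⟩ := h2
  -- Otherwise the nonneighbours of `v` in `A` would form a smaller side containing `c`. With `y` on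
  -- the other side, x', x, v, y is then an induced P₄.
  have hx : ∃ x ∈ A, ∃ x' ∈ A, G.Adj v x ∧ ¬ G.Adj v x' ∧ G.Adj x' x := by
    by_contra! H
    have hlt : (A.filter fun x => ¬ G.Adj v x).card < A.card :=
      Finset.card_lt_card (Finset.filter_ssubset.2 ⟨x0, hx0, by simpa using hvx0⟩)
    refine absurd (hmin (A.filter fun x => ¬ G.Adj v x) ?_) (by omega)
    refine ⟨(Finset.filter_subset _ _).trans hA, by simp [hcA, hvc], ⟨x0, ?_⟩, ?_⟩
    · simp [hA hx0, hvx0]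
    · intro a ha b hb
      simp only [Finset.mem_filter, Finset.mem_sdiff, not_and, not_not] at ha hb
      by_cases hbA : b ∈ A
      · exact H b hbA a ha.1 (hb.2 hbA) ha.2
      · exact hno a ha.1 b (by simp [hb.1, hbA])
  obtain ⟨x, hxA, x', hx'A, hvx, hvx', hxx'⟩ := hx
  have hyN : y ∈ N := (Finset.mem_sdiff.1 hy).1
  rcases h4 x' (by simp [hA hx'A]) x (by simp [hA hxA]) v (by simp) y (by simp [hyN]) hxx' hvx.symm
    hvy with h | h | h
  · exact hvx' h.symm
  · exact hno x hxA y hy h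
  · exact hno x' hx'A y hy h

/-- Seinsche's theorem: a P₄-free graph or its complement is disconnected. Self-complementarity lets
`Splits.of_insert` serve both cases of the induction. -/
lemma P4Free.splits [DecidableEq V] {N : Finset V} (h : P4Free G N) (hN : 2 ≤ N.card) :
    Splits G N ∨ Splits Gᶜ N := by
  induction N using Finset.induction_on with
  | empty => simp at hN
  | insert v N hv ih =>
    rw [Finset.card_insert_of_notMem hv] at hN
    by_cases h1 : N.card = 1
    · obtain ⟨w, rfl⟩ := Finset.card_eq_one.1 h1
      have hvw : v ≠ w := by simpa using hv
      have e : (insert v {w} : Finset V) \ {v} = {w} := by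
        rw [Finset.sdiff_singleton_eq_erase, Finset.erase_insert hv]
      by_cases hadj : G.Adj v w
      · exact .inr ⟨{v}, by simp, by simp, by rw [e]; simp, by rw [e]; simp [hadj]⟩
      · exact .inl ⟨{v}, by simp, by simp, by rw [e]; simp, by rw [e]; simp [hadj]⟩
    · rcases ih (h.mono (Finset.subset_insert _ _)) (by omega) with h2 | h2
      · exact h2.of_insert hv h
      · have := h2.of_insert hv h.compl
        rw [compl_compl] at this
        exact this.symm

/-- A vertex set spanned by a path which closes up to a cycle (if it has at least two vertices). -/
def IsBlock (G : SimpleGraph V) (K : Finset V) : Prop :=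
  ∃ x l, IsHam G K (x :: l) ∧ ∀ y ∈ l.getLast?, G.Adj y x

lemma IsBlock.nonempty {K : Finset V} (h : IsBlock G K) : K.Nonempty := by
  obtain ⟨x, l, h, -⟩ := h
  exact ⟨x, (h.mem x).1 (by simp)⟩

lemma IsBlock.exists_adj_crossing {K : Finset V} (h : IsBlock G K) (P : V → Prop) {v w : V}
    (hv : v ∈ K) (hw : w ∈ K) (hPv : P v) (hPw : ¬ P w) :
    ∃ x ∈ K, ∃ y ∈ K, P x ∧ ¬ P y ∧ G.Adj x y := by
  obtain ⟨x, l, h, -⟩ := h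
  obtain ⟨a, ha, b, hb, r⟩ := ToughGraph.exists_adj_crossing h.chain P ((h.mem _).2 hv)
    ((h.mem _).2 hw) hPv hPw
  exact ⟨a, (h.mem _).1 ha, b, (h.mem _).1 hb, r⟩

lemma IsBlock.exists_ham_cons {K : Finset V} (h : IsBlock G K) {u : V} (hu : u ∈ K) :
    ∃ l, IsHam G K (u :: l) ∧ ∀ y ∈ l.getLast?, G.Adj y u := by
  obtain ⟨x, l, h, hc⟩ := h
  obtain ⟨a, b, e⟩ := List.append_of_mem ((h.mem u).2 hu)
  match a with
  | [] => 
    simp only [List.nil_append, List.cons.injEq] at e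
    obtain ⟨rfl, rfl⟩ := e
    exact ⟨l, h, hc⟩
  | x' :: a =>
    simp only [List.cons_append, List.cons.injEq] at e
    obtain ⟨rfl, rfl⟩ := e
    have hch := h.chain
    rw [← List.cons_append, List.isChain_append] at hch
    have p : (u :: (b ++ x :: a)).Perm (x :: (a ++ u :: b)) := by
      rw [← List.cons_append, ← List.cons_append]; exact List.perm_append_comm
    refine ⟨b ++ x :: a, ⟨?_, p.nodup_iff.2 h.nodup, fun v => p.mem_iff.trans (h.mem v)⟩, ?_⟩
    · rw [← List.cons_append]
      refine hch.2.1.append hch.1 fun y hy z hz => ?_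
      simp only [List.head?_cons, Option.mem_def, Option.some.injEq] at hz
      subst hz
      refine hc y ?_
      rw [List.getLast?_append_of_ne_nil _ (by simp)]
      exact hy
    · intro y hy
      rw [List.getLast?_append_of_ne_nil _ (by simp)] at hy
      exact hch.2.2 y hy u (by simp)

/-- A decomposition of `N` into blocks and connecting vertices, such that given Hamiltonian
paths of the blocks can be linked along the connecting vertices. -/
structure Dec [DecidableEq V] (G : SimpleGraph V) (N T : Finset V) (B : Finset (Finset V)) :
    Prop where
  mem_iff : ∀ v, v ∈ N ↔ v ∈ T ∨ ∃ K ∈ B, v ∈ K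
  notMem : ∀ v ∈ T, ∀ K ∈ B, v ∉ K
  block : ∀ K ∈ B, IsBlock G K
  sep : ∀ K ∈ B, ∀ K' ∈ B, K ≠ K' → ∀ v ∈ K, ∀ w ∈ K', v ≠ w ∧ ¬ G.Adj v w
  -- A connecting vertex arises from a join to a set with at least two blocks, hence the second
  -- block.
  complete : ∀ t ∈ T, ∀ K ∈ B, ∀ v ∈ K, G.Adj t v → (∀ w ∈ K, G.Adj t w) ∧
    ∃ K' ∈ B, K' ≠ K ∧ ∀ w ∈ K', G.Adj t w
  -- The option `o t` names a block end that is to be used up when `t` is inserted; the inequality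
  -- says that named ends no longer occur as ends, counted with multiplicity.
  link : ∀ (l : Finset V → List V) (o : V → Option V), (∀ K ∈ B, IsHam G K (l K)) →
    (∀ t ∈ T, ∀ v, o t = some v → G.Adj t v) → ∃ L, IsSystem G N L ∧
      L.length + T.card = B.card ∧
      allEnds L ≤ ∑ K ∈ B, ends (l K) - (T.val.filterMap o)

/-- Each link lowers the number of paths by one, so the strict inequality `hL` leaves two paths to
link every time. -/
lemma IsSystem.link_many [DecidableEq V] {N M : Finset V} {L : List (List V)}
    (h : IsSystem G N L) (hM : Disjoint M N) (hL : M.card < L.length)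
    (hadj : ∀ b ∈ M, ∀ v ∈ allEnds L, G.Adj b v) (o : V → Option V) :
    ∃ L', IsSystem G (M ∪ N) L' ∧ L'.length + M.card = L.length ∧
      allEnds L' ≤ allEnds L - (M.val.filterMap o) := by
  induction M using Finset.induction_on with
  | empty => exact ⟨L, by simpa using h, by simp, by simp⟩
  | insert b M hb ih =>
    rw [Finset.card_insert_of_notMem hb] at *
    obtain ⟨L', h1, h2, h3⟩ := ih (hM.mono_left (Finset.subset_insert _ _)) (by omega)
      (fun b' hb' => hadj b' (by simp [hb']))
    obtain ⟨L'', g1, g2, g3⟩ := h1.link (b := b) (by omega)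
      (by simp only [Finset.mem_union, not_or]
          exact ⟨hb, fun hbN => Finset.disjoint_left.1 hM (Finset.mem_insert_self _ _) hbN⟩)
      (fun v hv => hadj b (by simp) v (Multiset.mem_of_le (h3.trans tsub_le_self) hv)) (o b)
    refine ⟨L'', by rwa [Finset.insert_union], by omega, g3.trans ?_⟩
    have e : (insert b M).val.filterMap o = M.val.filterMap o + ((o b).toList : Multiset V) := by
      rw [Finset.insert_val_of_notMem hb]
      cases hob : o b with
      | none => rw [Multiset.filterMap_cons_none _ _ hob]; simp
      | some v =>
        rw [Multiset.filterMap_cons_some _ _ _ hob, ← Multiset.singleton_add, add_comm]; rfl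
    rw [e, ← tsub_tsub]
    exact tsub_le_tsub_right h3 _

lemma Dec.exists_system [DecidableEq V] {N T : Finset V} {B : Finset (Finset V)}
    (h : Dec G N T B) : ∃ L, IsSystem G N L ∧ L.length + T.card = B.card := by
  have : ∀ K, ∃ l, K ∈ B → IsHam G K l := by
    intro K
    by_cases hK : K ∈ B
    · obtain ⟨x, l, hl, -⟩ := h.block K hK
      exact ⟨x :: l, fun _ => hl⟩
    · exact ⟨[], fun h => absurd h hK⟩
  choose l hl using this
  obtain ⟨L, h1, h2, -⟩ := h.link l (fun _ => none) hl (by simp)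
  exact ⟨L, h1, h2⟩

lemma Dec.of_isBlock [DecidableEq V] {N : Finset V} (h : IsBlock G N) : Dec G N ∅ {N} where
  mem_iff := by simp
  notMem := by simp
  block := by simpa using h
  sep := by simp only [Finset.mem_singleton]; rintro K rfl K' rfl h; exact absurd rfl h
  complete := by simp
  link l o hl _ := by
    have h1 := hl N (by simp)
    have h2 : l N ≠ [] := by
      obtain ⟨v, hv⟩ := h.nonempty
      exact List.ne_nil_of_mem ((h1.mem v).2 hv)
    exact ⟨[l N], h1.isSystem h2, by simp, by simp [allEnds]⟩

lemma Dec.union [DecidableEq V] {N N' T T' : Finset V} {B B' : Finset (Finset V)}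
    (h : Dec G N T B) (h' : Dec G N' T' B') (hd : Disjoint N N')
    (hno : ∀ a ∈ N, ∀ b ∈ N', ¬ G.Adj a b) : Dec G (N ∪ N') (T ∪ T') (B ∪ B') := by
  have hT : ∀ v ∈ T, v ∈ N := fun v hv => (h.mem_iff v).2 (.inl hv)
  have hT' : ∀ v ∈ T', v ∈ N' := fun v hv => (h'.mem_iff v).2 (.inl hv)
  have hB : ∀ K ∈ B, ∀ v ∈ K, v ∈ N := fun K hK v hv => (h.mem_iff v).2 (.inr ⟨K, hK, hv⟩)
  have hB' : ∀ K ∈ B', ∀ v ∈ K, v ∈ N' := fun K hK v hv => (h'.mem_iff v).2 (.inr ⟨K, hK, hv⟩)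
  have hdd : ∀ v ∈ N, v ∉ N' := fun v hv hv' => Finset.disjoint_left.1 hd hv hv'
  have hBd : Disjoint B B' := by
    rw [Finset.disjoint_left]
    intro K hK hK'
    obtain ⟨v, hv⟩ := (h.block K hK).nonempty
    exact hdd v (hB K hK v hv) (hB' K hK' v hv)
  have hTd : Disjoint T T' := Finset.disjoint_left.2 fun v hv hv' => hdd v (hT v hv) (hT' v hv')
  constructor
  · intro v
    simp only [Finset.mem_union, h.mem_iff, h'.mem_iff]
    constructor
    · rintro ((h | ⟨K, hK, h⟩) | (h | ⟨K, hK, h⟩))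
      exacts [.inl (.inl h), .inr ⟨K, .inl hK, h⟩, .inl (.inr h), .inr ⟨K, .inr hK, h⟩]
    · rintro ((h | h) | ⟨K, hK | hK, h⟩)
      exacts [.inl (.inl h), .inr (.inl h), .inl (.inr ⟨K, hK, h⟩), .inr (.inr ⟨K, hK, h⟩)]
  · intro v hv K hK hvK
    simp only [Finset.mem_union] at hv hK
    rcases hv with hv | hv <;> rcases hK with hK | hK
    · exact h.notMem v hv K hK hvK
    · exact hdd v (hT v hv) (hB' K hK v hvK)
    · exact hdd v (hB K hK v hvK) (hT' v hv)
    · exact h'.notMem v hv K hK hvK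
  · intro K hK
    rcases Finset.mem_union.1 hK with hK | hK
    exacts [h.block K hK, h'.block K hK]
  · intro K hK K' hK' hne v hv w hw
    simp only [Finset.mem_union] at hK hK'
    rcases hK with hK | hK <;> rcases hK' with hK' | hK'
    · exact h.sep K hK K' hK' hne v hv w hw
    · have h1 := hB K hK v hv
      have h2 := hB' K' hK' w hw
      exact ⟨fun e => hdd v h1 (e ▸ h2), hno v h1 w h2⟩
    · have h1 := hB' K hK v hv
      have h2 := hB K' hK' w hw
      exact ⟨fun e => hdd w h2 (e ▸ h1), fun e => hno w h2 v h1 e.symm⟩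
    · exact h'.sep K hK K' hK' hne v hv w hw
  · intro t ht K hK v hv hadj
    simp only [Finset.mem_union] at ht hK ⊢
    rcases ht with ht | ht <;> rcases hK with hK | hK
    · obtain ⟨a, K', b, c⟩ := h.complete t ht K hK v hv hadj
      exact ⟨a, K', .inl b, c⟩
    · exact absurd hadj (hno t (hT t ht) v (hB' K hK v hv))
    · exact absurd hadj.symm (hno v (hB K hK v hv) t (hT' t ht))
    · obtain ⟨a, K', b, c⟩ := h'.complete t ht K hK v hv hadj
      exact ⟨a, K', .inr b, c⟩
  · intro l o hl ho
    obtain ⟨L, a1, a2, a3⟩ := h.link l o (fun K hK => hl K (by simp [hK]))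
      (fun t ht => ho t (by simp [ht]))
    obtain ⟨L', b1, b2, b3⟩ := h'.link l o (fun K hK => hl K (by simp [hK]))
      (fun t ht => ho t (by simp [ht]))
    refine ⟨L ++ L', a1.append b1 hd, ?_, ?_⟩
    · rw [List.length_append, Finset.card_union_of_disjoint hBd, Finset.card_union_of_disjoint hTd]
      omega
    · have e : (T ∪ T').val = T.val + T'.val := by
        rw [← Finset.disjUnion_eq_union _ _ hTd]; rfl
      rw [allEnds_append, Finset.sum_union hBd, e, Multiset.filterMap_add]
      refine (add_le_add a3 b3).trans (Multiset.le_iff_count.2 fun v => ?_)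
      -- Truncated subtraction does not distribute over sums in general. Here it does, since the
      -- ends on one side, and the vertices that `o` names for connecting vertices of that side, do
      -- not occur on the other side.
      have key : ∀ {N T : Finset V} {B : Finset (Finset V)}, Dec G N T B →
          (∀ K ∈ B, IsHam G K (l K)) → v ∉ N → (∑ K ∈ B, ends (l K)).count v = 0 := by
        intro N T B h hl hv
        rw [Multiset.count_eq_zero, Multiset.mem_sum]
        rintro ⟨K, hK, hvK⟩
        exact hv ((h.mem_iff v).2 (.inr ⟨K, hK, ((hl K hK).mem v).1 (mem_of_mem_ends hvK)⟩))
      have hlB : ∀ K ∈ B, IsHam G K (l K) := fun K hK => hl K (by simp [hK])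
      have hlB' : ∀ K ∈ B', IsHam G K (l K) := fun K hK => hl K (by simp [hK])
      simp only [Multiset.count_add, Multiset.count_sub]
      by_cases hv : v ∈ N
      · have e1 := key h' hlB' (hdd v hv)
        have e2 : (T'.val.filterMap o).count v = 0 := by
          rw [Multiset.count_eq_zero, Multiset.mem_filterMap]
          rintro ⟨t, ht, hto⟩
          exact hno v hv t (hT' t ht) (ho t (by simp at ht; simp [ht]) v hto).symm
        omega
      by_cases hv' : v ∈ N'
      · have e1 := key h hlB hv
        have e2 : (T.val.filterMap o).count v = 0 := by
          rw [Multiset.count_eq_zero, Multiset.mem_filterMap]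
          rintro ⟨t, ht, hto⟩
          exact hno t (hT t ht) v hv' (ho t (by simp at ht; simp [ht]) v hto)
        omega
      · have e1 := key h hlB hv
        have e2 := key h' hlB' hv'
        omega

/-- If `N'` has fewer vertices than the number of paths covering `N`, each vertex of `N'` can be
spent on linking two of these paths. -/
lemma Dec.join [DecidableEq V] {N N' T : Finset V} {B : Finset (Finset V)}
    (h : Dec G N T B) (hd : Disjoint N' N) (hN' : N'.Nonempty) (hall : ∀ a ∈ N', ∀ b ∈ N, G.Adj a b)
    (hlt : N'.card + T.card < B.card) : Dec G (N' ∪ N) (N' ∪ T) B := by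
  have hT : ∀ v ∈ T, v ∈ N := fun v hv => (h.mem_iff v).2 (.inl hv)
  have hB : ∀ K ∈ B, ∀ v ∈ K, v ∈ N := fun K hK v hv => (h.mem_iff v).2 (.inr ⟨K, hK, hv⟩)
  have hdd : ∀ v ∈ N', v ∉ N := fun v hv hv' => Finset.disjoint_left.1 hd hv hv'
  have hTd : Disjoint N' T := Finset.disjoint_left.2 fun v hv hv' => hdd v hv (hT v hv')
  constructor
  · intro v
    simp only [Finset.mem_union, h.mem_iff]
    tauto
  · intro v hv K hK hvK
    rcases Finset.mem_union.1 hv with hv | hv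
    · exact hdd v hv (hB K hK v hvK)
    · exact h.notMem v hv K hK hvK
  · exact h.block
  · exact h.sep
  · intro t ht K hK v hv hadj
    rcases Finset.mem_union.1 ht with ht | ht
    · refine ⟨fun w hw => hall t ht w (hB K hK w hw), ?_⟩
      have hp := hN'.card_pos
      obtain ⟨K', hK', hne⟩ := Finset.exists_mem_ne (s := B) (by omega) K
      exact ⟨K', hK', hne, fun w hw => hall t ht w (hB K' hK' w hw)⟩
    · exact h.complete t ht K hK v hv hadj
  · intro l o hl ho
    obtain ⟨L, a1, a2, a3⟩ := h.link l o hl (fun t ht => ho t (by simp [ht]))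
    obtain ⟨L', b1, b2, b3⟩ := a1.link_many (M := N') hd (by omega) (fun b hb v hv => hall b hb v (by
      obtain ⟨m, hm, hvm⟩ := mem_allEnds.1 hv
      exact (a1.mem v).1 (List.mem_flatten.2 ⟨m, hm, mem_of_mem_ends hvm⟩))) o
    refine ⟨L', b1, ?_, b3.trans ?_⟩
    · rw [Finset.card_union_of_disjoint hTd]; omega
    · have e : (N' ∪ T).val = N'.val + T.val := by
        rw [← Finset.disjUnion_eq_union _ _ hTd]; rfl
      rw [e, Multiset.filterMap_add, add_comm, ← tsub_tsub]
      exact tsub_le_tsub_right a3 _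

/-- Equally many paths on the two sides of a join alternate into one path that starts in `A` and
ends in `B`, hence closes up. -/
lemma IsBlock.join [DecidableEq V] {A B : Finset V} (hd : Disjoint A B)
    (hall : ∀ a ∈ A, ∀ b ∈ B, G.Adj a b) {L M : List (List V)} (hL : IsSystem G A L)
    (hM : IsSystem G B M) (h1 : L.length ≤ B.card) (h2 : M.length ≤ A.card) (hA : A.Nonempty) : IsBlock G (A ∪ B) := by
  have hL' := hL.length_le_card
  have hM' := hM.length_le_card
  -- The larger number of paths is at most `A.card` and at most `B.card`, so both systems can be cut
  -- into that many.
  obtain ⟨L1, l1, l2⟩ := hL.chop (t := max L.length M.length) (le_max_left _ _) (by omega)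
  obtain ⟨M1, m1, m2⟩ := hM.chop (t := max L.length M.length) (le_max_right _ _) (by omega)
  obtain ⟨c, c1, c2, c3, c4⟩ := exists_interleave hall L1 M1 (by omega) l1.ne m1.ne l1.chain m1.chain
    (fun v => (l1.mem v).1) (fun v => (m1.mem v).1)
  have hmem : ∀ v, v ∈ c ↔ v ∈ A ∪ B := fun v => by
    rw [c2.mem_iff, List.mem_append, l1.mem, m1.mem, Finset.mem_union]
  have hnd : c.Nodup := by
    rw [c2.nodup_iff]
    refine l1.nodup.append m1.nodup fun v hv hv' => ?_
    exact Finset.disjoint_left.1 hd ((l1.mem v).1 hv) ((m1.mem v).1 hv')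
  match c with
  | [] =>
    obtain ⟨a, ha⟩ := hA
    simpa using (hmem a).2 (by simp [ha])
  | x :: c =>
    refine ⟨x, c, ⟨c1, hnd, hmem⟩, fun y hy => ?_⟩
    refine (hall x (c3 x (by simp)) y (c4 y ?_)).symm
    rw [List.getLast?_cons]
    simp only [Option.mem_def] at hy
    simp [hy]

/-- Every nonempty vertex set without induced four-vertex paths has a decomposition. -/
theorem P4Free.exists_dec [DecidableEq V] {N : Finset V} (h : P4Free G N) (hN : N.Nonempty) :
    ∃ T B, Dec G N T B := by
  induction hn : N.card using Nat.strong_induction_on generalizing N with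
  | _ n ih =>
  subst hn
  by_cases h2 : 2 ≤ N.card
  swap
  · have := hN.card_pos
    obtain ⟨v, rfl⟩ := Finset.card_eq_one.1 (show N.card = 1 by omega)
    exact ⟨_, _, Dec.of_isBlock ⟨v, [], ⟨by simp, by simp, by simp⟩, by simp⟩⟩
  have hsp : ∀ A ⊆ N, A.Nonempty → (N \ A).Nonempty → (∃ T B, Dec G A T B) ∧
      (∃ T B, Dec G (N \ A) T B) := by
    intro A hA h1 h2
    have := Finset.card_sdiff_add_card_eq_card hA
    have := h1.card_pos
    have := h2.card_pos
    exact ⟨ih _ (by omega) (h.mono hA) h1 rfl, ih _ (by omega) (h.mono Finset.sdiff_subset) h2 rfl⟩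
  rcases h.splits h2 with ⟨A, hA, h1, h2, hno⟩ | ⟨A, hA, h1, h2, hno⟩
  · obtain ⟨⟨T, B, hD⟩, T', B', hD'⟩ := hsp A hA h1 h2
    rw [← Finset.union_sdiff_of_subset hA]
    exact ⟨_, _, hD.union hD' Finset.disjoint_sdiff hno⟩
  · obtain ⟨⟨T, B, hD⟩, T', B', hD'⟩ := hsp A hA h1 h2
    have hall : ∀ a ∈ A, ∀ b ∈ N \ A, G.Adj a b := by
      intro a ha b hb
      have := hno a ha b hb
      rw [SimpleGraph.compl_adj] at this
      by_contra hab
      refine this ⟨?_, hab⟩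
      rintro rfl
      exact (Finset.mem_sdiff.1 hb).2 ha
    rw [← Finset.union_sdiff_of_subset hA]
    have hd : Disjoint A (N \ A) := Finset.disjoint_sdiff
    -- Here `B.card - T.card` is the number of paths that cover `A`. Either one side is too small to
    -- separate the paths of the other and becomes a set of connecting vertices, or both sides are
    -- large enough for a spanning cycle.
    by_cases c1 : (N \ A).card + T.card < B.card
    · rw [Finset.union_comm]
      exact ⟨_, _, hD.join hd.symm h2 (fun a ha b hb => (hall b hb a ha).symm) c1⟩
    by_cases c2 : A.card + T'.card < B'.card
    · exact ⟨_, _, hD'.join hd h1 hall c2⟩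
    obtain ⟨L, l1, l2⟩ := hD.exists_system
    obtain ⟨L', l1', l2'⟩ := hD'.exists_system
    exact ⟨_, _, Dec.of_isBlock (IsBlock.join hd hall l1 l1' (by omega) (by omega) h1)⟩

end ToughGraph

/-! ### The hypotheses used, and exchange arguments on a Hamiltonian cycle. -/

namespace ToughGraph
variable {V : Type*} {ι : Type*}

/-- What is used of a minimal cutset `S` of a tough `(P₄ ∪ P₁)`-free graph;
`κ` labels the vertices outside `S` by their components. -/
structure Setup [Fintype V] (G : SimpleGraph V) (S : Finset V) (κ : V → ι) : Prop where
  false_of_P4P1 : ∀ a b c d e, G.Adj a b → G.Adj b c → G.Adj c d → ¬ G.Adj a c → ¬ G.Adj b d →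
    ¬ G.Adj a d → ¬ G.Adj e a → ¬ G.Adj e b → ¬ G.Adj e c → ¬ G.Adj e d → False
  label : ∀ v ∉ S, ∀ w ∉ S, G.Adj v w → κ v = κ w
  cross : ∀ (P : V → Prop), ∀ v ∉ S, ∀ w ∉ S, κ v = κ w → P v → ¬ P w →
    ∃ x, x ∉ S ∧ ∃ y, y ∉ S ∧ κ x = κ v ∧ κ y = κ v ∧ P x ∧ ¬ P y ∧ G.Adj x y
  nbr : ∀ s ∈ S, ∀ v ∉ S, ∃ x, x ∉ S ∧ κ x = κ v ∧ G.Adj s x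
  exists_notMem : ∃ v, v ∉ S
  other : ∀ v ∉ S, ∃ w, w ∉ S ∧ κ w ≠ κ v
  -- The members of `B` are disjoint unions of components of G - Z, so that G - Z has at least
  -- `B.card` components; the inequality is 4.5-toughness with denominators cleared.
  tough : ∀ (Z : Finset V) (B : Finset (Finset V)), 2 ≤ B.card → (∀ K ∈ B, K.Nonempty) →
    (∀ K ∈ B, ∀ v ∈ K, v ∉ Z) → (∀ K ∈ B, ∀ K' ∈ B, K ≠ K' → ∀ v ∈ K, v ∉ K') →
    (∀ K ∈ B, ∀ v ∈ K, ∀ w, G.Adj v w → w ∈ K ∨ w ∈ Z) → 9 * B.card ≤ 2 * Z.card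

/-- `c` is a Hamiltonian cycle of `L` with successor function `f`. -/
structure IsCyc [DecidableEq V] (G : SimpleGraph V) (L : Finset V) (f : V → V) (c : List V) :
    Prop where
  ham : IsHam G L c
  close : ∀ x ∈ c.head?, ∀ y ∈ c.getLast?, G.Adj y x
  succ : ⇑c.formPerm = f

variable {G : SimpleGraph V}

section IsCyc
variable [DecidableEq V] {L : Finset V} {f : V → V} {c : List V}

/-- The successor function is invariant under cyclic shifts, so the list may be cut wherever an
exchange needs it. -/
lemma IsCyc.rotate {X Y : List V} (h : IsCyc G L f (X ++ Y)) : IsCyc G L f (Y ++ X) := by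
  rcases eq_or_ne X [] with rfl | hX
  · simpa using h
  rcases eq_or_ne Y [] with rfl | hY
  · simpa using h
  have p : (Y ++ X).Perm (X ++ Y) := List.perm_append_comm
  have hch := List.isChain_append.1 h.ham.chain
  refine ⟨⟨?_, p.nodup_iff.2 h.ham.nodup, fun v => p.mem_iff.trans (h.ham.mem v)⟩, ?_, ?_⟩
  · refine hch.2.1.append hch.1 fun x hx y hy => h.close y ?_ x ?_
    · rwa [List.head?_append_of_ne_nil _ hX]
    · rwa [List.getLast?_append_of_ne_nil _ hY]
  · intro x hx y hy
    rw [List.head?_append_of_ne_nil _ hY] at hx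
    rw [List.getLast?_append_of_ne_nil _ hX] at hy
    exact hch.2.2 y hy x hx
  · rw [← h.succ]
    have hr : (X ++ Y) ~r (Y ++ X) := List.isRotated_append
    exact congrArg _ (List.formPerm_eq_of_isRotated h.ham.nodup hr).symm

lemma IsCyc.succ_eq {X Y : List V} {a b : V} (h : IsCyc G L f (X ++ a :: b :: Y)) : f a = b := by
  have h' := IsCyc.rotate h
  rw [← h'.succ, List.cons_append, List.cons_append]
  have := List.formPerm_apply_head a b (Y ++ X) (by simpa using h'.ham.nodup)
  exact this

lemma IsCyc.exists_append_singleton (h : IsCyc G L f c) {a : V} (ha : a ∈ L) :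
    ∃ l, IsCyc G L f (l ++ [a]) := by
  obtain ⟨X, Y, rfl⟩ := List.append_of_mem ((h.ham.mem a).2 ha)
  have : IsCyc G L f ((X ++ [a]) ++ Y) := by simpa using h
  exact ⟨Y ++ X, by simpa using this.rotate⟩

lemma IsCyc.succ_getLast {l : List V} {x a : V} (h : IsCyc G L f (x :: l ++ [a])) : f a = x := by
  have h2 := IsCyc.rotate (X := x :: l) (Y := [a]) h
  exact IsCyc.succ_eq (X := []) (Y := l) (by simpa using h2)

/-- Cutting a cycle after `a` and after `b`. -/
lemma IsCyc.exists_two_cut (h : IsCyc G L f c) {a b : V} (ha : a ∈ L) (hb : b ∈ L) (hab : a ≠ b) :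
    ∃ X Y, IsCyc G L f ((X ++ [b]) ++ (Y ++ [a])) ∧ f a ∈ (X ++ [b]).head? ∧
      f b ∈ (Y ++ [a]).head? := by
  obtain ⟨l, hl⟩ := h.exists_append_singleton ha
  have hbl : b ∈ l ++ [a] := (hl.ham.mem b).2 hb
  simp only [List.mem_append, List.mem_singleton, hab.symm, or_false] at hbl
  obtain ⟨X, Y, rfl⟩ := List.append_of_mem hbl
  refine ⟨X, Y, by simpa using hl, ?_, ?_⟩
  · match X with
    | [] => simpa using (hl.succ_getLast (l := Y) (x := b)).symm
    | x :: X => simpa using (hl.succ_getLast (l := X ++ b :: Y) (x := x)).symm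
  · match Y with
    | [] => simpa using (IsCyc.succ_eq (X := X) (Y := []) (by simpa using hl)).symm
    | y :: Y => simpa using (IsCyc.succ_eq (X := X) (Y := Y ++ [a]) (b := y) (by simpa using hl)).symm

lemma IsCyc.adj_succ (h : IsCyc G L f c) (h2 : 2 ≤ L.card) {a : V} (ha : a ∈ L) :
    G.Adj a (f a) := by
  obtain ⟨l, hl⟩ := h.exists_append_singleton ha
  match l with
  | [] =>
    have : ∀ v, v ∈ L ↔ v = a := fun v => by rw [← hl.ham.mem]; simp
    have : L = {a} := by ext v; simp [this]
    simp [this] at h2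
  | x :: l =>
    rw [hl.succ_getLast]
    exact hl.close x (by simp) a (by rw [List.getLast?_append_of_ne_nil _ (by simp)]; simp)

lemma IsCyc.succ_mem (h : IsCyc G L f c) {a : V} (ha : a ∈ L) : f a ∈ L := by
  rw [← h.succ, ← h.ham.mem]
  exact List.formPerm_apply_mem_of_mem ((h.ham.mem a).2 ha)

lemma IsCyc.injective (h : IsCyc G L f c) : Function.Injective f := by
  rw [← h.succ]; exact Equiv.injective _

/-- The path from the successor of `a` to `a`. -/
lemma IsCyc.exists_path (h : IsCyc G L f c) {a : V} (ha : a ∈ L) :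
    ∃ l, IsHam G L l ∧ f a ∈ l.head? ∧ a ∈ l.getLast? := by
  obtain ⟨l, hl⟩ := h.exists_append_singleton ha
  refine ⟨_, hl.ham, ?_, by simp⟩
  match l with
  | [] =>
    rw [← hl.succ]; simp
  | x :: l => simpa using hl.succ_getLast.symm

/-- Exchanging edges: a chord `ab` gives a path between the successors of `a` and `b`. -/
lemma IsCyc.exists_path_of_adj (h : IsCyc G L f c) {a b : V} (ha : a ∈ L) (hb : b ∈ L)
    (hab : G.Adj a b) : ∃ l, IsHam G L l ∧ f a ∈ l.head? ∧ f b ∈ l.getLast? := by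
  obtain ⟨X, Y, hc, h1, h2⟩ := h.exists_two_cut ha hb hab.ne
  have hch := List.isChain_append.1 hc.ham.chain
  refine ⟨(X ++ [b]) ++ (Y ++ [a]).reverse, hc.ham.of_perm ?_ ?_, ?_, ?_⟩
  · refine hch.1.append (isChain_reverse_adj hch.2.1) ?_
    simpa using hab.symm
  · exact List.Perm.append_left _ (List.reverse_perm _)
  · rwa [List.head?_append_of_ne_nil _ (by simp)]
  · rwa [List.getLast?_append_of_ne_nil _ (by simp), List.getLast?_reverse]

/-- Exchanging edges: a chord between the successors of `a` and `b` gives a path between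
`b` and `a`. -/
lemma IsCyc.exists_path_of_adj_succ (h : IsCyc G L f c) {a b : V} (ha : a ∈ L) (hb : b ∈ L)
    (hab : G.Adj (f a) (f b)) : ∃ l, IsHam G L l ∧ b ∈ l.head? ∧ a ∈ l.getLast? := by
  obtain ⟨X, Y, hc, h1, h2⟩ := h.exists_two_cut ha hb (fun e => hab.ne (by rw [e]))
  have hch := List.isChain_append.1 hc.ham.chain
  refine ⟨(X ++ [b]).reverse ++ (Y ++ [a]), hc.ham.of_perm ?_ ?_, by simp, ?_⟩
  · refine (isChain_reverse_adj hch.1).append hch.2.1 fun x hx y hy => ?_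
    rw [List.getLast?_reverse] at hx
    rw [Option.mem_unique hx h1, Option.mem_unique hy h2]
    exact hab
  · exact List.Perm.append_right _ (List.reverse_perm _)
  · rw [List.getLast?_append_of_ne_nil _ (by simp)]; simp

/-- If the edge from `b` to `f b` can be crossed by the edges from `b` to `f a` and from `f b` to
`f a'`, there is a path between `a` and `a'`. -/
lemma IsCyc.exists_path_of_cross (h : IsCyc G L f c) {a a' b : V} (ha : a ∈ L) (ha' : a' ∈ L)
    (hb : b ∈ L) (haa' : a ≠ a') (hab : a ≠ b) (hab' : a' ≠ b) (h1 : G.Adj b (f a))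
    (h1' : G.Adj b (f a')) (h2 : G.Adj (f b) (f a)) (h2' : G.Adj (f b) (f a')) :
    ∃ l, IsHam G L l ∧ ((a ∈ l.head? ∧ a' ∈ l.getLast?) ∨ (a' ∈ l.head? ∧ a ∈ l.getLast?)) := by
  obtain ⟨l, hl⟩ := h.exists_append_singleton hb
  have hal : a ∈ l ++ [b] := (hl.ham.mem a).2 ha
  have hal' : a' ∈ l ++ [b] := (hl.ham.mem a').2 ha'
  simp only [List.mem_append, List.mem_singleton, hab, hab', or_false] at hal hal'
  -- The cycle consists of the segments from `f b` to `a`, from `f a` to `a'` and from `f a'` to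
  -- `b`. The new path runs from `a` back to `f b`, jumps to `f a'`, runs to `b`, jumps to `f a` and
  -- runs to `a'`.
  have key : ∀ (a a' : V) (X Y W : List V), G.Adj b (f a) → G.Adj (f b) (f a') →
      IsCyc G L f ((X ++ [a]) ++ ((Y ++ [a']) ++ (W ++ [b]))) →
      ∃ l, IsHam G L l ∧ a ∈ l.head? ∧ a' ∈ l.getLast? := by
    intro a a' X Y W h1 h2 hc
    have hfb : f b ∈ (X ++ [a]).head? := by
      match X with
      | [] => simpa using (IsCyc.succ_getLast (l := Y ++ a' :: W) (x := a) (by simpa using hc)).symm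
      | x :: X => simpa using (IsCyc.succ_getLast (l := X ++ a :: Y ++ a' :: W) (x := x)
          (by simpa using hc)).symm
    have hfa : f a ∈ (Y ++ [a']).head? := by
      match Y with
      | [] => simpa using (IsCyc.succ_eq (X := X) (Y := W ++ [b]) (by simpa using hc)).symm
      | y :: Y => simpa using (IsCyc.succ_eq (X := X) (Y := Y ++ a' :: W ++ [b]) (b := y)
          (by simpa using hc)).symm
    have hfa' : f a' ∈ (W ++ [b]).head? := by
      match W with
      | [] => simpa using (IsCyc.succ_eq (X := X ++ a :: Y) (Y := []) (by simpa using hc)).symm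
      | y :: W => simpa using (IsCyc.succ_eq (X := X ++ a :: Y) (Y := W ++ [b]) (b := y)
          (by simpa using hc)).symm
    have hch := List.isChain_append.1 hc.ham.chain
    have hch' := List.isChain_append.1 hch.2.1
    refine ⟨(X ++ [a]).reverse ++ ((W ++ [b]) ++ (Y ++ [a'])), hc.ham.of_perm ?_ ?_, by simp, ?_⟩
    · refine (isChain_reverse_adj hch.1).append (hch'.2.1.append hch'.1 ?_) ?_
      · intro x hx y hy
        rw [Option.mem_unique hy hfa]
        simp only [List.getLast?_append, List.getLast?_singleton, Option.some_or,
          Option.mem_def, Option.some.injEq] at hx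
        exact hx ▸ h1
      · intro x hx y hy
        rw [List.getLast?_reverse] at hx
        rw [List.head?_append_of_ne_nil _ (by simp)] at hy
        rw [Option.mem_unique hx hfb, Option.mem_unique hy hfa']
        exact h2
    · exact (List.reverse_perm _).append List.perm_append_comm
    · rw [List.getLast?_append_of_ne_nil _ (by simp), List.getLast?_append_of_ne_nil _ (by simp)]
      simp
  obtain ⟨X, Y, rfl⟩ := List.append_of_mem hal
  simp only [List.mem_append, List.mem_cons, haa'.symm, false_or] at hal'
  rcases hal' with hm | hm
  · obtain ⟨X, W, rfl⟩ := List.append_of_mem hm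
    obtain ⟨l, hl, e1, e2⟩ := key a' a X W Y h1' h2 (by simpa using hl)
    exact ⟨l, hl, .inr ⟨e1, e2⟩⟩
  · obtain ⟨Y, W, rfl⟩ := List.append_of_mem hm
    obtain ⟨l, hl, e1, e2⟩ := key a a' X Y W h1 h2' (by simpa using hl)
    exact ⟨l, hl, .inl ⟨e1, e2⟩⟩

/-- If the successor `f b` of `b` can be moved in front of `f a`, there is a path between `f b` and
`a`. -/
lemma IsCyc.exists_path_of_move (h : IsCyc G L f c) {a b : V} (ha : a ∈ L) (hb : b ∈ L)
    (hab : a ≠ b) (hab' : f b ≠ a) (h1 : G.Adj (f b) (f a)) (h2 : G.Adj b (f (f b))) :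
    ∃ l, IsHam G L l ∧ f b ∈ l.head? ∧ a ∈ l.getLast? := by
  obtain ⟨X, Y, hc, e1, e2⟩ := h.exists_two_cut hb ha hab.symm
  match X with
  | [] =>
    simp only [List.nil_append, List.head?_cons, Option.mem_def, Option.some.injEq] at e1
    exact absurd e1.symm hab'
  | x :: X =>
    simp only [List.cons_append, List.head?_cons, Option.mem_def, Option.some.injEq] at e1
    subst e1
    have hf : f (f b) ∈ (X ++ [a]).head? := by
      match X with
      | [] => simpa using (IsCyc.succ_eq (X := []) (Y := Y ++ [b]) (by simpa using hc)).symm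
      | x :: X => simpa using (IsCyc.succ_eq (X := []) (Y := X ++ [a] ++ Y ++ [b]) (b := x)
          (by simpa using hc)).symm
    have hch := List.isChain_append.1 hc.ham.chain
    have hchX : (X ++ [a]).IsChain G.Adj := (List.isChain_cons.1 hch.1).2
    -- The new path is `f b`, then `f a` up to `b`, then `f (f b)` up to `a`.
    refine ⟨f b :: ((Y ++ [b]) ++ (X ++ [a])), hc.ham.of_perm ?_ ?_, by simp, ?_⟩
    · refine List.isChain_cons.2 ⟨fun y hy => ?_, hch.2.1.append hchX fun x hx y hy => ?_⟩
      · rw [List.head?_append_of_ne_nil _ (by simp)] at hy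
        rw [Option.mem_unique hy e2]; exact h1
      · simp only [List.getLast?_append, List.getLast?_singleton, Option.some_or,
          Option.mem_def, Option.some.injEq] at hx
        rw [Option.mem_unique hy hf]; exact hx ▸ h2
    · exact List.Perm.cons _ List.perm_append_comm
    · rw [← List.cons_append, List.getLast?_append_of_ne_nil _ (by simp)]; simp

lemma IsBlock.exists_isCyc {K : Finset V} (h : IsBlock G K) (hK : 2 ≤ K.card) :
    ∃ f c, IsCyc G K f c := by
  obtain ⟨x, l, h, hc⟩ := h
  refine ⟨_, x :: l, h, ?_, rfl⟩
  rcases eq_or_ne l [] with rfl | hl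
  · have : K = {x} := by ext v; rw [← h.mem]; simp
    simp [this] at hK
  · intro x' hx' y hy
    simp only [List.head?_cons, Option.mem_def, Option.some.injEq] at hx'
    subst hx'
    refine hc y ?_
    rw [List.getLast?_cons] at hy
    rw [List.getLast?_eq_some_getLast hl] at hy ⊢
    simpa using hy

end IsCyc
end ToughGraph

/-! ### Hamiltonian paths of a component with ends extendable to distinct vertices of `S`. -/

namespace ToughGraph
variable {V : Type*} {ι : Type*}
variable {G : SimpleGraph V}

/-- Components of the complement of `G[Q]`. -/
lemma exists_coComponent [DecidableEq V] (G : SimpleGraph V) (Q : Finset V) {q0 : V} (h0 : q0 ∈ Q) :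
    ∃ Q1 ⊆ Q, q0 ∈ Q1 ∧ (∀ q ∈ Q1, ∀ b ∈ Q, b ∉ Q1 → G.Adj q b) ∧
      ∀ P : V → Prop, (∃ q ∈ Q1, P q) → (∀ q ∈ Q1, ∀ q' ∈ Q1, ¬ G.Adj q q' → P q → P q') →
        ∀ q ∈ Q1, P q := by
  classical
  let R : V → V → Prop := fun x y => x ∈ Q ∧ y ∈ Q ∧ ¬ G.Adj x y
  have hsymm : ∀ x y, R x y → R y x := fun x y h => ⟨h.2.1, h.1, fun e => h.2.2 e.symm⟩
  have hsym : ∀ x y, Relation.ReflTransGen R x y → Relation.ReflTransGen R y x := by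
    intro x y h
    induction h with
    | refl => exact .refl
    | tail _ h ih => exact .head (hsymm _ _ h) ih
  refine ⟨Q.filter fun q => Relation.ReflTransGen R q0 q, Finset.filter_subset _ _,
    Finset.mem_filter.2 ⟨h0, .refl⟩, ?_, ?_⟩
  · intro q hq b hb hb'
    rw [Finset.mem_filter] at hq hb'
    by_contra hqb
    exact hb' ⟨hb, hq.2.tail ⟨hq.1, hb, hqb⟩⟩
  · rintro P ⟨q1, hq1, hP⟩ hstep q hq
    rw [Finset.mem_filter] at hq1 hq
    have h1 : Relation.ReflTransGen R q1 q := (hsym _ _ hq1.2).trans hq.2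
    clear hq
    have : P q ∧ Relation.ReflTransGen R q0 q := by
      induction h1 with
      | refl => exact ⟨hP, hq1.2⟩
      | @tail b c _ h ih =>
        have hc := ih.2.tail h
        exact ⟨hstep b (Finset.mem_filter.2 ⟨h.1, ih.2⟩) c (Finset.mem_filter.2 ⟨h.2.1, hc⟩) h.2.2 ih.1,
          hc⟩
    exact this.1

/-- A path that alternates between the members of a system of `Q` and the vertices of `L \ Q`. -/
lemma exists_ham_alternate [DecidableEq V] {L Q : Finset V} (hQ : Q ⊆ L)
    (hQZ : ∀ q ∈ Q, ∀ z ∈ L \ Q, G.Adj q z) {P : List (List V)} (hP : IsSystem G Q P)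
    (hc : P.length = (L \ Q).card - 1) {a a' : V} (ha : a ∈ L \ Q) (ha' : a' ∈ L \ Q)
    (hne : a' ≠ a) : ∃ l, IsHam G L l ∧ a ∈ l.head? ∧ a' ∈ l.getLast? := by
  obtain ⟨Z, hZ⟩ : ∃ Z, Z = L \ Q := ⟨_, rfl⟩
  have memZ : ∀ v, v ∈ Z ↔ v ∈ L ∧ v ∉ Q := fun v => by rw [hZ, Finset.mem_sdiff]
  have hcard : Z.card + Q.card = L.card := by rw [hZ, Finset.card_sdiff_add_card_eq_card hQ]
  rw [← hZ] at hQZ hc ha ha'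
  clear hZ
  have hZ2 : 2 ≤ Z.card := Finset.one_lt_card.2 ⟨a, ha, a', ha', hne.symm⟩
  obtain ⟨q, P, rfl⟩ : ∃ q P', P = q :: P' := by
    cases P with
    | nil => simp at hc; omega
    | cons q P => exact ⟨_, _, rfl⟩
  obtain ⟨zs, hzs⟩ : ∃ zs, zs = ((Z.erase a).erase a').toList := ⟨_, rfl⟩
  have memzs : ∀ v, v ∈ zs ↔ v ≠ a' ∧ v ≠ a ∧ v ∈ Z := fun v => by simp [hzs]
  have hcz : zs.length = Z.card - 2 := by
    rw [hzs, Finset.length_toList, Finset.card_erase_of_mem (Finset.mem_erase.2 ⟨hne, ha'⟩),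
      Finset.card_erase_of_mem ha]
    omega
  clear hzs
  have hqne : q ≠ [] := hP.ne q (by simp)
  have hqQ : ∀ v ∈ q, v ∈ Q := fun v hv => (hP.mem v).1 (by simp [hv])
  have hfl : (zs.map fun z => [z]).flatten = zs := by
    clear memzs hcz
    induction zs with
    | nil => rfl
    | cons z l ih => simpa using ih
  simp only [List.length_cons] at hc
  -- The path `q` is reserved for the place just before `a'`. The other `Z.card - 2` paths alternate
  -- with the vertices of `Z` other than `a` and `a'`.
  obtain ⟨d, d1, d2, d3, d4⟩ := exists_interleave hQZ P (zs.map fun z => [z])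
    (by rw [List.length_map, hcz]; omega) (fun l hl => hP.ne l (by simp [hl]))
    (fun l hl => by obtain ⟨z, -, rfl⟩ := List.mem_map.1 hl; simp)
    (fun l hl => hP.chain l (by simp [hl]))
    (fun l hl => by obtain ⟨z, -, rfl⟩ := List.mem_map.1 hl; simp)
    (fun v hv => (hP.mem v).1 (by simp only [List.flatten_cons, List.mem_append, hv, or_true]))
    (fun v hv => by rw [hfl] at hv; exact ((memzs v).1 hv).2.2)
  rw [hfl] at d2
  have hmem : ∀ v, v ∈ a :: (d ++ (q ++ [a'])) ↔ v ∈ L := by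
    intro v
    have hv := hP.mem v
    have hvL := (memZ v)
    have haL := ((memZ a).1 ha).1
    have haL' := ((memZ a').1 ha').1
    have hQv : v ∈ Q → v ∈ L := fun h => hQ h
    rw [List.flatten_cons, List.mem_append] at hv
    rw [List.mem_cons, List.mem_append, List.mem_append, List.mem_singleton, d2.mem_iff,
      List.mem_append, memzs]
    by_cases h1 : v = a
    · simp [h1, haL]
    by_cases h2 : v = a'
    · simp [h2, haL']
    tauto
  have hlen : (a :: (d ++ (q ++ [a']))).length = L.card := by
    have e1 := hP.length_flatten
    have e3 := d2.length_eq
    rw [List.flatten_cons, List.length_append] at e1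
    rw [List.length_append, hcz] at e3
    rw [List.length_cons, List.length_append, List.length_append, List.length_singleton]
    omega
  refine ⟨a :: (d ++ (q ++ [a'])), ⟨?_, ?_, hmem⟩, by simp, ?_⟩
  · have hq : (q ++ [a']).IsChain G.Adj := by
      refine (hP.chain q (by simp)).append (by simp) fun x hx y hy => ?_
      simp only [List.head?_cons, Option.mem_def, Option.some.injEq] at hy
      subst hy
      exact hQZ x (hqQ x (List.mem_of_getLast? hx)) a' ha'
    have hqh : ∀ y ∈ (q ++ [a']).head?, y ∈ Q := by
      intro y hy
      rw [List.head?_append_of_ne_nil _ hqne] at hy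
      exact hqQ y (List.mem_of_head? hy)
    refine List.isChain_cons.2 ⟨fun y hy => ?_, d1.append hq fun x hx y hy =>
      (hQZ y (hqh y hy) x (d4 x hx)).symm⟩
    rcases eq_or_ne d [] with rfl | hd
    · exact (hQZ y (hqh y hy) a ha).symm
    · rw [List.head?_append_of_ne_nil _ hd] at hy
      exact (hQZ y (d3 y hy) a ha).symm
  -- There are no repetitions because the list has exactly `L.card` entries and contains all of `L`.
  · rw [← Multiset.coe_nodup, ← Multiset.toFinset_card_eq_card_iff_nodup, Multiset.coe_card, hlen]
    congr 1; ext v; rw [Multiset.mem_toFinset, Multiset.mem_coe, hmem]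
  · rw [← List.cons_append, ← List.append_assoc, List.getLast?_append_of_ne_nil _ (by simp)]
    simp

variable [Fintype V] {S : Finset V} {κ : V → ι}

lemma Setup.not_adj (h : Setup G S κ) {v w : V} (hv : v ∉ S) (hw : w ∉ S) (hne : κ v ≠ κ w) :
    ¬ G.Adj v w := fun e => hne (h.label v hv w hw e)

variable [DecidableEq V]

/-- All remaining vertices outside `Z` together count as one further union of components, which
improves the bound by one. -/
lemma Setup.tough_succ (h : Setup G S κ) (Z : Finset V) (B : Finset (Finset V)) (hB : 1 ≤ B.card)
    (h1 : ∀ K ∈ B, K.Nonempty) (h2 : ∀ K ∈ B, ∀ v ∈ K, v ∉ Z)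
    (h3 : ∀ K ∈ B, ∀ K' ∈ B, K ≠ K' → ∀ v ∈ K, v ∉ K')
    (h4 : ∀ K ∈ B, ∀ v ∈ K, ∀ w, G.Adj v w → w ∈ K ∨ w ∈ Z)
    (h5 : ∃ w, w ∉ Z ∧ ∀ K ∈ B, w ∉ K) : 9 * (B.card + 1) ≤ 2 * Z.card := by
  classical
  let K0 : Finset V := Finset.univ.filter fun w => w ∉ Z ∧ ∀ K ∈ B, w ∉ K
  have hmem : ∀ w, w ∈ K0 ↔ w ∉ Z ∧ ∀ K ∈ B, w ∉ K := fun w => by simp [K0]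
  have hK0 : K0 ∉ B := by
    obtain ⟨w, hw⟩ := h5
    exact fun hK => ((hmem w).1 ((hmem w).2 hw)).2 K0 hK ((hmem w).2 hw)
  rw [← Finset.card_insert_of_notMem hK0]
  apply h.tough
  · rw [Finset.card_insert_of_notMem hK0]; omega
  · intro K hK
    rcases Finset.mem_insert.1 hK with rfl | hK
    · obtain ⟨w, hw⟩ := h5
      exact ⟨w, (hmem w).2 hw⟩
    · exact h1 K hK
  · intro K hK v hv
    rcases Finset.mem_insert.1 hK with rfl | hK
    · exact ((hmem v).1 hv).1
    · exact h2 K hK v hv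
  · intro K hK K' hK' hne v hv hv'
    rcases Finset.mem_insert.1 hK with rfl | hK <;> rcases Finset.mem_insert.1 hK' with rfl | hK'
    · exact hne rfl
    · exact ((hmem v).1 hv).2 K' hK' hv'
    · exact ((hmem v).1 hv').2 K hK hv
    · exact h3 K hK K' hK' hne v hv hv'
  · intro K hK v hv w hvw
    rcases Finset.mem_insert.1 hK with rfl | hK
    · by_contra! hw
      have : ¬ ∀ K ∈ B, w ∉ K := fun hh => hw.1 ((hmem w).2 ⟨hw.2, hh⟩)
      push Not at this
      obtain ⟨K, hK, hwK⟩ := this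
      have hv' := (hmem v).1 hv
      rcases h4 K hK w hwK v hvw.symm with hh | hh
      · exact hv'.2 K hK hh
      · exact hv'.1 hh
    · exact h4 K hK v hv w hvw

omit [DecidableEq V] in
/-- If `s1` has a neighbour `x1` in a component that contains a nonneighbour of `s1` and `x1`, then
it has a common neighbour with each vertex of `S` in another component. -/
lemma Setup.common_nbr (h : Setup G S κ) {s1 s2 x1 x2 : V} (h1 : s1 ∈ S) (h2 : s2 ∈ S)
    (hx1 : x1 ∉ S) (hx2 : x2 ∉ S) (hκ : κ x1 = κ x2) (a1 : G.Adj s1 x1)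
    (n12 : ¬ G.Adj s1 x2) (nx : ¬ G.Adj x1 x2) :
    ∃ y, y ∉ S ∧ κ y ≠ κ x1 ∧ G.Adj s1 y ∧ G.Adj s2 y := by
  by_contra! H
  obtain ⟨w, hw, hκw⟩ := h.other x1 hx1
  obtain ⟨y1, hy1, k1, b1⟩ := h.nbr s1 h1 w hw
  obtain ⟨y2, hy2, k2, b2⟩ := h.nbr s2 h2 w hw
  have c1 : κ y1 ≠ κ x1 := by rwa [k1]
  have c2 : κ y2 ≠ κ x1 := by rwa [k2]
  have d2 : ¬ G.Adj s2 y1 := H y1 hy1 c1 b1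
  have d1 : ¬ G.Adj s1 y2 := fun e => H y2 hy2 c2 e b2
  obtain ⟨x, hx, x', hx', kx, kx', ax, nax', axx'⟩ := h.cross (fun v => G.Adj s1 v) x1 hx1 x2 hx2 hκ
    a1 n12
  -- If `y1`, `y2` are nonadjacent, x', x, s1, y1 is an induced P₄ missing `y2`; if they are
  -- adjacent, x1, s1, y1, y2 is one missing `x2`.
  have hyy : G.Adj y2 y1 := by
    by_contra hy
    refine h.false_of_P4P1 x' x s1 y1 y2 axx'.symm ax.symm b1 (fun e => nax' e.symm)
      (h.not_adj hx hy1 (by rw [kx]; exact c1.symm)) (h.not_adj hx' hy1 (by rw [kx']; exact c1.symm))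
      (h.not_adj hy2 hx' (by rw [kx']; exact c2)) (h.not_adj hy2 hx (by rw [kx]; exact c2))
      (fun e => d1 e.symm) hy
  exact h.false_of_P4P1 x1 s1 y1 y2 x2 a1.symm b1 hyy.symm (h.not_adj hx1 hy1 c1.symm) d1
    (h.not_adj hx1 hy2 c2.symm) (fun e => nx e.symm) (fun e => n12 e.symm)
    (h.not_adj hx2 hy1 (by rw [← hκ]; exact c1.symm))
    (h.not_adj hx2 hy2 (by rw [← hκ]; exact c2.symm))

/-- In a component spanned by a block, there is a Hamiltonian path that can be extended at both
ends to prescribed vertices of `S`. -/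
theorem Setup.exists_ham_of_class (h : Setup G S κ) {L : Finset V} {i : ι}
    (hL : ∀ v, v ∈ L ↔ v ∉ S ∧ κ v = i) (hblock : IsBlock G L) {S' : Finset V} (hS' : S' ⊆ S)
    (hcard : (S \ S').card ≤ 2) :
    ∃ l, IsHam G L l ∧ ∃ x ∈ l.head?, ∃ y ∈ l.getLast?, ∃ s ∈ S', ∃ s' ∈ S', s ≠ s' ∧ G.Adj s x ∧
      G.Adj s' y := by
  classical
  by_contra! hno
  obtain ⟨v0, hv0⟩ := hblock.nonempty
  have hv0' := (hL v0).1 hv0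
  obtain ⟨w0, hw0, hκw0⟩ := h.other v0 hv0'.1
  rw [hv0'.2] at hκw0
  have hw0L : w0 ∉ L := fun hw => hκw0 ((hL w0).1 hw).2
  have hLS : ∀ v ∈ L, v ∉ S := fun v hv => ((hL v).1 hv).1
  have hnbrL : ∀ v ∈ L, ∀ w, G.Adj v w → w ∈ L ∨ w ∈ S := by
    intro v hv w hvw
    by_cases hw : w ∈ S
    · exact .inr hw
    · left
      rw [hL] at hv ⊢
      exact ⟨hw, (h.label v hv.1 w hw hvw).symm.trans hv.2⟩
  have hSL : ∀ s ∈ S, ∃ x ∈ L, G.Adj s x := by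
    intro s hs
    obtain ⟨x, hx, k, a⟩ := h.nbr s hs v0 hv0'.1
    exact ⟨x, (hL x).2 ⟨hx, k.trans hv0'.2⟩, a⟩
  have hnotL : ∀ v ∈ L, ∀ y, y ∉ S → κ y ≠ i → ¬ G.Adj v y := by
    intro v hv y hy hk
    exact h.not_adj (hLS v hv) hy (by rw [((hL v).1 hv).2]; exact hk.symm)
  -- Deleting `S` leaves `L` and something else, so toughness gives 18 ≤ 2|S|.
  have hScard : 9 ≤ S.card := by
    have := h.tough_succ S {L} (by simp) (by simpa using ⟨v0, hv0⟩) (by simpa using hLS)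
      (by simp only [Finset.mem_singleton]; rintro K rfl K' rfl h; exact absurd rfl h)
      (by simpa using hnbrL) ⟨w0, hw0, by simpa using hw0L⟩
    simp at this; omega
  have hS'card : 7 ≤ S'.card := by
    have := Finset.card_sdiff_add_card_eq_card hS'; omega
  by_cases hL2 : 2 ≤ L.card
  swap
  · have hpos : 0 < L.card := Finset.card_pos.2 ⟨v0, hv0⟩
    obtain ⟨x, hx⟩ := Finset.card_eq_one.1 (show L.card = 1 by omega)
    obtain ⟨s, hs, s', hs', hne⟩ := Finset.one_lt_card.1 (show 1 < S'.card by omega)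
    obtain ⟨y, hy, hsy⟩ := hSL s (hS' hs)
    obtain ⟨y', hy', hsy'⟩ := hSL s' (hS' hs')
    rw [hx, Finset.mem_singleton] at hy hy'
    subst hy hy'
    exact hno [y'] ⟨by simp, by simp, by simp [hx]⟩ y' (by simp) y' (by simp) s hs s' hs' hne hsy hsy'
  obtain ⟨f, c, hc⟩ := hblock.exists_isCyc hL2
  have hadjf : ∀ v ∈ L, G.Adj v (f v) := fun v hv => hc.adj_succ hL2 hv
  have hfL : ∀ v ∈ L, f v ∈ L := fun v hv => hc.succ_mem hv
  -- no Hamiltonian path has ends with different neighbours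
  have hno' : ∀ l x y, IsHam G L l → x ∈ l.head? → y ∈ l.getLast? → ∀ s ∈ S', ∀ s' ∈ S',
      G.Adj s x → G.Adj s' y → s = s' := by
    intro l x y hl hx hy s hs s' hs' h1 h2
    by_contra hne
    exact hno l hl x hx y hy s hs s' hs' hne h1 h2
  have hsucc : ∀ v ∈ L, ∀ s ∈ S', ∀ s' ∈ S', G.Adj s v → G.Adj s' (f v) → s = s' := by
    intro v hv s hs s' hs' h1 h2
    obtain ⟨l, hl, e1, e2⟩ := hc.exists_path hv
    exact (hno' l _ _ hl e1 e2 s' hs' s hs h2 h1).symm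
  -- Three bad vertices are impossible. By exchanges, `v1`, `v2`, `v3` are pairwise nonadjacent and
  -- the relevant cross adjacencies to `s1`, `s2` are absent. Then v1, s1, s2, v2, or v1, s1, y, s2
  -- with a common neighbour `y` in another component, is an induced P₄ missing `v3`.
  let Bad := S'.filter fun s => ∃ v ∈ L, G.Adj s v ∧ G.Adj s (f v)
  have hBad : Bad.card ≤ 2 := by
    by_contra! hB
    obtain ⟨s1, s2, s3, m1, m2, m3, d12, d13, d23⟩ := Finset.two_lt_card_iff.1 hB
    simp only [Bad, Finset.mem_filter] at m1 m2 m3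
    obtain ⟨hs1, v1, hv1, a1, b1⟩ := m1
    obtain ⟨hs2, v2, hv2, a2, b2⟩ := m2
    obtain ⟨hs3, v3, hv3, a3, b3⟩ := m3
    have cross : ∀ {s s' v}, s ∈ S' → s' ∈ S' → s ≠ s' → v ∈ L → G.Adj s v → G.Adj s (f v) →
        ¬ G.Adj s' v := fun hs hs' hne hv a b e => hne (hsucc _ hv _ hs' _ hs e b).symm
    have nonadj : ∀ {s s' v v'}, s ∈ S' → s' ∈ S' → s ≠ s' → v ∈ L → v' ∈ L → G.Adj s (f v) →
        G.Adj s' (f v') → ¬ G.Adj v v' := by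
      intro s s' v v' hs hs' hne hv hv' a b e
      obtain ⟨l, hl, e1, e2⟩ := hc.exists_path_of_adj hv hv' e
      exact hne (hno' l _ _ hl e1 e2 s hs s' hs' a b)
    have n12 := cross hs2 hs1 d12.symm hv2 a2 b2
    have n21 := cross hs1 hs2 d12 hv1 a1 b1
    have n13 := cross hs3 hs1 d13.symm hv3 a3 b3
    have n23 := cross hs3 hs2 d23.symm hv3 a3 b3
    have m12 := nonadj hs1 hs2 d12 hv1 hv2 b1 b2
    have m13 := nonadj hs1 hs3 d13 hv1 hv3 b1 b3
    have m23 := nonadj hs2 hs3 d23 hv2 hv3 b2 b3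
    by_cases hss : G.Adj s1 s2
    · exact h.false_of_P4P1 v1 s1 s2 v2 v3 a1.symm hss a2 (fun e => n21 e.symm) n12 m12
        (fun e => m13 e.symm) (fun e => n13 e.symm) (fun e => n23 e.symm) (fun e => m23 e.symm)
    · have k1 := (hL v1).1 hv1
      have k2 := (hL v2).1 hv2
      obtain ⟨y, hy, hκy, e1, e2⟩ := h.common_nbr (hS' hs1) (hS' hs2) k1.1 k2.1
        (k1.2.trans k2.2.symm) a1 n12 m12
      rw [k1.2] at hκy
      exact h.false_of_P4P1 v1 s1 y s2 v3 a1.symm e1 e2.symm (hnotL v1 hv1 y hy hκy) hss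
        (fun e => n21 e.symm) (fun e => m13 e.symm) (fun e => n13 e.symm) (hnotL v3 hv3 y hy hκy)
        (fun e => n23 e.symm)
  let S'' := S' \ Bad
  have hS''S' : S'' ⊆ S' := Finset.sdiff_subset
  have hS''card : 5 ≤ S''.card := by
    have : S''.card + Bad.card = S'.card :=
      Finset.card_sdiff_add_card_eq_card (Finset.filter_subset _ _)
    omega
  have hSS'' : (S \ S'').card ≤ 4 := by
    have e1 : (S \ S'').card + S''.card = S.card :=
      Finset.card_sdiff_add_card_eq_card (hS''S'.trans hS')
    have e2 : (S \ S').card + S'.card = S.card := Finset.card_sdiff_add_card_eq_card hS'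
    have e3 : S''.card + Bad.card = S'.card :=
      Finset.card_sdiff_add_card_eq_card (Finset.filter_subset _ _)
    omega
  have hgood : ∀ s ∈ S'', ∀ v ∈ L, G.Adj s v → ¬ G.Adj s (f v) := by
    intro s hs v hv h1 h2
    simp only [S'', Finset.mem_sdiff, Bad, Finset.mem_filter] at hs
    exact hs.2 ⟨hs.1, v, hv, h1, h2⟩
  -- No vertex of `A` is followed by another one on the cycle: distinct neighbours of the two would
  -- give a forbidden path, and a shared neighbour would be bad.
  let A := L.filter fun v => ∃ s ∈ S'', G.Adj s v
  let Q := L \ A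
  have hAL : A ⊆ L := Finset.filter_subset _ _
  have hQL : Q ⊆ L := Finset.sdiff_subset
  have memA : ∀ v, v ∈ A ↔ v ∈ L ∧ ∃ s ∈ S'', G.Adj s v := fun v => Finset.mem_filter
  have hQS : ∀ q ∈ Q, ∀ s ∈ S'', ¬ G.Adj s q := by
    intro q hq s hs e
    rw [Finset.mem_sdiff] at hq
    exact hq.2 ((memA q).2 ⟨hq.1, s, hs, e⟩)
  have hfA : ∀ a ∈ A, f a ∈ Q := by
    intro a ha
    obtain ⟨haL, s, hs, hsa⟩ := (memA a).1 ha
    refine Finset.mem_sdiff.2 ⟨hfL a haL, fun hfa => ?_⟩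
    obtain ⟨-, s', hs', hsa'⟩ := (memA _).1 hfa
    have := hsucc a haL s (hS''S' hs) s' (hS''S' hs') hsa hsa'
    subst this
    exact hgood s hs a haL hsa hsa'
  have hSA : ∀ s ∈ S'', ∃ a ∈ A, G.Adj s a := by
    intro s hs
    obtain ⟨x, hx, a⟩ := hSL s (hS' (hS''S' hs))
    exact ⟨x, (memA x).2 ⟨hx, s, hs, a⟩, a⟩
  obtain ⟨s0, hs0⟩ : S''.Nonempty := Finset.card_pos.1 (by omega)
  obtain ⟨a0, ha0, hs0a0⟩ := hSA s0 hs0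
  -- toughness, applied to sets of blocks inside `Q`
  have htough : ∀ (Z : Finset V) (B : Finset (Finset V)), 1 ≤ B.card → (∀ K ∈ B, K.Nonempty) →
      (∀ K ∈ B, K ⊆ Q) → (∀ K ∈ B, ∀ v ∈ K, v ∉ Z) → Z ⊆ L →
      (∀ K ∈ B, ∀ K' ∈ B, K ≠ K' → ∀ v ∈ K, v ∉ K') →
      (∀ K ∈ B, ∀ v ∈ K, ∀ w ∈ L, G.Adj v w → w ∈ K ∨ w ∈ Z) →
      9 * (B.card + 1) ≤ 2 * (Z.card + 4) := by
    intro Z B hB h1 h2 h3 hZ h4 h5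
    have := h.tough_succ (Z ∪ (S \ S'')) B hB h1 ?_ h4 ?_ ⟨w0, ?_, ?_⟩
    · have := Finset.card_union_le Z (S \ S'')
      omega
    · intro K hK v hv hvZ
      rcases Finset.mem_union.1 hvZ with hvZ | hvZ
      · exact h3 K hK v hv hvZ
      · exact hLS v (hQL (h2 K hK hv)) (Finset.mem_sdiff.1 hvZ).1
    · intro K hK v hv w hvw
      rcases hnbrL v (hQL (h2 K hK hv)) w hvw with hw | hw
      · rcases h5 K hK v hv w hw hvw with hh | hh
        · exact .inl hh
        · exact .inr (by simp [hh])
      · by_cases hw'' : w ∈ S''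
        · exact absurd hvw.symm (hQS v (h2 K hK hv) w hw'')
        · exact .inr (by simp [hw, hw''])
    · simp only [Finset.mem_union, Finset.mem_sdiff, not_or]
      exact ⟨fun hw => hw0L (hZ hw), fun hw => hw0 hw.1⟩
    · exact fun K hK hw => hw0L (hQL (h2 K hK hw))
  have hAcard : 2 ≤ A.card := by
    have := htough A {Q} (by simp) (by simpa using ⟨f a0, hfA a0 ha0⟩) (by simp)
      (by simp [Q]) hAL
      (by simp only [Finset.mem_singleton]; rintro K rfl K' rfl h; exact absurd rfl h)
      (by
        simp only [Finset.mem_singleton, forall_eq]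
        intro v hv w hw _
        by_cases hwA : w ∈ A
        · exact .inr hwA
        · exact .inl (Finset.mem_sdiff.2 ⟨hw, hwA⟩))
    simp at this; omega
  let Compat : V → V → Prop := fun a a' => ∃ s ∈ S'', ∃ s' ∈ S'', s ≠ s' ∧ G.Adj s a ∧ G.Adj s' a'
  have hnoC : ∀ l x y, IsHam G L l → x ∈ l.head? → y ∈ l.getLast? → ¬ Compat x y := by
    rintro l x y hl hx hy ⟨s, hs, s', hs', hne, h1, h2⟩
    exact hne (hno' l x y hl hx hy s (hS''S' hs) s' (hS''S' hs') h1 h2)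
  have hCsymm : ∀ a a', Compat a a' → Compat a' a := by
    rintro a a' ⟨s, hs, s', hs', hne, h1, h2⟩
    exact ⟨s', hs', s, hs, hne.symm, h2, h1⟩
  -- If another vertex `a'` of `A` shares its chosen neighbour with `a`, a second vertex of `S''`
  -- and a neighbour of it in `A` resolve the tie.
  have hexC : ∀ a ∈ A, ∃ a' ∈ A, a' ≠ a ∧ Compat a a' := by
    intro a ha
    obtain ⟨a', ha', hne⟩ := Finset.exists_mem_ne (s := A) (by omega) a
    obtain ⟨-, s, hs, hsa⟩ := (memA a).1 ha
    obtain ⟨-, s', hs', hsa'⟩ := (memA a').1 ha'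
    by_cases hss : s = s'
    · subst hss
      obtain ⟨s2, hs2, hne2⟩ := Finset.exists_mem_ne (s := S'') (by omega) s
      obtain ⟨a2, ha2, hsa2⟩ := hSA s2 hs2
      by_cases h2 : a2 = a
      · subst h2
        exact ⟨a', ha', hne, s2, hs2, s, hs, hne2, hsa2, hsa'⟩
      · exact ⟨a2, ha2, h2, s, hs, s2, hs2, hne2.symm, hsa, hsa2⟩
    · exact ⟨a', ha', hne, s, hs, s', hs', hss, hsa, hsa'⟩
  -- Otherwise q, x, s, y with `y` in another component is an induced P₄ missing `q'`.
  have hstar : ∀ x ∈ A, ∀ q ∈ Q, G.Adj x q → ∀ q' ∈ Q, ¬ G.Adj q q' → G.Adj x q' := by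
    intro x hx q hq hxq q' hq' hqq'
    by_contra hxq'
    obtain ⟨hxL, s, hs, hsx⟩ := (memA x).1 hx
    obtain ⟨y, hy, hκy, hsy⟩ := h.nbr s (hS' (hS''S' hs)) w0 hw0
    rw [← hκy] at hκw0
    exact h.false_of_P4P1 q x s y q' hxq.symm hsx.symm hsy (fun e => hQS q hq s hs e.symm)
      (hnotL x hxL y hy hκw0) (hnotL q (hQL hq) y hy hκw0) (fun e => hqq' e.symm)
      (fun e => hxq' e.symm) (fun e => hQS q' hq' s hs e.symm) (hnotL q' (hQL hq') y hy hκw0)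
  have hCf : ∀ a ∈ A, ∀ a' ∈ A, Compat a a' → ¬ G.Adj (f a) (f a') := by
    intro a ha a' ha' hC e
    obtain ⟨l, hl, e1, e2⟩ := hc.exists_path_of_adj_succ (hAL ha) (hAL ha') e
    exact hnoC l _ _ hl e1 e2 (hCsymm _ _ hC)
  -- Successors of compatible vertices are nonadjacent, so they lie in one component of the
  -- complement of G[Q]. This puts all successors of `A` into `Q1`, and `hstar` then spreads
  -- adjacency from them over all of `Q1`.
  obtain ⟨Q1, hQ1Q, hf0, hQ1a, hQ1b⟩ := exists_coComponent G Q (hfA a0 ha0)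
  have hQ1c : ∀ a ∈ A, ∀ a' ∈ A, Compat a a' → f a ∈ Q1 → f a' ∈ Q1 := by
    intro a ha a' ha' hC h1
    by_contra h2
    exact hCf a ha a' ha' hC (hQ1a _ h1 _ (hfA a' ha') h2)
  have hfQ1 : ∀ a ∈ A, f a ∈ Q1 := by
    intro a ha
    obtain ⟨-, s, hs, hsa⟩ := (memA a).1 ha
    by_cases hss : s0 = s
    · subst hss
      obtain ⟨s2, hs2, hne2⟩ := Finset.exists_mem_ne (s := S'') (by omega) s0
      obtain ⟨a2, ha2, hsa2⟩ := hSA s2 hs2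
      have := hQ1c a0 ha0 a2 ha2 ⟨s0, hs0, s2, hs2, hne2.symm, hs0a0, hsa2⟩ hf0
      exact hQ1c a2 ha2 a ha ⟨s2, hs2, s0, hs0, hne2, hsa2, hsa⟩ this
    · exact hQ1c a0 ha0 a ha ⟨s0, hs0, s, hs, hss, hs0a0, hsa⟩ hf0
  have hAQ1 : ∀ a ∈ A, ∀ q ∈ Q1, G.Adj a q := by
    intro a ha
    exact hQ1b (fun q => G.Adj a q) ⟨f a, hfQ1 a ha, hadjf a (hAL ha)⟩
      (fun q hq q' hq' hn e => hstar a ha q (hQ1Q hq) e q' (hQ1Q hq') hn)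
  let Z := L \ Q1
  have hQ1L : Q1 ⊆ L := hQ1Q.trans hQL
  have hQZ : ∀ b ∈ L, b ∉ A → b ∉ Q1 → b ∈ Q ∧ ∀ q ∈ Q1, G.Adj b q := by
    intro b hb hbA hbQ1
    have hbQ : b ∈ Q := Finset.mem_sdiff.2 ⟨hb, hbA⟩
    exact ⟨hbQ, fun q hq => (hQ1a q hq b hbQ hbQ1).symm⟩
  have hZQ1 : ∀ q ∈ Q1, ∀ z ∈ Z, G.Adj q z := by
    intro q hq z hz
    rw [Finset.mem_sdiff] at hz
    by_cases hzA : z ∈ A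
    · exact (hAQ1 z hzA q hq).symm
    · exact ((hQZ z hz.1 hzA hz.2).2 q hq).symm
  have hAZ : ∀ a ∈ A, a ∈ Z := fun a ha => Finset.mem_sdiff.2 ⟨hAL ha, fun hq =>
    (Finset.mem_sdiff.1 (hQ1Q hq)).2 ha⟩
  -- For `b` outside `A`, a successor in `A` could be moved elsewhere on the cycle, and a successor
  -- in `Q \ Q1` would allow a crossing exchange; each gives a Hamiltonian path between compatible
  -- vertices. So `f` embeds `Z` into `Q1`.
  have hfZ : ∀ z ∈ Z, f z ∈ Q1 := by
    intro b hb
    have hb' := Finset.mem_sdiff.1 hb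
    by_cases hbA : b ∈ A
    · exact hfQ1 b hbA
    obtain ⟨hbQ, hbc⟩ := hQZ b hb'.1 hbA hb'.2
    by_contra hfb
    have hfbL := hfL b hb'.1
    by_cases hfbA : f b ∈ A
    · obtain ⟨a, ha, hne, hC⟩ := hexC (f b) hfbA
      obtain ⟨l, hl, e1, e2⟩ := hc.exists_path_of_move (hAL ha) hb'.1
        (fun e => hbA (e ▸ ha)) hne.symm (hAQ1 _ hfbA _ (hfQ1 a ha)) (hbc _ (hfQ1 _ hfbA))
      exact hnoC l _ _ hl e1 e2 hC
    · obtain ⟨-, hfbc⟩ := hQZ (f b) hfbL hfbA hfb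
      obtain ⟨a, ha, hne, hC⟩ := hexC a0 ha0
      obtain ⟨l, hl, e⟩ := hc.exists_path_of_cross (hAL ha0) (hAL ha) hb'.1 hne.symm
        (fun e => hbA (e ▸ ha0)) (fun e => hbA (e ▸ ha)) (hbc _ (hfQ1 _ ha0)) (hbc _ (hfQ1 _ ha))
        (hfbc _ (hfQ1 _ ha0)) (hfbc _ (hfQ1 _ ha))
      rcases e with ⟨e1, e2⟩ | ⟨e1, e2⟩
      · exact hnoC l _ _ hl e1 e2 hC
      · exact hnoC l _ _ hl e1 e2 (hCsymm _ _ hC)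
  have hZcard : Z.card ≤ Q1.card :=
    Finset.card_le_card_of_injOn f hfZ hc.injective.injOn
  have hP4 : P4Free G Q1 := by
    intro a ha b hb c hc d hd hab hbc hcd
    by_contra! H
    have hk : ∀ {q}, q ∈ Q1 → ¬ G.Adj w0 q := fun hq e => hnotL _ (hQ1L hq) w0 hw0 hκw0 e.symm
    exact h.false_of_P4P1 a b c d w0 hab hbc hcd H.1 H.2.1 H.2.2 (hk ha) (hk hb) (hk hc) (hk hd)
  obtain ⟨T, B, hD⟩ := hP4.exists_dec ⟨f a0, hf0⟩
  obtain ⟨P, hP, hPcard⟩ := hD.exists_system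
  have hTQ1 : T ⊆ Q1 := fun t ht => (hD.mem_iff t).2 (.inl ht)
  have hPpos : 1 ≤ P.length := by
    rcases P with - | ⟨l, P⟩
    · simpa using (hP.mem _).2 hf0
    · simp
  have hBQ1 : ∀ K ∈ B, K ⊆ Q1 := fun K hK v hv => (hD.mem_iff v).2 (.inr ⟨K, hK, hv⟩)
  -- This gives 9(|B| + 1) ≤ 2(|Z| + |T| + 4), so the |B| - |T| paths covering `Q1` number at most
  -- |Z| - 1. As |Z| ≤ |Q1|, they can be cut into exactly |Z| - 1 pieces to be placed between the
  -- vertices of `Z`.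
  have hmain := htough (Z ∪ T) B (by omega) (fun K hK => (hD.block K hK).nonempty)
    (fun K hK => (hBQ1 K hK).trans hQ1Q)
    (by
      intro K hK v hv hvZ
      rcases Finset.mem_union.1 hvZ with hvZ | hvZ
      · exact (Finset.mem_sdiff.1 hvZ).2 (hBQ1 K hK hv)
      · exact hD.notMem v hvZ K hK hv)
    (Finset.union_subset Finset.sdiff_subset (hTQ1.trans hQ1L))
    (fun K hK K' hK' hne v hv hv' => (hD.sep K hK K' hK' hne v hv v hv').1 rfl)
    (by
      intro K hK v hv w hw hvw
      by_cases hwQ : w ∈ Q1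
      · rcases (hD.mem_iff w).1 hwQ with hwT | ⟨K', hK', hwK⟩
        · exact .inr (by simp [hwT])
        · by_cases e : K = K'
          · exact .inl (e ▸ hwK)
          · exact absurd hvw (hD.sep K hK K' hK' e v hv w hwK).2
      · exact .inr (Finset.mem_union_left _ (Finset.mem_sdiff.2 ⟨hw, hwQ⟩)))
  have hcu := Finset.card_union_le Z T
  obtain ⟨P', hP', hP'card⟩ := hP.chop (t := Z.card - 1) (by omega) (by omega)
  obtain ⟨a', ha', hne, hC⟩ := hexC a0 ha0
  obtain ⟨l, hl, e1, e2⟩ := exists_ham_alternate hQ1L hZQ1 hP' (by omega) (hAZ a0 ha0) (hAZ a' ha')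
    hne
  exact hnoC l _ _ hl e1 e2 hC

end ToughGraph

/-! ### Paths with ends in `S`, and matchings of block ends into `S ∪ T`. -/

namespace ToughGraph
variable {V : Type*} {ι : Type*}

/-- A list with two further vertices to be put in front of it and behind it. -/
structure SPath (V : Type*) where
  /-- the vertex before the list -/
  p : V
  /-- the list -/
  core : List V
  /-- the vertex behind the list -/
  q : V

/-- The whole list. -/
def SPath.full (t : SPath V) : List V := t.p :: (t.core ++ [t.q])

/-- `t` is a path between two vertices of `S`, whose inner path has ends outside `S`,
and meets only one component. -/
structure IsSPath (G : SimpleGraph V) (S : Finset V) (κ : V → ι) (t : SPath V) : Prop where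
  left : t.p ∈ S
  right : t.q ∈ S
  chain : t.full.IsChain G.Adj
  ne : t.core ≠ []
  head : ∀ x ∈ t.core.head?, x ∉ S
  last : ∀ x ∈ t.core.getLast?, x ∉ S
  label : ∀ x ∈ t.core, ∀ y ∈ t.core, x ∉ S → y ∉ S → κ x = κ y

/-- A family of disjoint `S`-paths that covers all vertices outside `S`. -/
structure IsSPathCover (G : SimpleGraph V) (S : Finset V) (κ : V → ι) (P : List (SPath V)) :
    Prop where
  isSPath : ∀ t ∈ P, IsSPath G S κ t
  nodup : (P.map SPath.full).flatten.Nodup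
  covers : ∀ v ∉ S, ∃ t ∈ P, v ∈ t.core

variable {G : SimpleGraph V}

/-- Prescribed ends of a family of paths can be attached. -/
lemma exists_spaths : ∀ (L : List (List V)) (R : Multiset (V × V)), (∀ l ∈ L, l ≠ []) →
    allEnds L ≤ R.map Prod.fst → ∃ P : List (SPath V), P.map SPath.core = L ∧
      (∀ t ∈ P, (∀ x ∈ t.core.head?, (x, t.p) ∈ R) ∧ ∀ x ∈ t.core.getLast?, (x, t.q) ∈ R) ∧
      ((P.flatMap fun t => [t.p, t.q] : List V) : Multiset V) ≤ R.map Prod.snd := by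
  classical
  intro L
  induction L with
  | nil => intro R _ _; exact ⟨[], by simp⟩
  | cons l L ih =>
    intro R hne hR
    have hl := hne l (by simp)
    rw [allEnds_cons, ends_eq hl] at hR
    simp only [Multiset.insert_eq_cons, ← Multiset.singleton_add, add_assoc] at hR
    rw [Multiset.singleton_add] at hR
    have h1 : l.head hl ∈ R.map Prod.fst := Multiset.mem_of_le hR (Multiset.mem_cons_self _ _)
    obtain ⟨⟨x, s⟩, hx, ex⟩ := Multiset.mem_map.1 h1
    obtain ⟨R1, rfl⟩ := Multiset.exists_cons_of_mem hx
    simp only at ex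
    subst ex
    rw [Multiset.map_cons, Multiset.cons_le_cons_iff, Multiset.singleton_add] at hR
    have h2 : l.getLast hl ∈ R1.map Prod.fst := Multiset.mem_of_le hR (Multiset.mem_cons_self _ _)
    obtain ⟨⟨y, s'⟩, hy, ey⟩ := Multiset.mem_map.1 h2
    obtain ⟨R2, rfl⟩ := Multiset.exists_cons_of_mem hy
    simp only at ey
    subst ey
    rw [Multiset.map_cons, Multiset.cons_le_cons_iff] at hR
    obtain ⟨P, p1, p2, p3⟩ := ih R2 (fun l hl => hne l (by simp [hl])) hR
    refine ⟨⟨s, l, s'⟩ :: P, by simp [p1], ?_, ?_⟩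
    · intro t ht
      rcases List.mem_cons.1 ht with rfl | ht
      · simp [List.head?_eq_some_head hl, List.getLast?_eq_some_getLast hl]
      · exact ⟨fun x hx => by simp [(p2 t ht).1 x hx], fun x hx => by simp [(p2 t ht).2 x hx]⟩
    · simp only [List.flatMap_cons, Multiset.map_cons, List.cons_append, List.nil_append,
        ← Multiset.cons_coe, Multiset.cons_le_cons_iff]
      exact p3

lemma SPath.full_perm (P : List (SPath V)) : (P.map SPath.full).flatten.Perm
    ((P.map SPath.core).flatten ++ P.flatMap fun t => [t.p, t.q]) := by
  classical
  rw [List.perm_iff_count]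
  intro a
  induction P with
  | nil => simp
  | cons t P ih =>
    simp only [List.map_cons, List.flatten_cons, List.flatMap_cons, List.count_append,
      SPath.full, List.count_cons, List.count_nil] at ih ⊢
    omega

variable [Fintype V] {S : Finset V} {κ : V → ι}

lemma Setup.label_of_chain (h : Setup G S κ) {l : List V} (hl : l.IsChain G.Adj)
    (hS : ∀ v ∈ l, v ∉ S) : ∀ x ∈ l, ∀ y ∈ l, κ x = κ y := by
  intro x hx y hy
  by_contra hne
  obtain ⟨a, ha, b, hb, h1, h2, hab⟩ := exists_adj_crossing hl (fun v => κ x = κ v) hx hy rfl hne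
  exact h2 (h1.trans (h.label a (hS a ha) b (hS b hb) hab))

variable [DecidableEq V]

/-- If the ends of Hamiltonian paths of all blocks can be matched into `S ∪ T`, there is a cover. -/
lemma Setup.exists_cover_of_match (h : Setup G S κ) {T : Finset V} {B : Finset (Finset V)}
    (hD : Dec G Sᶜ T B) (l : Finset V → List V) (hl : ∀ K ∈ B, IsHam G K (l K))
    (R : Multiset (V × V)) (hR1 : R.map Prod.fst = ∑ K ∈ B, ends (l K)) (hR2 : (R.map Prod.snd).Nodup)
    (hR3 : ∀ p ∈ R, G.Adj p.2 p.1 ∧ p.2 ∈ S ∪ T) : ∃ P, IsSPathCover G S κ P := by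
  classical
  have huniq : ∀ p ∈ R, ∀ p' ∈ R, p.2 = p'.2 → p = p' :=
    fun p hp p' hp' e => Multiset.inj_on_of_nodup_map hR2 p hp p' hp' e
  -- The block end matched to `t`, so that linking uses up every end that is matched into `T`.
  let o : V → Option V := fun t => if ht : ∃ v, (v, t) ∈ R then some ht.choose else none
  have ho : ∀ p ∈ R, o p.2 = some p.1 := by
    intro p hp
    have ht : ∃ v, (v, p.2) ∈ R := ⟨p.1, hp⟩
    simp only [o, dif_pos ht]
    have := huniq _ ht.choose_spec p hp rfl
    exact congrArg some (congrArg Prod.fst this)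
  have ho' : ∀ t v, o t = some v → (v, t) ∈ R := by
    intro t v e
    by_cases ht : ∃ v, (v, t) ∈ R
    · simp only [o, dif_pos ht, Option.some.injEq] at e
      exact e ▸ ht.choose_spec
    · simp [o, dif_neg ht] at e
  obtain ⟨L, hL, -, hLe⟩ := hD.link l o hl (fun t _ v e => (hR3 _ (ho' t v e)).1)
  have hsplit := Multiset.filter_add_not (fun p : V × V => p.2 ∈ S) R
  have hRT : (R.filter fun p => ¬ p.2 ∈ S).map Prod.fst ≤ T.val.filterMap o := by
    have e : (R.filter fun p => ¬ p.2 ∈ S).map Prod.fst =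
        ((R.filter fun p => ¬ p.2 ∈ S).map Prod.snd).filterMap o := by
      have key : ∀ M : Multiset (V × V), (∀ p ∈ M, o p.2 = some p.1) →
          M.map Prod.fst = (M.map Prod.snd).filterMap o := by
        intro M
        induction M using Multiset.induction_on with
        | empty => simp
        | cons p M ih =>
          intro hM
          rw [Multiset.map_cons, Multiset.map_cons,
            Multiset.filterMap_cons_some _ _ _ (hM p (by simp)), ih fun p hp => hM p (by simp [hp])]
      exact key _ fun p hp => ho p (Multiset.mem_filter.1 hp).1
    rw [e]
    refine Multiset.filterMap_le_filterMap _ ?_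
    rw [Multiset.le_iff_subset]
    · intro t ht
      obtain ⟨p, hp, rfl⟩ := Multiset.mem_map.1 ht
      obtain ⟨h1, h2⟩ := Multiset.mem_filter.1 hp
      exact (Finset.mem_union.1 (hR3 p h1).2).resolve_left h2
    · exact Multiset.nodup_of_le (Multiset.map_le_map (Multiset.filter_le _ _)) hR2
  -- Whatever ends survive the linking were matched into `S`, and their partners there become the
  -- ends of the final paths.
  have hLe' : allEnds L ≤ (R.filter fun p => p.2 ∈ S).map Prod.fst := by
    refine hLe.trans ?_
    rw [← hR1, ← hsplit, Multiset.map_add, tsub_le_iff_right]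
    rw [hsplit]
    gcongr
  obtain ⟨P, hP1, hP2, hP3⟩ := exists_spaths L _ hL.ne hLe'
  have hcore : ∀ t ∈ P, t.core ∈ L := fun t ht => hP1 ▸ List.mem_map_of_mem ht
  have hcS : ∀ t ∈ P, ∀ v ∈ t.core, v ∉ S := fun t ht v hv =>
    Finset.mem_compl.1 ((hL.mem v).1 (List.mem_flatten.2 ⟨_, hcore t ht, hv⟩))
  have hpq : ∀ t ∈ P, t.p ∈ S ∧ t.q ∈ S := by
    intro t ht
    have hne := hL.ne _ (hcore t ht)
    have h1 := (hP2 t ht).1 _ (List.head?_eq_some_head hne)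
    have h2 := (hP2 t ht).2 _ (List.getLast?_eq_some_getLast hne)
    exact ⟨(Multiset.mem_filter.1 h1).2, (Multiset.mem_filter.1 h2).2⟩
  refine ⟨P, ⟨fun t ht => ?_, ?_, fun v hv => ?_⟩⟩
  · refine ⟨(hpq t ht).1, (hpq t ht).2, ?_, hL.ne _ (hcore t ht), ?_, ?_, ?_⟩
    · refine List.isChain_cons.2 ⟨fun y hy => ?_, (hL.chain _ (hcore t ht)).append (by simp) ?_⟩
      · rw [List.head?_append_of_ne_nil _ (hL.ne _ (hcore t ht))] at hy
        exact (hR3 _ (Multiset.mem_of_mem_filter ((hP2 t ht).1 y hy))).1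
      · intro x hx y hy
        simp only [List.head?_cons, Option.mem_def, Option.some.injEq] at hy
        exact hy ▸ (hR3 _ (Multiset.mem_of_mem_filter ((hP2 t ht).2 x hx))).1.symm
    · exact fun x hx => hcS t ht x (List.mem_of_head? hx)
    · exact fun x hx => hcS t ht x (List.mem_of_getLast? hx)
    · exact fun x hx y hy _ _ => h.label_of_chain (hL.chain _ (hcore t ht)) (hcS t ht) x hx y hy
  · rw [(SPath.full_perm P).nodup_iff, hP1]
    refine hL.nodup.append ?_ ?_
    · rw [← Multiset.coe_nodup]
      refine Multiset.nodup_of_le (hP3.trans ?_) hR2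
      exact Multiset.map_le_map (Multiset.filter_le _ _)
    · intro v hv hv'
      obtain ⟨t, ht, hvt⟩ := List.mem_flatMap.1 hv'
      have : v ∈ S := by
        simp only [List.mem_cons, List.not_mem_nil, or_false] at hvt
        rcases hvt with rfl | rfl
        exacts [(hpq t ht).1, (hpq t ht).2]
      exact Finset.mem_compl.1 ((hL.mem v).1 hv) this
  · obtain ⟨c, hc, hvc⟩ := List.mem_flatten.1 ((hL.mem v).2 (Finset.mem_compl.2 hv))
    rw [← hP1] at hc
    obtain ⟨t, ht, rfl⟩ := List.mem_map.1 hc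
    exact ⟨t, ht, hvc⟩

/-- The ends of Hamiltonian paths of the members of `B` can be matched into `U`. -/
def HasMatch (G : SimpleGraph V) (B : Finset (Finset V)) (U : Finset V) : Prop :=
  ∃ (l : Finset V → List V) (R : Multiset (V × V)), (∀ K ∈ B, IsHam G K (l K)) ∧
    R.map Prod.fst = ∑ K ∈ B, ends (l K) ∧ (R.map Prod.snd).Nodup ∧
    ∀ p ∈ R, G.Adj p.2 p.1 ∧ p.2 ∈ U

omit [Fintype V] [DecidableEq V] in
lemma HasMatch.mono {B : Finset (Finset V)} {U U' : Finset V} (h : HasMatch G B U) (hU : U ⊆ U') :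
    HasMatch G B U' := by
  obtain ⟨l, R, h1, h2, h3, h4⟩ := h
  exact ⟨l, R, h1, h2, h3, fun p hp => ⟨(h4 p hp).1, hU (h4 p hp).2⟩⟩

omit [Fintype V] [DecidableEq V] in
lemma hasMatch_empty (G : SimpleGraph V) : HasMatch G ∅ ∅ :=
  ⟨fun _ => [], 0, by simp, by simp, by simp, by simp⟩

omit [Fintype V] in
lemma HasMatch.union {B B' : Finset (Finset V)} {U U' : Finset V} (h : HasMatch G B U)
    (h' : HasMatch G B' U') (hB : Disjoint B B') (hU : Disjoint U U') :
    HasMatch G (B ∪ B') (U ∪ U') := by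
  classical
  obtain ⟨l, R, h1, h2, h3, h4⟩ := h
  obtain ⟨l', R', h1', h2', h3', h4'⟩ := h'
  have hB' : ∀ K ∈ B', K ∉ B := fun K hK hK' => Finset.disjoint_left.1 hB hK' hK
  refine ⟨fun K => if K ∈ B then l K else l' K, R + R', ?_, ?_, ?_, ?_⟩
  · intro K hK
    by_cases hKB : K ∈ B
    · simpa [hKB] using h1 K hKB
    · simpa [hKB] using h1' K ((Finset.mem_union.1 hK).resolve_left hKB)
  · rw [Multiset.map_add, Finset.sum_union hB, h2, h2']
    congr 1
    · exact Finset.sum_congr rfl fun K hK => by simp [hK]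
    · exact Finset.sum_congr rfl fun K hK => by simp [hB' K hK]
  · rw [Multiset.map_add, Multiset.nodup_add]
    refine ⟨h3, h3', Multiset.disjoint_left.2 fun {v} hv hv' => ?_⟩
    obtain ⟨p, hp, rfl⟩ := Multiset.mem_map.1 hv
    obtain ⟨p', hp', e⟩ := Multiset.mem_map.1 hv'
    exact Finset.disjoint_left.1 hU (h4 p hp).2 (e ▸ (h4' p' hp').2)
  · intro p hp
    rcases Multiset.mem_add.1 hp with hp | hp
    · exact ⟨(h4 p hp).1, Finset.mem_union_left _ (h4 p hp).2⟩
    · exact ⟨(h4' p hp).1, Finset.mem_union_right _ (h4' p hp).2⟩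

omit [Fintype V] in
lemma hasMatch_singleton {K : Finset V} {l : List V} (hl : IsHam G K l) {x y s s' : V}
    (hx : x ∈ l.head?) (hy : y ∈ l.getLast?) (hs : G.Adj s x) (hs' : G.Adj s' y) (hne : s ≠ s') :
    HasMatch G {K} {s, s'} := by
  refine ⟨fun _ => l, {(x, s), (y, s')}, by simpa using hl, ?_, ?_, ?_⟩
  · have hl : l ≠ [] := by rintro rfl; simp at hx
    rw [Finset.sum_singleton, ends_eq hl]
    rw [List.head?_eq_some_head hl] at hx
    rw [List.getLast?_eq_some_getLast hl] at hy
    simp only [Option.mem_def, Option.some.injEq] at hx hy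
    simp [hx, hy]
  · simp [hne]
  · simp [hs, hs']

omit [Fintype V] in
/-- Hall's theorem, with demand two. -/
lemma hasMatch_of_hall {B : Finset (Finset V)} (hB : ∀ K ∈ B, IsBlock G K)
    (c : Finset V → Finset V) (hc : ∀ K ∈ B, ∀ v ∈ c K, ∀ w ∈ K, G.Adj v w)
    (hall : ∀ B' ⊆ B, 2 * B'.card ≤ (B'.biUnion c).card) : HasMatch G B (B.biUnion c) := by
  classical
  -- Each block is doubled, one copy per end. Vertices of `c K` are adjacent to all of `K`, so any
  -- Hamiltonian path of `K` will do.
  have h1 := (Finset.all_card_le_biUnion_card_iff_exists_injective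
    (fun x : {K // K ∈ B} × Bool => c x.1.1)).1 (by
      intro s
      have hsub : (s.image fun x => x.1.1) ⊆ B := by
        intro K hK
        obtain ⟨x, -, rfl⟩ := Finset.mem_image.1 hK
        exact x.1.2
      have h2 := hall _ hsub
      have e : (s.image fun x => x.1.1).biUnion c = s.biUnion fun x => c x.1.1 := by
        rw [Finset.image_biUnion]
      rw [e] at h2
      refine le_trans ?_ h2
      have : (s.image fun x => (x.1.1, x.2)).card = s.card :=
        Finset.card_image_of_injective _ (by
          rintro ⟨⟨K, hK⟩, b⟩ ⟨⟨K', hK'⟩, b'⟩ e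
          simp only [Prod.mk.injEq] at e
          obtain ⟨rfl, rfl⟩ := e
          rfl)
      rw [← this]
      have hs2 : (s.image fun x => (x.1.1, x.2)) ⊆ (s.image fun x => x.1.1) ×ˢ Finset.univ := by
        intro y hy
        obtain ⟨x, hx, rfl⟩ := Finset.mem_image.1 hy
        simp only [Finset.mem_product, Finset.mem_univ, and_true]
        exact Finset.mem_image_of_mem _ hx
      have := Finset.card_le_card hs2
      rw [Finset.card_product] at this
      simpa [mul_comm] using this)
  obtain ⟨f, hf, hfc⟩ := h1
  have : ∀ K : {K // K ∈ B}, ∃ l, l ≠ [] ∧ IsHam G K l := by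
    rintro ⟨K, hK⟩
    obtain ⟨x, l, hl, -⟩ := hB K hK
    exact ⟨x :: l, by simp, hl⟩
  choose l hlne hl using this
  let R : Multiset (V × V) := ∑ K : {K // K ∈ B},
    {((l K).head (hlne K), f (K, true)), ((l K).getLast (hlne K), f (K, false))}
  have hR : R.map Prod.snd = (Finset.univ : Finset ({K // K ∈ B} × Bool)).val.map f := by
    have : (Finset.univ : Finset ({K // K ∈ B} × Bool)).val.map f = ∑ x, {f x} := by
      rw [← Finset.sum_multiset_singleton Finset.univ]
      exact map_sum (Multiset.mapAddMonoidHom f) _ _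
    rw [this, Fintype.sum_prod_type]
    refine (map_sum (Multiset.mapAddMonoidHom Prod.snd) _ _).trans ?_
    refine Finset.sum_congr rfl fun K _ => ?_
    rw [Fintype.sum_bool]
    rfl
  refine ⟨fun K => if hK : K ∈ B then l ⟨K, hK⟩ else [], R, ?_, ?_, ?_, ?_⟩
  · intro K hK
    simpa [hK] using hl ⟨K, hK⟩
  · rw [← Finset.sum_coe_sort B]
    refine (map_sum (Multiset.mapAddMonoidHom Prod.fst) _ _).trans ?_
    refine Finset.sum_congr rfl fun K _ => ?_
    simp [ends_eq (hlne K)]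
  · rw [hR]
    exact Finset.univ.nodup.map hf
  · intro p hp
    simp only [R, Multiset.mem_sum, Finset.mem_univ, true_and, Multiset.insert_eq_cons,
      Multiset.mem_cons, Multiset.mem_singleton] at hp
    obtain ⟨K, rfl | rfl⟩ := hp
    · exact ⟨hc K K.2 _ (hfc (K, true)) _ (((hl K).mem _).1 (List.head_mem _)),
        Finset.mem_biUnion.2 ⟨K, K.2, hfc (K, true)⟩⟩
    · exact ⟨hc K K.2 _ (hfc (K, false)) _ (((hl K).mem _).1 (List.getLast_mem _)),
        Finset.mem_biUnion.2 ⟨K, K.2, hfc (K, false)⟩⟩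

end ToughGraph

/-! ### Existence of a cover by paths with ends in `S`, from toughness and Hall's theorem. -/

namespace ToughGraph
variable {V : Type*} {ι : Type*} {G : SimpleGraph V}

lemma exists_ne_ne {a b c : ι} (p q : ι) (hab : a ≠ b) (hac : a ≠ c) (hbc : b ≠ c) :
    (a ≠ p ∧ a ≠ q) ∨ (b ≠ p ∧ b ≠ q) ∨ (c ≠ p ∧ c ≠ q) := by
  by_contra! H
  by_cases h1 : a = p <;> by_cases h2 : b = p <;> by_cases h3 : c = p <;> simp_all

open scoped Classical in
/-- The vertices of `U` that are adjacent to all of `K`. -/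
noncomputable def completeTo (G : SimpleGraph V) (U K : Finset V) : Finset V :=
  U.filter fun v => ∀ w ∈ K, G.Adj v w

lemma mem_completeTo {U K : Finset V} {v : V} :
    v ∈ completeTo G U K ↔ v ∈ U ∧ ∀ w ∈ K, G.Adj v w := by
  classical
  exact Finset.mem_filter

section
variable [Fintype V] [DecidableEq V]

variable {S : Finset V} {κ : V → ι}

omit [DecidableEq V] in
/-- With three components, a vertex of `S` has its nonneighbours in one component. -/
lemma Setup.eq_of_not_adj (h : Setup G S κ) {s u v w : V} (hs : s ∈ S) (hu : u ∉ S) (hv : v ∉ S)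
    (hw : w ∉ S) (huw : κ w ≠ κ u) (hvw : κ w ≠ κ v) (h1 : ¬ G.Adj s u) (h2 : ¬ G.Adj s v) :
    κ u = κ v := by
  by_contra huv
  obtain ⟨x0, hx0, k0, a0⟩ := h.nbr s hs u hu
  -- With `y` in the component of `w`, x', x, s, y is an induced P₄, and `v` in the third component
  -- misses it.
  obtain ⟨x, hx, x', hx', kx, kx', ax, ax', axx'⟩ := h.cross (fun x => G.Adj s x) x0 hx0 u hu k0 a0 h1
  obtain ⟨y, hy, ky, ay⟩ := h.nbr s hs w hw
  rw [k0] at kx kx'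
  exact h.false_of_P4P1 x' x s y v axx'.symm ax.symm ay (fun e => ax' e.symm)
    (h.not_adj hx hy (by rw [kx, ky]; exact huw.symm)) (h.not_adj hx' hy (by rw [kx', ky]; exact huw.symm))
    (h.not_adj hv hx' (by rw [kx']; exact Ne.symm huv)) (h.not_adj hv hx (by rw [kx]; exact Ne.symm huv))
    (fun e => h2 e.symm) (h.not_adj hv hy (by rw [ky]; exact hvw.symm))

variable {T : Finset V} {B : Finset (Finset V)}

lemma Setup.block_notMem (hD : Dec G Sᶜ T B) {K : Finset V} (hK : K ∈ B) {v : V} (hv : v ∈ K) :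
    v ∉ S := Finset.mem_compl.1 ((hD.mem_iff v).2 (.inr ⟨K, hK, hv⟩))

lemma Setup.label_block (h : Setup G S κ) (hD : Dec G Sᶜ T B) {K : Finset V} (hK : K ∈ B) {v w : V}
    (hv : v ∈ K) (hw : w ∈ K) : κ v = κ w := by
  obtain ⟨x, l, hl, -⟩ := hD.block K hK
  exact h.label_of_chain hl.chain
    (fun v hv => Setup.block_notMem hD hK ((hl.mem v).1 hv)) v ((hl.mem v).2 hv) w ((hl.mem w).2 hw)

lemma Setup.adj_block (hD : Dec G Sᶜ T B) {K : Finset V} (hK : K ∈ B) {v w : V} (hv : v ∈ K)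
    (hvw : G.Adj v w) : w ∈ K ∨ w ∈ S ∪ T := by
  by_cases hw : w ∈ S
  · simp [hw]
  · rcases (hD.mem_iff w).1 (Finset.mem_compl.2 hw) with hT | ⟨K', hK', hwK⟩
    · simp [hT]
    · by_cases e : K = K'
      · exact .inl (e ▸ hwK)
      · exact absurd hvw (hD.sep K hK K' hK' e v hv w hwK).2

lemma Setup.notMem_block (hD : Dec G Sᶜ T B) {K : Finset V} (hK : K ∈ B) {v : V}
    (hv : v ∈ S ∪ T) : v ∉ K := by
  intro hvK
  rcases Finset.mem_union.1 hv with hv | hv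
  · exact Setup.block_notMem hD hK hvK hv
  · exact hD.notMem v hv K hK hvK

/-- A block without neighbours in `T` is a component. -/
lemma Setup.block_eq_class (h : Setup G S κ) (hD : Dec G Sᶜ T B) {K : Finset V} (hK : K ∈ B)
    (hT : ∀ t ∈ T, ∀ v ∈ K, ¬ G.Adj t v) {v : V} (hv : v ∈ K) (w : V) :
    w ∈ K ↔ w ∉ S ∧ κ w = κ v := by
  constructor
  · exact fun hw => ⟨Setup.block_notMem hD hK hw, h.label_block hD hK hw hv⟩
  · rintro ⟨hw, k⟩
    by_contra hwK
    obtain ⟨x, hx, y, hy, -, -, h1, h2, hxy⟩ := h.cross (fun x => x ∈ K) v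
      (Setup.block_notMem hD hK hv) w hw k.symm hv hwK
    rcases Setup.adj_block hD hK h1 hxy with e | e
    · exact h2 e
    · exact hT y ((Finset.mem_union.1 e).resolve_left hy) x h1 hxy.symm

/-- The neighbours of a family of blocks are complete to some of the blocks. -/
lemma Setup.exists_complete (h : Setup G S κ) (hD : Dec G Sᶜ T B) {B' : Finset (Finset V)}
    (hB' : B' ⊆ B) (h2 : 2 ≤ B'.card)
    (hw : (∃ u v w, u ∉ S ∧ v ∉ S ∧ w ∉ S ∧ κ u ≠ κ v ∧ κ u ≠ κ w ∧ κ v ≠ κ w) ∨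
      ∀ K ∈ B', ∃ t ∈ T, ∃ v ∈ K, G.Adj t v)
    {v : V} (hv : v ∈ S ∪ T) {K : Finset V} (hK : K ∈ B') {x : V} (hx : x ∈ K) (hvx : G.Adj v x) :
    ∃ K' ∈ B', ∀ w ∈ K', G.Adj v w := by
  rcases Finset.mem_union.1 hv with hs | ht
  swap
  · exact ⟨K, hK, (hD.complete v ht K (hB' hK) x hx hvx).1⟩
  by_contra! H
  obtain ⟨z0, hz0, nz0⟩ := H K hK
  obtain ⟨x, hx, x', hx', ax, ax', axx'⟩ := (hD.block K (hB' hK)).exists_adj_crossing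
    (fun x => G.Adj v x) hx hz0 hvx nz0
  have hxS := Setup.block_notMem hD (hB' hK) hx
  have hxS' := Setup.block_notMem hD (hB' hK) hx'
  have kxx' := h.label_block hD (hB' hK) hx' hx
  -- a nonneighbour outside `K`, and a neighbour in a component of neither
  have main : ∀ K' ∈ B, K' ≠ K → ∀ z ∈ K', ¬ G.Adj v z →
      ∀ w, w ∉ S → κ w ≠ κ x → κ w ≠ κ z → False := by
    intro K' hK' hne z hz nz w hwS kw kw'
    obtain ⟨y, hy, ky, ay⟩ := h.nbr v hs w hwS
    have hzS := Setup.block_notMem hD hK' hz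
    exact h.false_of_P4P1 x' x v y z axx'.symm ax.symm ay (fun e => ax' e.symm)
      (h.not_adj hxS hy (by rw [ky]; exact kw.symm))
      (h.not_adj hxS' hy (by rw [ky, kxx']; exact kw.symm))
      (hD.sep K' hK' K (hB' hK) hne z hz x' hx').2 (hD.sep K' hK' K (hB' hK) hne z hz x hx).2
      (fun e => nz e.symm) (h.not_adj hzS hy (by rw [ky]; exact kw'.symm))
  obtain ⟨K', hK', hne⟩ := Finset.exists_mem_ne (s := B') (by omega) K
  obtain ⟨z, hz, nz⟩ := H K' hK'
  have hzS := Setup.block_notMem hD (hB' hK') hz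
  by_cases k : κ z = κ x
  · obtain ⟨w, hwS, kw⟩ := h.other x hxS
    exact main K' (hB' hK') hne z hz nz w hwS kw (by rw [k]; exact kw)
  by_cases h3 : ∃ w, w ∉ S ∧ κ w ≠ κ x ∧ κ w ≠ κ z
  · obtain ⟨w, hwS, kw, kw'⟩ := h3
    exact main K' (hB' hK') hne z hz nz w hwS kw kw'
  rcases hw with ⟨a, b, c, ha, hb, hc, hab, hac, hbc⟩ | hw
  · push Not at h3
    have e1 := h3 a ha
    have e2 := h3 b hb
    have e3 := h3 c hc
    rcases exists_ne_ne (κ x) (κ z) hab hac hbc with ⟨e, e'⟩ | ⟨e, e'⟩ | ⟨e, e'⟩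
    exacts [e' (e1 e), e' (e2 e), e' (e3 e)]
  -- Only two components are left, those of `x` and of `z`. A connecting vertex at `K` yields
  -- another block in the component of `x`; `v` must be adjacent to its vertex `k'`. Then y', y, v,
  -- k' is an induced P₄ missing `x'`.
  obtain ⟨t, ht, u, hu, atu⟩ := hw K hK
  obtain ⟨-, K'', hK'', hne'', hc⟩ := hD.complete t ht K (hB' hK) u hu atu
  obtain ⟨k', hk'⟩ := (hD.block K'' hK'').nonempty
  have htS : t ∉ S := Finset.mem_compl.1 ((hD.mem_iff t).2 (.inl ht))
  have hk'S := Setup.block_notMem hD hK'' hk'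
  have kk : κ k' = κ x := by
    rw [← h.label t htS k' hk'S (hc k' hk'), h.label t htS u (Setup.block_notMem hD (hB' hK) hu) atu,
      h.label_block hD (hB' hK) hu hx]
  have avk : G.Adj v k' := by
    by_contra nk
    obtain ⟨w, hwS, kw⟩ := h.other x hxS
    exact main K'' hK'' hne'' k' hk' nk w hwS kw (by rw [kk]; exact kw)
  obtain ⟨y0, hy0, ky0, ay0⟩ := h.nbr v hs z hzS
  obtain ⟨y, hy, y', hy', ky, ky', ay, ay', ayy'⟩ := h.cross (fun x => G.Adj v x) y0 hy0 z hzS ky0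
    ay0 nz
  rw [ky0] at ky ky'
  exact h.false_of_P4P1 y' y v k' x' ayy'.symm ay.symm avk (fun e => ay' e.symm)
    (h.not_adj hy hk'S (by rw [ky, kk]; exact k)) (h.not_adj hy' hk'S (by rw [ky', kk]; exact k))
    (h.not_adj hxS' hy' (by rw [ky', kxx']; exact Ne.symm k))
    (h.not_adj hxS' hy (by rw [ky, kxx']; exact Ne.symm k)) (fun e => ax' e.symm)
    (hD.sep K (hB' hK) K'' hK'' hne''.symm x' hx' k' hk').2

/-- The vertices complete to one of the given blocks separate the blocks. -/
lemma Setup.tough_blocks (h : Setup G S κ) (hD : Dec G Sᶜ T B) {B' : Finset (Finset V)}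
    (hB' : B' ⊆ B) (h2 : 2 ≤ B'.card)
    (hw : (∃ u v w, u ∉ S ∧ v ∉ S ∧ w ∉ S ∧ κ u ≠ κ v ∧ κ u ≠ κ w ∧ κ v ≠ κ w) ∨
      ∀ K ∈ B', ∃ t ∈ T, ∃ v ∈ K, G.Adj t v) :
    9 * B'.card ≤ 2 * (B'.biUnion (completeTo G (S ∪ T))).card ∧
    ((∃ w, w ∉ S ∪ T ∧ ∀ K ∈ B', w ∉ K) ∨ (∃ w ∈ T, ∀ K ∈ B', ∀ v ∈ K, ¬ G.Adj w v) →
      9 * (B'.card + 1) ≤ 2 * (B'.biUnion (completeTo G (S ∪ T))).card) := by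
  classical
  -- Removing all neighbours of the blocks in `S ∪ T` isolates the blocks, and each such neighbour
  -- is complete to some block of the family.
  let Z : Finset V := (S ∪ T).filter fun v => ∃ K ∈ B', ∃ w ∈ K, G.Adj v w
  have hZ : Z ⊆ B'.biUnion (completeTo G (S ∪ T)) := by
    intro v hv
    obtain ⟨hv, K, hK, w, hw', a⟩ := Finset.mem_filter.1 hv
    obtain ⟨K', hK', hc⟩ := h.exists_complete hD hB' h2 hw hv hK hw' a
    exact Finset.mem_biUnion.2 ⟨K', hK', mem_completeTo.2 ⟨hv, hc⟩⟩
  have hZc := Finset.card_le_card hZ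
  have p1 : ∀ K ∈ B', K.Nonempty := fun K hK => (hD.block K (hB' hK)).nonempty
  have p2 : ∀ K ∈ B', ∀ v ∈ K, v ∉ Z := fun K hK v hv hvZ =>
    Setup.notMem_block hD (hB' hK) (Finset.mem_filter.1 hvZ).1 hv
  have p3 : ∀ K ∈ B', ∀ K' ∈ B', K ≠ K' → ∀ v ∈ K, v ∉ K' := fun K hK K' hK' hne v hv hv' =>
    (hD.sep K (hB' hK) K' (hB' hK') hne v hv v hv').1 rfl
  have p4 : ∀ K ∈ B', ∀ v ∈ K, ∀ w, G.Adj v w → w ∈ K ∨ w ∈ Z := fun K hK v hv w hvw => by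
    rcases Setup.adj_block hD (hB' hK) hv hvw with e | e
    · exact .inl e
    · exact .inr (Finset.mem_filter.2 ⟨e, K, hK, v, hv, hvw.symm⟩)
  constructor
  · have := h.tough Z B' h2 p1 p2 p3 p4
    omega
  · intro hout
    have := h.tough_succ Z B' (by omega) p1 p2 p3 p4 (by
      rcases hout with ⟨w, hwST, hw⟩ | ⟨w, hwT, hw⟩
      · exact ⟨w, fun hwZ => hwST (Finset.mem_filter.1 hwZ).1, hw⟩
      · refine ⟨w, fun hwZ => ?_, fun K hK => Setup.notMem_block hD (hB' hK) (by simp [hwT])⟩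
        obtain ⟨-, K, hK, v, hv, a⟩ := Finset.mem_filter.1 hwZ
        exact hw K hK v hv a)
    omega

end

/-- The vertices outside `S` can be covered by disjoint paths with both ends in `S`. -/
theorem Setup.exists_cover [Fintype V] [DecidableEq V] {S : Finset V} {κ : V → ι} (h : Setup G S κ) :
    ∃ P, IsSPathCover G S κ P := by
  classical
  have hP4 : P4Free G Sᶜ := by
    intro a ha b hb c hc d hd hab hbc hcd
    rw [Finset.mem_compl] at ha hb hc hd
    by_contra! H
    obtain ⟨e, he, ke⟩ := h.other a ha
    have k1 := h.label a ha b hb hab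
    have k2 := h.label b hb c hc hbc
    have k3 := h.label c hc d hd hcd
    exact h.false_of_P4P1 a b c d e hab hbc hcd H.1 H.2.1 H.2.2 (h.not_adj he ha ke)
      (h.not_adj he hb (k1 ▸ ke)) (h.not_adj he hc (k2 ▸ k1 ▸ ke))
      (h.not_adj he hd (k3 ▸ k2 ▸ k1 ▸ ke))
  obtain ⟨v0, hv0⟩ := h.exists_notMem
  obtain ⟨T, B, hD⟩ := hP4.exists_dec ⟨v0, Finset.mem_compl.2 hv0⟩
  suffices hM : HasMatch G B (S ∪ T) by
    obtain ⟨l, R, h1, h2, h3, h4⟩ := hM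
    exact h.exists_cover_of_match hD l h1 R h2 h3 h4
  obtain ⟨Three, hThree⟩ : ∃ p : Prop, p ↔
    ∃ u v w, u ∉ S ∧ v ∉ S ∧ w ∉ S ∧ κ u ≠ κ v ∧ κ u ≠ κ w ∧ κ v ≠ κ w := ⟨_, Iff.rfl⟩
  let c := completeTo G (S ∪ T)
  let Whole : Finset V → Prop := fun K => ∀ t ∈ T, ∀ v ∈ K, ¬ G.Adj t v
  -- a whole block can be matched
  have hHC : ∀ K ∈ B, Whole K → ∀ S' ⊆ S, (S \ S').card ≤ 2 →
      ∃ U ⊆ S', U.card ≤ 2 ∧ HasMatch G {K} U := by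
    intro K hK hKw S' hS' hc
    obtain ⟨v, hv⟩ := (hD.block K hK).nonempty
    obtain ⟨l, hl, x, hx, y, hy, s, hs, s', hs', hne, a1, a2⟩ := h.exists_ham_of_class
      (h.block_eq_class hD hK hKw hv) (hD.block K hK) hS' hc
    exact ⟨{s, s'}, by simp [Finset.insert_subset_iff, hs, hs'], Finset.card_le_two,
      hasMatch_singleton hl hx hy a1 a2 hne⟩
  -- two whole blocks span different components
  have hwne : ∀ K ∈ B, ∀ K' ∈ B, Whole K → K ≠ K' → ∀ v ∈ K, ∀ v' ∈ K', κ v' ≠ κ v := by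
    intro K hK K' hK' hw hne v hv v' hv' e
    have := (h.block_eq_class hD hK hw hv v').2 ⟨Setup.block_notMem hD hK' hv', e⟩
    exact (hD.sep K hK K' hK' hne v' this v' hv').1 rfl
  -- Whole components cannot rely on connecting vertices. They are matched directly, unless there
  -- are three components and enough complete vertices for Hall's theorem.
  let Pre := B.filter fun K => Whole K ∧ (Three → (c K).card ≤ 5)
  have memPre : ∀ K, K ∈ Pre ↔ K ∈ B ∧ Whole K ∧ (Three → (c K).card ≤ 5) :=
    fun K => Finset.mem_filter
  by_cases hPre : 1 < Pre.card
  · obtain ⟨K, hK, K', hK', hne⟩ := Finset.one_lt_card.1 hPre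
    obtain ⟨hKB, hKw, hKc⟩ := (memPre K).1 hK
    obtain ⟨hKB', hKw', hKc'⟩ := (memPre K').1 hK'
    obtain ⟨v, hv⟩ := (hD.block K hKB).nonempty
    obtain ⟨v', hv'⟩ := (hD.block K' hKB').nonempty
    have hvv' := hwne K hKB K' hKB' hKw hne v hv v' hv'
    have hclass := h.block_eq_class hD hKB hKw hv
    have hclass' := h.block_eq_class hD hKB' hKw' hv'
    have hthird : ∀ w, w ∉ S → w ∉ K → w ∉ K' → Three := by
      intro w hw h1 h2
      rw [hThree]
      refine ⟨v, v', w, Setup.block_notMem hD hKB hv, Setup.block_notMem hD hKB' hv', hw, hvv'.symm,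
        ?_, ?_⟩
      · exact fun e => h1 ((hclass w).2 ⟨hw, e.symm⟩)
      · exact fun e => h2 ((hclass' w).2 ⟨hw, e.symm⟩)
    by_cases h3 : Three
    · exfalso
      have hw : ∃ w, w ∉ S ∧ κ w ≠ κ v ∧ κ w ≠ κ v' := by
        obtain ⟨a, b, d, ha, hb, hd, hab, had, hbd⟩ := hThree.1 h3
        by_contra! H
        have e1 := H a ha
        have e2 := H b hb
        have e3 := H d hd
        rcases exists_ne_ne (κ v) (κ v') hab had hbd with ⟨e, e'⟩ | ⟨e, e'⟩ | ⟨e, e'⟩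
        exacts [e' (e1 e), e' (e2 e), e' (e3 e)]
      obtain ⟨w, hwS, k1, k2⟩ := hw
      -- With a third component, a vertex of `S` cannot have nonneighbours in both. Hence |S| ≤ 10,
      -- while three components demand 27 ≤ 2|S|.
      have hsub : S ⊆ c K ∪ c K' := by
        intro s hs
        by_contra hs'
        simp only [Finset.mem_union, c, mem_completeTo, hs, true_or, true_and] at hs'
        push Not at hs'
        obtain ⟨⟨u, hu, nu⟩, u', hu', nu'⟩ := hs'
        have hku := ((hclass u).1 hu)
        have hku' := ((hclass' u').1 hu')
        have := h.eq_of_not_adj hs hku.1 hku'.1 hwS (by rw [hku.2]; exact k1)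
          (by rw [hku'.2]; exact k2) nu nu'
        rw [hku.2, hku'.2] at this
        exact hvv' this.symm
      have h1 := (Finset.card_le_card hsub).trans (Finset.card_union_le _ _)
      have hKc := hKc h3
      have hKc' := hKc' h3
      have hnoadj : ∀ L ∈ ({K, K'} : Finset (Finset V)), ∀ v ∈ L, ∀ w, G.Adj v w → w ∈ L ∨ w ∈ S := by
        intro L hL u hu z huw
        have hLB : L ∈ B ∧ Whole L := by
          simp only [Finset.mem_insert, Finset.mem_singleton] at hL
          rcases hL with rfl | rfl
          exacts [⟨hKB, hKw⟩, ⟨hKB', hKw'⟩]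
        rcases Setup.adj_block hD hLB.1 hu huw with e | e
        · exact .inl e
        · rcases Finset.mem_union.1 e with e | e
          · exact .inr e
          · exact absurd huw.symm (hLB.2 z e u hu)
      have h2 := h.tough_succ S {K, K'} (by rw [Finset.card_pair hne]; omega)
        (by simpa using ⟨⟨v, hv⟩, ⟨v', hv'⟩⟩)
        (by
          intro L hL u hu
          simp only [Finset.mem_insert, Finset.mem_singleton] at hL
          rcases hL with rfl | rfl
          exacts [Setup.block_notMem hD hKB hu, Setup.block_notMem hD hKB' hu])
        (by
          intro L hL L' hL' hLL u hu hu'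
          simp only [Finset.mem_insert, Finset.mem_singleton] at hL hL'
          have : L ∈ B := by rcases hL with rfl | rfl <;> assumption
          have : L' ∈ B := by rcases hL' with rfl | rfl <;> assumption
          exact (hD.sep L ‹_› L' ‹_› hLL u hu u hu').1 rfl)
        hnoadj ⟨w, hwS, by
          simp only [Finset.mem_insert, Finset.mem_singleton, forall_eq_or_imp, forall_eq]
          exact ⟨fun e => k1 ((hclass w).1 e).2, fun e => k2 ((hclass' w).1 e).2⟩⟩
      rw [Finset.card_pair hne] at h2
      omega
    · have hBeq : B = {K} ∪ {K'} := by
        ext L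
        simp only [Finset.mem_union, Finset.mem_singleton]
        constructor
        · intro hL
          by_contra! hLne
          obtain ⟨w, hw⟩ := (hD.block L hL).nonempty
          exact h3 (hthird w (Setup.block_notMem hD hL hw)
            (fun e => (hD.sep L hL K hKB hLne.1 w hw w e).1 rfl)
            (fun e => (hD.sep L hL K' hKB' hLne.2 w hw w e).1 rfl))
        · rintro (rfl | rfl) <;> assumption
      -- The first component uses at most two vertices of `S`, which is the loss that `hHC`
      -- tolerates for the second.
      obtain ⟨U, hU, hUc, hM⟩ := hHC K hKB hKw S subset_rfl (by simp)
      obtain ⟨U', hU', -, hM'⟩ := hHC K' hKB' hKw' (S \ U) Finset.sdiff_subset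
        (by rwa [Finset.sdiff_sdiff_eq_self hU])
      rw [hBeq]
      refine (hM.union hM' (by simpa using hne)
        (Finset.disjoint_sdiff.mono_right hU')).mono ?_
      exact Finset.union_subset (hU.trans Finset.subset_union_left)
        ((hU'.trans Finset.sdiff_subset).trans Finset.subset_union_left)
  -- now at most one block is treated beforehand
  obtain ⟨U0, hU0S, hU0c, hM0⟩ : ∃ U0 ⊆ S, U0.card ≤ 2 ∧ HasMatch G Pre U0 := by
    rcases Nat.le_one_iff_eq_zero_or_eq_one.1 (not_lt.1 hPre) with h0 | h1
    · rw [Finset.card_eq_zero] at h0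
      rw [h0]
      exact ⟨∅, by simp, by simp, hasMatch_empty G⟩
    · obtain ⟨K, hK⟩ := Finset.card_eq_one.1 h1
      have := (memPre K).1 (by rw [hK]; simp)
      rw [hK]
      exact hHC K this.1 this.2.1 S subset_rfl (by simp)
  have hnonwhole : ∀ K ∈ B, K ∉ Pre → ¬ (Three ∧ 6 ≤ (c K).card) → ∃ t ∈ T, ∃ v ∈ K, G.Adj t v := by
    intro K hK hKP hn
    by_contra! H
    exact hKP ((memPre K).2 ⟨hK, H, fun h3 => by
      by_contra hc
      exact hn ⟨h3, by omega⟩⟩)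
  -- Blocks too poor in complete vertices to survive the loss of four. Two of them would be
  -- separated from each other and from a third piece by at most ten vertices, against 27 ≤ 2|Z|.
  let Exc := (B \ Pre).filter fun K => (c K).card ≤ 5
  have memExc : ∀ K, K ∈ Exc ↔ (K ∈ B ∧ K ∉ Pre) ∧ (c K).card ≤ 5 := fun K => by
    simp only [Exc, Finset.mem_filter, Finset.mem_sdiff]
  have hExcw : ∀ K ∈ Exc, ∃ t ∈ T, ∃ v ∈ K, G.Adj t v := fun K hK => by
    have := (memExc K).1 hK
    exact hnonwhole K this.1.1 this.1.2 (by omega)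
  have hTS : ∀ t ∈ T, t ∉ S := fun t ht => Finset.mem_compl.1 ((hD.mem_iff t).2 (.inl ht))
  have hExc1 : Exc.card ≤ 1 := by
    by_contra! hE
    obtain ⟨K, hK, K', hK', hne⟩ := Finset.one_lt_card.1 hE
    have m := (memExc K).1 hK
    have m' := (memExc K').1 hK'
    have hsub : ({K, K'} : Finset (Finset V)) ⊆ B := by
      simp [Finset.insert_subset_iff, m.1.1, m'.1.1]
    obtain ⟨-, h2⟩ := h.tough_blocks hD hsub (by rw [Finset.card_pair hne])
      (.inr (by
        simp only [Finset.mem_insert, Finset.mem_singleton, forall_eq_or_imp, forall_eq]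
        exact ⟨hExcw K hK, hExcw K' hK'⟩))
    -- The third piece is seen in another component if both blocks share one. Otherwise it is a
    -- second block at a connecting vertex of `K`, in the component of `K`.
    have hout : (∃ w, w ∉ S ∪ T ∧ ∀ L ∈ ({K, K'} : Finset (Finset V)), w ∉ L) ∨
        (∃ w ∈ T, ∀ L ∈ ({K, K'} : Finset (Finset V)), ∀ v ∈ L, ¬ G.Adj w v) := by
      simp only [Finset.mem_insert, Finset.mem_singleton, forall_eq_or_imp, forall_eq]
      obtain ⟨v, hv⟩ := (hD.block K m.1.1).nonempty
      obtain ⟨v', hv'⟩ := (hD.block K' m'.1.1).nonempty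
      have hvS := Setup.block_notMem hD m.1.1 hv
      by_cases hk : κ v = κ v'
      · obtain ⟨w, hw, kw⟩ := h.other v hvS
        by_cases hwT : w ∈ T
        · refine .inr ⟨w, hwT, fun x hx e => kw ?_, fun x hx e => kw ?_⟩
          · rw [h.label w hw x (Setup.block_notMem hD m.1.1 hx) e, h.label_block hD m.1.1 hx hv]
          · rw [h.label w hw x (Setup.block_notMem hD m'.1.1 hx) e, h.label_block hD m'.1.1 hx hv',
              hk]
        · refine .inl ⟨w, by simp [hw, hwT], fun e => kw ?_, fun e => kw ?_⟩
          · exact h.label_block hD m.1.1 e hv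
          · rw [hk]; exact h.label_block hD m'.1.1 e hv'
      · obtain ⟨t, ht, u, hu, a⟩ := hExcw K hK
        obtain ⟨-, K'', hK'', hne'', hc''⟩ := hD.complete t ht K m.1.1 u hu a
        obtain ⟨w, hw⟩ := (hD.block K'' hK'').nonempty
        have hwS := Setup.block_notMem hD hK'' hw
        have kw : κ w = κ v := by
          rw [← h.label t (hTS t ht) w hwS (hc'' w hw),
            h.label t (hTS t ht) u (Setup.block_notMem hD m.1.1 hu) a, h.label_block hD m.1.1 hu hv]
        refine .inl ⟨w, fun e => Setup.notMem_block hD hK'' e hw, fun e => ?_, fun e => hk ?_⟩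
        · exact (hD.sep K'' hK'' K m.1.1 hne'' w hw w e).1 rfl
        · rw [← kw]; exact h.label_block hD m'.1.1 e hv'
    have h3 := h2 hout
    rw [Finset.card_pair hne] at h3
    have h4 : (({K, K'} : Finset (Finset V)).biUnion c).card ≤ (c K).card + (c K').card := by
      rw [Finset.biUnion_insert, Finset.singleton_biUnion]
      exact Finset.card_union_le _ _
    have : (({K, K'} : Finset (Finset V)).biUnion (completeTo G (S ∪ T))).card =
      (({K, K'} : Finset (Finset V)).biUnion c).card := rfl
    omega
  obtain ⟨U1, hU1, hU1c, hU01, hM1⟩ : ∃ U1 ⊆ S ∪ T, U1.card ≤ 2 ∧ Disjoint U0 U1 ∧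
      HasMatch G Exc U1 := by
    rcases Nat.le_one_iff_eq_zero_or_eq_one.1 hExc1 with h0 | h1
    · rw [Finset.card_eq_zero] at h0
      rw [h0]
      exact ⟨∅, by simp, by simp, by simp, hasMatch_empty G⟩
    · obtain ⟨K, hK⟩ := Finset.card_eq_one.1 h1
      have hKE : K ∈ Exc := by rw [hK]; simp
      have m := (memExc K).1 hKE
      rw [hK]
      obtain ⟨t, ht, u, hu, a⟩ := hExcw K hKE
      have htc := (hD.complete t ht K m.1.1 u hu a).1
      -- One end of the block goes to a connecting vertex `t`, which is complete to `K`; the other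
      -- needs an unused neighbour in `S`. Without one, the at most 2 + 5 vertices of `U0 ∪ c K`
      -- would separate `K`, against 18 ≤ 2|Z|.
      let Z : Finset V := (S \ U0).filter fun s => ∃ v ∈ K, G.Adj s v
      have hZ : Z.Nonempty := by
        by_contra hZ
        rw [Finset.not_nonempty_iff_eq_empty] at hZ
        have hbl : ∀ {v}, v ∈ K → v ∉ S := Setup.block_notMem hD m.1.1
        obtain ⟨w, hw, kw⟩ := h.other u (hbl hu)
        have hcS : ∀ v ∈ K, v ∉ U0 ∪ c K := by
          intro v hv e
          rcases Finset.mem_union.1 e with e | e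
          · exact hbl hv (hU0S e)
          · exact Setup.notMem_block hD m.1.1 (mem_completeTo.1 e).1 hv
        have h1 := h.tough_succ (U0 ∪ c K) {K} (by simp) (by simpa using ⟨u, hu⟩)
          (by simpa using hcS)
          (by simp only [Finset.mem_singleton]; rintro K rfl K' rfl h; exact absurd rfl h)
          (by
            simp only [Finset.mem_singleton, forall_eq]
            intro v hv w hvw
            rcases Setup.adj_block hD m.1.1 hv hvw with e | e
            · exact .inl e
            · right
              rcases Finset.mem_union.1 e with hwS | hwT
              · by_contra hwU
                have : w ∈ Z := Finset.mem_filter.2 ⟨by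
                  simp only [Finset.mem_union, not_or] at hwU
                  simp [hwS, hwU.1], v, hv, hvw.symm⟩
                rw [hZ] at this
                simp at this
              · exact Finset.mem_union_right _
                  (mem_completeTo.2 ⟨e, (hD.complete w hwT K m.1.1 v hv hvw.symm).1⟩))
          ⟨w, by
            intro e
            rcases Finset.mem_union.1 e with e | e
            · exact hw (hU0S e)
            · exact kw (h.label w hw u (hbl hu) ((mem_completeTo.1 e).2 u hu)), by
            simp only [Finset.mem_singleton, forall_eq]
            exact fun e => kw (h.label_block hD m.1.1 e hu)⟩
        have h2 := Finset.card_union_le U0 (c K)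
        simp at h1
        omega
      obtain ⟨s, hs⟩ := hZ
      obtain ⟨hs, x, hx, asx⟩ := Finset.mem_filter.1 hs
      rw [Finset.mem_sdiff] at hs
      obtain ⟨l, hl, -⟩ := (hD.block K m.1.1).exists_ham_cons hx
      have hne : x :: l ≠ [] := by simp
      refine ⟨{s, t}, ?_, Finset.card_le_two, ?_, hasMatch_singleton hl (x := x)
        (y := (x :: l).getLast hne) (by simp) (List.getLast?_eq_some_getLast hne) asx ?_ ?_⟩
      · simp [Finset.insert_subset_iff, hs.1, ht]
      · rw [Finset.disjoint_right]
        simp only [Finset.mem_insert, Finset.mem_singleton, forall_eq_or_imp, forall_eq]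
        exact ⟨hs.2, fun e => hTS t ht (hU0S e)⟩
      · exact htc _ ((hl.mem _).1 (List.getLast_mem hne))
      · rintro rfl
        exact hTS s ht hs.1
  let Rest := (B \ Pre) \ Exc
  have memRest : ∀ K, K ∈ Rest ↔ (K ∈ B ∧ K ∉ Pre) ∧ 6 ≤ (c K).card := fun K => by
    simp only [Rest, Finset.mem_sdiff, memExc]
    constructor
    · rintro ⟨h1, h2⟩; exact ⟨h1, by by_contra hc; exact h2 ⟨h1, by omega⟩⟩
    · rintro ⟨h1, h2⟩; exact ⟨h1, fun hc => by omega⟩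
  have hM2 : HasMatch G Rest (Rest.biUnion fun K => c K \ (U0 ∪ U1)) := by
    refine hasMatch_of_hall (fun K hK => hD.block K ((memRest K).1 hK).1.1) _ ?_ ?_
    · intro K hK v hv
      exact (mem_completeTo.1 (Finset.mem_sdiff.1 hv).1).2
    · intro B' hB'
      have hU : (U0 ∪ U1).card ≤ 4 := (Finset.card_union_le _ _).trans (by omega)
      have e : (B'.biUnion fun K => c K \ (U0 ∪ U1)) = B'.biUnion c \ (U0 ∪ U1) := by
        ext v
        simp only [Finset.mem_biUnion, Finset.mem_sdiff]
        constructor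
        · rintro ⟨K, hK, h1, h2⟩; exact ⟨⟨K, hK, h1⟩, h2⟩
        · rintro ⟨⟨K, hK, h1⟩, h2⟩; exact ⟨K, hK, h1, h2⟩
      have h1 := Finset.le_card_sdiff (U0 ∪ U1) (B'.biUnion c)
      rw [e]
      -- At most four vertices are already used. A single block keeps 6 - 4 = 2 candidates, and for
      -- n ≥ 2 blocks 4.5n - 4 ≥ 2n.
      by_cases h2 : 2 ≤ B'.card
      · have := (h.tough_blocks hD (hB'.trans (fun K hK => ((memRest K).1 hK).1.1)) h2 (by
          by_cases h3 : Three
          · exact .inl (hThree.1 h3)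
          · refine .inr fun K hK => ?_
            have := (memRest K).1 (hB' hK)
            exact hnonwhole K this.1.1 this.1.2 fun hh => h3 hh.1)).1
        change 9 * B'.card ≤ 2 * (B'.biUnion c).card at this
        omega
      · rcases Nat.lt_or_ge 0 B'.card with hp | hp
        · obtain ⟨K, rfl⟩ := Finset.card_eq_one.1 (show B'.card = 1 by omega)
          have := ((memRest K).1 (hB' (by simp))).2
          rw [Finset.singleton_biUnion] at *
          simp
          omega
        · omega
  have hBeq : B = (Pre ∪ Exc) ∪ Rest := by
    ext K
    simp only [Finset.mem_union, Rest, Finset.mem_sdiff]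
    have h1 : K ∈ Pre → K ∈ B := fun e => ((memPre K).1 e).1
    have h2 : K ∈ Exc → K ∈ B := fun e => ((memExc K).1 e).1.1
    tauto
  rw [hBeq]
  refine ((hM0.union hM1 ?_ hU01).union hM2 ?_ ?_).mono ?_
  · exact Finset.disjoint_left.2 fun K hK hK' => ((memExc K).1 hK').1.2 hK
  · rw [Finset.disjoint_left]
    intro K hK hK'
    have h1 := (memRest K).1 hK'
    rcases Finset.mem_union.1 hK with hK | hK
    · exact h1.1.2 hK
    · have := ((memExc K).1 hK).2
      omega
  · rw [Finset.disjoint_left]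
    intro v hv hv'
    obtain ⟨K, -, hvK⟩ := Finset.mem_biUnion.1 hv'
    exact (Finset.mem_sdiff.1 hvK).2 hv
  · refine Finset.union_subset (Finset.union_subset (hU0S.trans Finset.subset_union_left) hU1) ?_
    intro v hv
    obtain ⟨K, -, hvK⟩ := Finset.mem_biUnion.1 hv
    exact (mem_completeTo.1 (Finset.mem_sdiff.1 hvK).1).1

end ToughGraph

/-! ### Merging paths of a cover inside one component. -/

namespace ToughGraph
variable {V : Type*} {ι : Type*} {G : SimpleGraph V}

/-- `l` lists the vertices of a walk of `G` from `x` to `y`. -/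
structure Pth (G : SimpleGraph V) (l : List V) (x y : V) : Prop where
  chain : l.IsChain G.Adj
  head : l.head? = some x
  last : l.getLast? = some y

lemma Pth.ne_nil {l : List V} {x y : V} (h : Pth G l x y) : l ≠ [] := by
  rintro rfl; simpa using h.head

lemma Pth.single (x : V) : Pth G [x] x x := ⟨by simp, by simp, by simp⟩

lemma Pth.append {l l' : List V} {x y x' y' : V} (h : Pth G l x y) (h' : Pth G l' x' y')
    (ha : G.Adj y x') : Pth G (l ++ l') x y' := by
  refine ⟨h.chain.append h'.chain ?_, ?_, ?_⟩
  · simp [h.last, h'.head, ha]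
  · rw [List.head?_append_of_ne_nil _ h.ne_nil, h.head]
  · rw [List.getLast?_append_of_ne_nil _ h'.ne_nil, h'.last]

lemma Pth.cons {l : List V} {x y z : V} (h : Pth G l x y) (ha : G.Adj z x) : Pth G (z :: l) z y :=
  (Pth.single z).append h ha

lemma Pth.concat {l : List V} {x y z : V} (h : Pth G l x y) (ha : G.Adj y z) :
    Pth G (l ++ [z]) x z := h.append (Pth.single z) ha

lemma Pth.reverse {l : List V} {x y : V} (h : Pth G l x y) : Pth G l.reverse y x :=
  ⟨isChain_reverse_adj h.chain, by rw [List.head?_reverse, h.last],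
    by rw [List.getLast?_reverse, h.head]⟩

lemma Pth.left {A B : List V} {x y z : V} (h : Pth G (A ++ z :: B) x y) : Pth G (A ++ [z]) x z := by
  have := (List.isChain_split.1 h.chain).1
  refine ⟨this, ?_, by simp⟩
  have := h.head
  cases A <;> simpa using this

lemma Pth.right {A B : List V} {x y z : V} (h : Pth G (A ++ z :: B) x y) : Pth G (z :: B) z y := by
  have := (List.isChain_split.1 h.chain).2
  refine ⟨this, by simp, ?_⟩
  have := h.last
  rwa [List.getLast?_append_of_ne_nil _ (by simp)] at this

lemma Pth.tail {B : List V} {x y z w : V} (h : Pth G (z :: w :: B) x y) :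
    G.Adj z w ∧ Pth G (w :: B) w y := by
  have := List.isChain_cons_cons.1 h.chain
  exact ⟨this.1, this.2, by simp, by simpa using h.last⟩

lemma Pth.head_mem {l : List V} {x y : V} (h : Pth G l x y) : x ∈ l := List.mem_of_head? h.head

lemma Pth.last_mem {l : List V} {x y : V} (h : Pth G l x y) : y ∈ l := List.mem_of_getLast? h.last

/-- The reversed path. -/
def SPath.rev (t : SPath V) : SPath V := ⟨t.q, t.core.reverse, t.p⟩

lemma SPath.full_rev (t : SPath V) : t.rev.full = t.full.reverse := by
  simp [SPath.full, SPath.rev]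

/-- `t` is a path between two vertices of `S` whose inner path runs from `a ∉ S` to `b ∉ S`. -/
structure IsSP (G : SimpleGraph V) (S : Finset V) (t : SPath V) (a b : V) : Prop where
  left : t.p ∈ S
  right : t.q ∈ S
  core : Pth G t.core a b
  adj_left : G.Adj t.p a
  adj_right : G.Adj t.q b
  first : a ∉ S
  last : b ∉ S

lemma IsSP.rev {S : Finset V} {t : SPath V} {a b : V} (h : IsSP G S t a b) :
    IsSP G S t.rev b a :=
  ⟨h.right, h.left, h.core.reverse, h.adj_right, h.adj_left, h.last, h.first⟩

lemma IsSP.full {S : Finset V} {t : SPath V} {a b : V} (h : IsSP G S t a b) :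
    Pth G t.full t.p t.q :=
  (h.core.concat h.adj_right.symm).cons h.adj_left

lemma IsSPath.exists_isSP {S : Finset V} {κ : V → ι} {t : SPath V} (h : IsSPath G S κ t) :
    ∃ a b, IsSP G S t a b := by
  have h1 := List.head?_eq_some_head h.ne
  have h2 := List.getLast?_eq_some_getLast h.ne
  have hc := h.chain
  rw [SPath.full, List.isChain_cons, List.isChain_append,
    List.head?_append_of_ne_nil _ h.ne, h1, h2] at hc
  refine ⟨_, _, h.left, h.right, ⟨hc.2.1, h1, h2⟩, hc.1 _ rfl, ?_, h.head _ h1, h.last _ h2⟩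
  exact (hc.2.2.2 _ rfl _ (by simp)).symm

lemma IsSP.isSPath {S : Finset V} {κ : V → ι} {t : SPath V} {a b : V} (h : IsSP G S t a b)
    (hκ : ∀ x ∈ t.core, ∀ y ∈ t.core, x ∉ S → y ∉ S → κ x = κ y) : IsSPath G S κ t := by
  refine ⟨h.left, h.right, h.full.chain, h.core.ne_nil, ?_, ?_, hκ⟩
  · rw [h.core.head]; simpa using h.first
  · rw [h.core.last]; simpa using h.last

/-- Vertices of `S` at the beginning of a walk may be dropped. -/
lemma Pth.exists_trim_left {S : Finset V} {w : List V} {s y v : V} (h : Pth G w s y) (hs : s ∈ S)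
    (hv : v ∈ w) (hvS : v ∉ S) : ∃ A p c a, w = A ++ p :: c ∧ p ∈ S ∧ a ∉ S ∧ G.Adj p a ∧
      Pth G c a y ∧ ∀ u ∈ A, u ∈ S := by
  induction w generalizing s with
  | nil => simp at hv
  | cons z w ih =>
    obtain rfl : z = s := by simpa using h.head
    match w, h, hv with
    | [], h, hv => 
      obtain rfl : v = z := by simpa using hv
      exact absurd hs hvS
    | z' :: w, h, hv =>
      obtain ⟨h1, h2⟩ := h.tail
      by_cases hz : z' ∈ S
      · have hv' : v ∈ z' :: w := by
          rcases List.mem_cons.1 hv with rfl | hv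
          · exact absurd hs hvS
          · exact hv
        obtain ⟨A, p, c, a, e, r1, r2, r3, r4, r5⟩ := ih h2 hz hv'
        refine ⟨z :: A, p, c, a, by simp [e], r1, r2, r3, r4, ?_⟩
        simpa [hs] using r5
      · exact ⟨[], z, z' :: w, z', rfl, hs, hz, h1, h2, by simp⟩

/-- A walk between vertices of `S` contains a path in `S`-form with the same vertices outside `S`. -/
lemma Pth.exists_trim [DecidableEq V] {S : Finset V} {w : List V} {s s' v : V} (h : Pth G w s s')
    (hs : s ∈ S) (hs' : s' ∈ S) (hv : v ∈ w) (hvS : v ∉ S) : ∃ t a b, IsSP G S t a b ∧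
      (∀ u, t.full.count u ≤ w.count u) ∧ ∀ u ∈ w, u ∉ S → u ∈ t.core := by
  obtain ⟨A, p, c, a, rfl, hp, ha, hpa, hc, hA⟩ := h.exists_trim_left hs hv hvS
  have hr : Pth G (p :: c).reverse s' p := (hc.cons hpa).reverse
  obtain ⟨B, q, d, b, e, hq, hb, hqb, hd, hB⟩ := hr.exists_trim_left (v := a) hs'
    (by simp [hc.head_mem]) ha
  have e' : p :: c = d.reverse ++ q :: B.reverse := by
    rw [← List.reverse_reverse (p :: c), e]; simp
  match hdr : d.reverse with
  | [] =>
    have : d = [] := by simpa using hdr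
    exact absurd this hd.ne_nil
  | x :: core =>
    rw [hdr, List.cons_append] at e'
    obtain ⟨rfl, rfl⟩ := List.cons.inj e'
    have hd' := hd.reverse
    rw [hdr] at hd'
    have hcore : core ≠ [] := by
      rintro rfl
      have h1 : p = b := by simpa using hd'.last
      exact hb (h1 ▸ hp)
    obtain ⟨a', core', rfl⟩ := List.exists_cons_of_ne_nil hcore
    obtain ⟨-, h2⟩ := hd'.tail
    obtain rfl : a' = a := by simpa using hc.head
    refine ⟨⟨p, a' :: core', q⟩, a', b, ⟨hp, hq, h2, hpa, hqb, ha, hb⟩, ?_, ?_⟩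
    · intro u
      simp only [SPath.full, List.count_append, List.count_cons, List.count_nil, List.count_reverse]
      omega
    · intro u hu huS
      simp only [List.mem_append, List.mem_cons, List.mem_reverse] at hu ⊢
      rcases hu with hu | rfl | (hu | rfl | hu)
      · exact absurd (hA u hu) huS
      · exact absurd hp huS
      · exact hu
      · exact absurd hq huS
      · exact absurd (hB u hu) huS

/-- A path whose ends can be closed up can be opened at an inner vertex `y`. -/
lemma IsSP.exists_open [DecidableEq V] {S : Finset V} {t : SPath V} {a b : V} (h : IsSP G S t a b)
    (hpb : G.Adj t.p b) (hqa : G.Adj t.q a) {A B : List V} {y : V} (hy : t.core = A ++ y :: B)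
    (hB : ∀ y' ∈ B.head?, y' ∈ S ∨ G.Adj t.q y' ∨ G.Adj t.p y') :
    ∃ Y s, Pth G Y s y ∧ s ∈ S ∧ (∀ v, Y.count v ≤ t.full.count v) ∧
      ∀ v ∈ t.core, v ∉ S → v ∈ Y := by
  have hc := h.core
  rw [hy] at hc
  have hl := hc.left
  match B with
  | [] =>
    refine ⟨t.p :: (A ++ [y]), t.p, hl.cons h.adj_left, h.left, ?_, ?_⟩
    · intro v
      simp only [SPath.full, hy, List.count_append, List.count_cons, List.count_nil]; omega
    · intro v hv _; rw [hy] at hv; exact List.mem_cons_of_mem _ hv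
  | y' :: B =>
    obtain ⟨-, hr⟩ := hc.right.tail
    -- The part behind `y` is traversed first, entered from a vertex of `S`; its end is then
    -- connected to the front part through `p`, or through `q` when `p` is the entrance.
    rcases hB y' (by simp) with h1 | h1 | h1
    · refine ⟨(y' :: B) ++ (t.p :: (A ++ [y])), y', hr.append (hl.cons h.adj_left) hpb.symm, h1, ?_, ?_⟩
      · intro v
        simp only [SPath.full, hy, List.count_append, List.count_cons, List.count_nil]; omega
      · intro v hv _; rw [hy] at hv
        simp only [List.mem_append, List.mem_cons, List.not_mem_nil] at hv ⊢; tauto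
    · refine ⟨t.q :: ((y' :: B) ++ (t.p :: (A ++ [y]))), t.q,
        (hr.append (hl.cons h.adj_left) hpb.symm).cons h1, h.right, ?_, ?_⟩
      · intro v
        simp only [SPath.full, hy, List.count_append, List.count_cons, List.count_nil]; omega
      · intro v hv _; rw [hy] at hv
        simp only [List.mem_append, List.mem_cons, List.not_mem_nil] at hv ⊢; tauto
    · refine ⟨t.p :: ((y' :: B) ++ (t.q :: (A ++ [y]))), t.p,
        (hr.append (hl.cons hqa) h.adj_right.symm).cons h1, h.left, ?_, ?_⟩
      · intro v
        simp only [SPath.full, hy, List.count_append, List.count_cons, List.count_nil]; omega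
      · intro v hv _; rw [hy] at hv
        simp only [List.mem_append, List.mem_cons, List.not_mem_nil] at hv ⊢; tauto

/-- Two disjoint paths in one component that cannot be merged. -/
structure NoMerge [DecidableEq V] (G : SimpleGraph V) (S : Finset V) (κ : V → ι) (t1 t2 : SPath V)
    (a1 b1 a2 b2 : V) : Prop where
  sp1 : IsSP G S t1 a1 b1
  sp2 : IsSP G S t2 a2 b2
  label : ∀ x y, (x ∈ t1.core ∨ x ∈ t2.core) → (y ∈ t1.core ∨ y ∈ t2.core) → x ∉ S → y ∉ S →
    κ x = κ y
  no : ∀ w s s', Pth G w s s' → s ∈ S → s' ∈ S →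
    (∀ v, w.count v ≤ t1.full.count v + t2.full.count v) →
    (∀ v, v ∉ S → v ∈ t1.core ∨ v ∈ t2.core → v ∈ w) → False

section NoMerge
variable [DecidableEq V] {S : Finset V} {κ : V → ι} {t1 t2 : SPath V} {a1 b1 a2 b2 : V}

lemma NoMerge.symm (h : NoMerge G S κ t1 t2 a1 b1 a2 b2) : NoMerge G S κ t2 t1 a2 b2 a1 b1 :=
  ⟨h.sp2, h.sp1, fun x y hx hy => h.label x y hx.symm hy.symm,
    fun w s s' hw hs hs' h1 h2 => h.no w s s' hw hs hs' (fun v => by rw [add_comm]; exact h1 v)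
      fun v hv hm => h2 v hv hm.symm⟩

lemma NoMerge.rev (h : NoMerge G S κ t1 t2 a1 b1 a2 b2) : NoMerge G S κ t1.rev t2 b1 a1 a2 b2 := by
  have e : ∀ v, v ∈ t1.rev.core ↔ v ∈ t1.core := fun v => by simp [SPath.rev]
  refine ⟨h.sp1.rev, h.sp2, fun x y hx hy => h.label x y (by rwa [e] at hx) (by rwa [e] at hy),
    fun w s s' hw hs hs' h1 h2 => h.no w s s' hw hs hs' (fun v => ?_) fun v hv hm => h2 v hv ?_⟩
  · have := h1 v
    rwa [SPath.full_rev, List.count_reverse] at this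
  · rwa [e]

/-- Any of these edges would join the reversed first path to the second, leaving out `t1.p` or
`t2.p` if necessary. -/
lemma NoMerge.not_adj (h : NoMerge G S κ t1 t2 a1 b1 a2 b2) : ¬ G.Adj t1.p t2.p ∧
    ¬ G.Adj t1.p a2 ∧ ¬ G.Adj a1 t2.p ∧ ¬ G.Adj a1 a2 := by
  have h1 := h.rev
  have hcov : ∀ v, v ∈ t1.rev.core ↔ v ∈ t1.core := fun v => by simp [SPath.rev]
  have key : ∀ {w s s'}, Pth G w s s' → s ∈ S → s' ∈ S →
    (∀ v, w.count v ≤ t1.full.count v + t2.full.count v) →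
    (∀ v, v ∉ S → v ∈ t1.core ∨ v ∈ t2.core → v ∈ w) → False := fun a b c d e => h.no _ _ _ a b c d e
  have d1 := h.sp1.rev
  have d2 := h.sp2
  refine ⟨fun e => ?_, fun e => ?_, fun e => ?_, fun e => ?_⟩
  · refine key (d1.full.append d2.full e) d1.left d2.right ?_ ?_
    · intro v
      simp only [SPath.full_rev, List.count_append, List.count_reverse]; omega
    · intro v _ hv
      simp only [SPath.full, SPath.rev, List.mem_append, List.mem_cons, List.mem_reverse]; tauto
  · refine key (d1.full.append (d2.core.concat d2.adj_right.symm) e) d1.left d2.right ?_ ?_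
    · intro v
      simp only [SPath.full_rev, List.count_append, List.count_reverse]
      simp only [SPath.full, List.count_cons, List.count_append]; omega
    · intro v _ hv
      simp only [SPath.full, SPath.rev, List.mem_append, List.mem_cons, List.mem_reverse]; tauto
  · refine key ((d1.core.cons d1.adj_left).append d2.full e) d1.left d2.right ?_ ?_
    · intro v
      simp only [SPath.full, SPath.rev, List.count_cons, List.count_append, List.count_reverse]; omega
    · intro v _ hv
      simp only [SPath.full, SPath.rev, List.mem_append, List.mem_cons, List.mem_reverse]; tauto
  · refine key ((d1.core.cons d1.adj_left).append (d2.core.concat d2.adj_right.symm) e) d1.left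
      d2.right ?_ ?_
    · intro v
      simp only [SPath.full, SPath.rev, List.count_cons, List.count_append, List.count_reverse]; omega
    · intro v _ hv
      simp only [SPath.rev, List.mem_append, List.mem_cons, List.mem_reverse]; tauto

variable [Fintype V]

/-- Let `y` be a common neighbour of `t1.p` and `t2.p` in another component. Then a1, t1.p, y, t2.p,
a2 is an induced path, and a vertex `z` violating the claim misses four consecutive vertices of it.
-/
lemma NoMerge.adj_or (hS : Setup G S κ) (h : NoMerge G S κ t1 t2 a1 b1 a2 b2) {z : V} (hz : z ∉ S)
    (hz' : z ∈ t1.core ∨ z ∈ t2.core) :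
    G.Adj t1.p z ∨ G.Adj t2.p z ∨ (G.Adj a1 z ∧ G.Adj a2 z) := by
  obtain ⟨n1, n2, n3, n4⟩ := h.not_adj
  have m1 := h.sp1.core.head_mem
  have m2 := h.sp2.core.head_mem
  have hκ := h.label a1 a2 (.inl m1) (.inr m2) h.sp1.first h.sp2.first
  obtain ⟨y, hy, ky, e1, e2⟩ := hS.common_nbr h.sp1.left h.sp2.left h.sp1.first h.sp2.first hκ
    h.sp1.adj_left n2 n4
  have kz := h.label z a1 hz' (.inl m1) hz h.sp1.first
  have f1 : ¬ G.Adj a1 y := hS.not_adj h.sp1.first hy ky.symm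
  have f2 : ¬ G.Adj a2 y := hS.not_adj h.sp2.first hy (by rw [← hκ]; exact ky.symm)
  have fz : ¬ G.Adj z y := hS.not_adj hz hy (by rw [kz]; exact ky.symm)
  by_contra! H
  obtain ⟨g1, g2, g3⟩ := H
  by_cases g : G.Adj a1 z
  · exact hS.false_of_P4P1 a2 t2.p y t1.p z h.sp2.adj_left.symm e2 e1.symm f2 (fun e => n1 e.symm)
      (fun e => n2 e.symm) (fun e => g3 g e.symm) (fun e => g2 e.symm) fz (fun e => g1 e.symm)
  · exact hS.false_of_P4P1 a1 t1.p y t2.p z h.sp1.adj_left.symm e1 e2.symm f1 n1 n3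
      (fun e => g e.symm) (fun e => g1 e.symm) fz (fun e => g2 e.symm)

/-- In `adj_or` for `b1`, the alternatives would be merging edges. So both paths close up to cycles
and can be opened elsewhere. -/
lemma NoMerge.adj_p_last (hS : Setup G S κ) (h : NoMerge G S κ t1 t2 a1 b1 a2 b2) :
    G.Adj t1.p b1 := by
  obtain ⟨n1, n2, n3, n4⟩ := h.rev.not_adj
  rcases h.adj_or hS h.sp1.last (.inl h.sp1.core.last_mem) with e | e | e
  · exact e
  · exact absurd e.symm n3
  · exact absurd e.2.symm n4

lemma NoMerge.adj_q_first (hS : Setup G S κ) (h : NoMerge G S κ t1 t2 a1 b1 a2 b2) :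
    G.Adj t1.q a1 := h.rev.adj_p_last hS

/-- An edge from inside the second path to the start of `X` allows a merge, either by opening the
second path at `y` or by inserting `X` just behind `y`. -/
lemma NoMerge.not_adj_of_pth (hS : Setup G S κ) (h : NoMerge G S κ t1 t2 a1 b1 a2 b2) {y : V}
    (hy : y ∈ t2.core) {X : List V} {x : V} (hX : Pth G X x b1)
    (hXc : ∀ v, X.count v + [t1.q].count v ≤ t1.full.count v) (hXm : ∀ v ∈ t1.core, v ∈ X) :
    ¬ G.Adj y x := by
  intro hyx
  have hX' := hX.concat h.sp1.adj_right.symm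
  obtain ⟨A, B, hc⟩ := List.append_of_mem hy
  by_cases hB : ∀ y' ∈ B.head?, y' ∈ S ∨ G.Adj t2.q y' ∨ G.Adj t2.p y'
  · obtain ⟨Y, s, hY, hs, hYc, hYm⟩ := h.sp2.exists_open (h.symm.adj_p_last hS)
      (h.symm.adj_q_first hS) hc hB
    refine h.no _ _ _ (hY.append hX' hyx) hs h.sp1.right ?_ ?_
    · intro v
      have := hXc v
      have := hYc v
      simp only [List.count_append]; omega
    · rintro v hv (hm | hm)
      · simp [hXm v hm]
      · simp [hYm v hm hv]
  · push Not at hB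
    -- The successor `y'` is adjacent to neither `t2.p` nor `t2.q`, so `adj_or` for the reversed
    -- first path makes it adjacent to `t1.q` or to `b1`, and the first path fits between `y` and
    -- `y'`.
    obtain ⟨y', hy', hyS', n1, n2⟩ := hB
    obtain ⟨B, rfl⟩ : ∃ B', B = y' :: B' := by
      cases B with
      | nil => simp at hy'
      | cons z B => simp at hy'; exact ⟨B, by rw [hy']⟩
    have hy'c : y' ∈ t2.core := by simp [hc]
    have hp := h.sp2.core
    rw [hc] at hp
    have hl := hp.left.cons h.sp2.adj_left
    have hr := hp.right.tail.2.concat h.sp2.adj_right.symm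
    rcases h.rev.adj_or hS hyS' (.inr hy'c) with e | e | e
    · refine h.no _ _ _ ((hl.append hX' hyx).append hr e) h.sp2.left h.sp2.right ?_ ?_
      · intro v
        have := hXc v
        simp only [SPath.full, hc, List.count_append, List.count_cons, List.count_nil] at this ⊢
        omega
      · rintro v hv (hm | hm)
        · simp [hXm v hm]
        · rw [hc] at hm
          simp only [List.mem_append, List.mem_cons, List.not_mem_nil] at hm ⊢; tauto
    · exact absurd e n2
    · refine h.no _ _ _ ((hl.append hX hyx).append hr e.1) h.sp2.left h.sp2.right ?_ ?_
      · intro v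
        have := hXc v
        simp only [SPath.full, hc, List.count_append, List.count_cons, List.count_nil] at this ⊢
        omega
      · rintro v hv (hm | hm)
        · simp [hXm v hm]
        · rw [hc] at hm
          simp only [List.mem_append, List.mem_cons, List.not_mem_nil] at hm ⊢; tauto

/-- The other alternatives of `adj_or` are excluded by `not_adj_of_pth`. Consequently either path
can be opened at any vertex of its inner part. -/
lemma NoMerge.adj_p_inner (hS : Setup G S κ) (h : NoMerge G S κ t1 t2 a1 b1 a2 b2) {y : V}
    (hy : y ∈ t2.core) (hyS : y ∉ S) : G.Adj t2.p y := by
  have n1 : ¬ G.Adj y a1 := h.not_adj_of_pth hS hy h.sp1.core (by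
    intro v
    simp only [SPath.full, List.count_append, List.count_cons]; omega) fun v hv => hv
  have n2 : ¬ G.Adj y t1.p := h.not_adj_of_pth hS hy (h.sp1.core.cons h.sp1.adj_left) (by
    intro v
    simp only [SPath.full, List.count_append, List.count_cons]; omega) fun v hv => by simp [hv]
  rcases h.adj_or hS hyS (.inr hy) with e | e | e
  · exact absurd e.symm n2
  · exact e
  · exact absurd e.1.symm n1

lemma NoMerge.exists_open (hS : Setup G S κ) (h : NoMerge G S κ t1 t2 a1 b1 a2 b2) {y : V}
    (hy : y ∈ t2.core) : ∃ Y s, Pth G Y s y ∧ s ∈ S ∧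
      (∀ v, Y.count v ≤ t2.full.count v) ∧ ∀ v ∈ t2.core, v ∉ S → v ∈ Y := by
  obtain ⟨A, B, hc⟩ := List.append_of_mem hy
  refine h.sp2.exists_open (h.symm.adj_p_last hS) (h.symm.adj_q_first hS) hc fun y' hy' => ?_
  by_cases hyS' : y' ∈ S
  · exact .inl hyS'
  · refine .inr (.inr (h.adj_p_inner hS ?_ hyS'))
    rw [hc]
    simp [List.mem_of_head? hy']

/-- Both paths are opened at the ends of the edge and joined along it. -/
lemma NoMerge.not_adj_core (hS : Setup G S κ) (h : NoMerge G S κ t1 t2 a1 b1 a2 b2) {x y : V}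
    (hx : x ∈ t1.core) (hy : y ∈ t2.core) : ¬ G.Adj x y := by
  intro hxy
  obtain ⟨X, s, hX, hs, hXc, hXm⟩ := h.symm.exists_open hS hx
  obtain ⟨Y, s', hY, hs', hYc, hYm⟩ := h.exists_open hS hy
  refine h.no _ _ _ (hX.append hY.reverse hxy) hs hs' ?_ ?_
  · intro v
    have := hXc v
    have := hYc v
    simp only [List.count_append, List.count_reverse]; omega
  · rintro v hv (hm | hm)
    · simp [hXm v hm hv]
    · simp [hYm v hm hv]

end NoMerge

variable {S : Finset V} {κ : V → ι}

lemma IsSPathCover.perm {P P' : List (SPath V)} (h : IsSPathCover G S κ P) (p : P.Perm P') :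
    IsSPathCover G S κ P' :=
  ⟨fun t ht => h.isSPath t (p.mem_iff.2 ht), (p.map _).flatten.nodup_iff.1 h.nodup,
    fun v hv => by
      obtain ⟨t, ht, e⟩ := h.covers v hv
      exact ⟨t, p.mem_iff.1 ht, e⟩⟩

lemma exists_perm_of_not_pairwise {α : Type*} {R : α → α → Prop} : ∀ {l : List α},
    ¬ l.Pairwise R → ∃ a b l', l.Perm (a :: b :: l') ∧ ¬ R a b := by
  intro l
  induction l with
  | nil => intro h; simp at h
  | cons a l ih =>
    intro h
    by_cases h1 : ∀ b ∈ l, R a b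
    · have h2 : ¬ l.Pairwise R := fun h2 => h (List.pairwise_cons.2 ⟨h1, h2⟩)
      obtain ⟨b, c, l', p, hr⟩ := ih h2
      refine ⟨b, c, a :: l', ?_, hr⟩
      refine (p.cons a).trans ?_
      exact (List.Perm.swap b a _).trans ((List.Perm.swap c a _).cons b)
    · push Not at h1
      obtain ⟨b, hb, hr⟩ := h1
      classical
      exact ⟨a, b, l.erase b, (List.perm_cons_erase hb).cons a, hr⟩

/-- Two paths of a cover that are joined by an edge can be merged. -/
lemma Setup.exists_merge [Fintype V] [DecidableEq V] (h : Setup G S κ) {t1 t2 : SPath V}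
    {P : List (SPath V)} (hP : IsSPathCover G S κ (t1 :: t2 :: P)) {x y : V} (hx : x ∈ t1.core)
    (hy : y ∈ t2.core) (hxS : x ∉ S) (hyS : y ∉ S) (hxy : G.Adj x y) :
    ∃ t, IsSPathCover G S κ (t :: P) := by
  have hp1 := hP.isSPath t1 (by simp)
  have hp2 := hP.isSPath t2 (by simp)
  obtain ⟨a1, b1, h1⟩ := hp1.exists_isSP
  obtain ⟨a2, b2, h2⟩ := hp2.exists_isSP
  have hlab : ∀ u, u ∈ t1.core ∨ u ∈ t2.core → u ∉ S → κ u = κ x := by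
    rintro u (hu | hu) huS
    · exact hp1.label u hu x hx huS hxS
    · rw [hp2.label u hu y hy huS hyS, h.label x hxS y hyS hxy]
  by_contra hno
  refine NoMerge.not_adj_core h ⟨h1, h2, ?_, ?_⟩ hx hy hxy
  · intro u v hu hv huS hvS
    rw [hlab u hu huS, hlab v hv hvS]
  · intro w s s' hw hs hs' hcount hcov
    obtain ⟨t, a, b, ht, htc, htm⟩ := hw.exists_trim hs hs' (hcov x hxS (.inl hx)) hxS
    have hnd := hP.nodup
    rw [List.nodup_iff_count_le_one] at hnd
    simp only [List.map_cons, List.flatten_cons, List.count_append] at hnd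
    have hsub : ∀ u ∈ t.core, u ∉ S → u ∈ t1.core ∨ u ∈ t2.core := by
      intro u hu huS
      have e1 := htc u
      have e2 := hcount u
      have e3 : 0 < t.full.count u := List.count_pos_iff.2 (by simp [SPath.full, hu])
      have e4 : 0 < t1.full.count u ∨ 0 < t2.full.count u := by omega
      rw [List.count_pos_iff, List.count_pos_iff] at e4
      simp only [SPath.full, List.mem_cons, List.mem_append, List.not_mem_nil, or_false] at e4
      rcases e4 with (rfl | e4 | rfl) | (rfl | e4 | rfl)
      · exact absurd h1.left huS
      · exact .inl e4
      · exact absurd h1.right huS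
      · exact absurd h2.left huS
      · exact .inr e4
      · exact absurd h2.right huS
    refine hno ⟨t, ⟨?_, ?_, ?_⟩⟩
    · intro t' ht'
      rcases List.mem_cons.1 ht' with rfl | ht'
      · refine ht.isSPath fun u hu v hv huS hvS => ?_
        rw [hlab u (hsub u hu huS) huS, hlab v (hsub v hv hvS) hvS]
      · exact hP.isSPath t' (by simp [ht'])
    · rw [List.nodup_iff_count_le_one]
      intro u
      have e1 := htc u
      have e2 := hcount u
      have e3 := hnd u
      simp only [List.map_cons, List.flatten_cons, List.count_append]
      omega
    · intro v hv
      obtain ⟨t', ht', hvt⟩ := hP.covers v hv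
      simp only [List.mem_cons] at ht'
      rcases ht' with rfl | rfl | ht'
      · exact ⟨t, by simp, htm v (hcov v hv (.inl hvt)) hv⟩
      · exact ⟨t, by simp, htm v (hcov v hv (.inr hvt)) hv⟩
      · exact ⟨t', by simp [ht'], hvt⟩

/-- There is a cover with one path for each component. -/
theorem Setup.exists_cover_pairwise [Fintype V] [DecidableEq V] (h : Setup G S κ) :
    ∃ P, IsSPathCover G S κ P ∧
      P.Pairwise fun t t' => ∀ x ∈ t.core, ∀ y ∈ t'.core, x ∉ S → y ∉ S → κ x ≠ κ y := by
  obtain ⟨P, hP⟩ := h.exists_cover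
  induction hn : P.length using Nat.strong_induction_on generalizing P with
  | _ n ih =>
  by_cases hpw : P.Pairwise fun t t' => ∀ x ∈ t.core, ∀ y ∈ t'.core, x ∉ S → y ∉ S → κ x ≠ κ y
  · exact ⟨P, hP, hpw⟩
  obtain ⟨t1, t2, P', p, hr⟩ := exists_perm_of_not_pairwise hpw
  push Not at hr
  obtain ⟨x, hx, y, hy, hxS, hyS, hκ⟩ := hr
  have hP' := hP.perm p
  have hnd := hP'.nodup
  simp only [List.map_cons, List.flatten_cons] at hnd
  have hd : ∀ t ∈ t2 :: P', ∀ v ∈ t.core, v ∉ t1.core := by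
    intro t ht v hv hv1
    have h1 := List.disjoint_of_nodup_append hnd
    refine h1 (a := v) (by simp [SPath.full, hv1]) ?_
    rw [← List.flatten_cons, ← List.map_cons]
    exact List.mem_flatten.2 ⟨_, List.mem_map_of_mem ht, by simp [SPath.full, hv]⟩
  -- The two paths of the same component need not be joined by an edge, but some edge in that
  -- component leaves the first path; it leads to a path `t3` that can be merged with it.
  obtain ⟨x', hxS', y', hyS', -, -, hx', hy', hxy⟩ := h.cross (fun v => v ∈ t1.core) x hxS y hyS hκ hx
    (hd t2 (by simp) y hy)
  obtain ⟨t3, ht3, hy3⟩ := hP'.covers y' hyS'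
  have ht3' : t3 ∈ t2 :: P' := by
    rcases List.mem_cons.1 ht3 with rfl | e
    · exact absurd hy3 hy'
    · exact e
  obtain ⟨P'', p'⟩ : ∃ P'', (t2 :: P').Perm (t3 :: P'') := by
    classical
    exact ⟨_, List.perm_cons_erase ht3'⟩
  obtain ⟨t, ht⟩ := h.exists_merge (hP'.perm (p'.cons t1)) hx' hy3 hxS' hyS' hxy
  have e1 := p.length_eq
  have e2 := p'.length_eq
  simp only [List.length_cons] at e1 e2
  exact ih _ (by simp only [List.length_cons]; omega) (t :: P'') ht rfl

end ToughGraph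

/-! ### Assembling one path per component into a single path and a cycle. -/

namespace ToughGraph
variable {V : Type*} {ι : Type*} {G : SimpleGraph V}

/-- There is a cycle through all vertices outside `S`. -/
def HasCycle [DecidableEq V] (G : SimpleGraph V) (S : Finset V) : Prop :=
  ∃ c x y, Pth G c x y ∧ G.Adj y x ∧ (∀ v, c.count v ≤ 1) ∧ ∀ v ∉ S, v ∈ c

/-- There is a path with ends in `S` through all vertices outside `S`. -/
def HasPath [DecidableEq V] (G : SimpleGraph V) (S : Finset V) : Prop :=
  ∃ w s s', Pth G w s s' ∧ s ∈ S ∧ s' ∈ S ∧ s ≠ s' ∧ (∀ v, w.count v ≤ 1) ∧ ∀ v ∉ S, v ∈ w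

variable [DecidableEq V] {S : Finset V} {κ : V → ι}

/-- Rotating a path, using one of its ends in `S` if necessary. -/
lemma IsSP.exists_rot {t : SPath V} {a b y : V} (h : IsSP G S t a b) (hy : y ∈ t.core) (hya : y ≠ a)
    (H : ∀ z ∈ t.core, z ∉ S → ¬ G.Adj t.q z → G.Adj z b) : ∃ Y, Pth G Y y a ∧
      (∀ v, Y.count v ≤ t.core.count v + [t.q].count v) ∧ ∀ v ∈ t.core, v ∉ S → v ∈ Y := by
  obtain ⟨A, B, hc⟩ := List.append_of_mem hy
  have hp := h.core
  rw [hc] at hp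
  have key : ∀ A : List V, (∃ x ∈ A, x ∉ S) → ∃ C z D, A = C ++ z :: D ∧ z ∉ S ∧ ∀ x ∈ D, x ∈ S := by
    intro A
    induction A using List.reverseRecOn with
    | nil => simp
    | append_singleton A z ih =>
      intro hA
      by_cases hz : z ∈ S
      · obtain ⟨x, hx, hxS⟩ := hA
        rcases List.mem_append.1 hx with hx | hx
        · obtain ⟨C, z', D, rfl, h1, h2⟩ := ih ⟨x, hx, hxS⟩
          refine ⟨C, z', D ++ [z], by simp, h1, fun x hx => ?_⟩
          rcases List.mem_append.1 hx with hx | hx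
          · exact h2 x hx
          · simp at hx; exact hx ▸ hz
        · simp at hx; exact absurd hz (hx ▸ hxS)
      · exact ⟨A, z, [], rfl, hz, by simp⟩
  have hA : ∃ x ∈ A, x ∉ S := by
    refine ⟨a, ?_, h.first⟩
    have := hp.head
    cases A with
    | nil => simp at this; exact absurd this hya
    | cons x A => simp at this; simp [this]
  -- Here `z` is the last vertex outside `S` before `y`; the vertices of `S` between them are
  -- dropped. The rotated path runs from `y` to `b`, then to `z`, through `t.q` if that is adjacent
  -- to `z`, and back to `a`.
  obtain ⟨C, z, D, rfl, hzS, hD⟩ := key A hA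
  have hzc : z ∈ t.core := by simp [hc]
  have hr := hp.right
  have hl : Pth G (C ++ [z]) a z := by
    rw [List.append_assoc] at hp
    exact Pth.left (B := D ++ y :: B) (by simpa using hp)
  by_cases hqz : G.Adj t.q z
  · refine ⟨(y :: B) ++ (t.q :: (C ++ [z]).reverse), hr.append (hl.reverse.cons hqz) h.adj_right.symm,
      ?_, ?_⟩
    · intro v
      simp only [hc, List.count_append, List.count_cons, List.count_nil, List.count_reverse]; omega
    · intro v hv hvS
      rw [hc] at hv
      have := hD v
      simp only [List.mem_append, List.mem_cons, List.mem_reverse, List.not_mem_nil] at hv ⊢; tauto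
  · refine ⟨(y :: B) ++ (C ++ [z]).reverse, hr.append hl.reverse (H z hzc hzS hqz).symm, ?_, ?_⟩
    · intro v
      simp only [hc, List.count_append, List.count_cons, List.count_nil, List.count_reverse]; omega
    · intro v hv hvS
      rw [hc] at hv
      have := hD v
      simp only [List.mem_append, List.mem_cons, List.mem_reverse, List.not_mem_nil] at hv ⊢; tauto

omit [DecidableEq V] in
/-- If `s` has a nonneighbour `w`, then in other components than that of `w` its neighbours are
adjacent to its nonneighbours. -/
lemma Setup.adj_of_not_adj [Fintype V] (h : Setup G S κ) {s w y z : V} (hs : s ∈ S) (hw : w ∉ S)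
    (hy : y ∉ S) (hz : z ∉ S) (hyz : κ y = κ z) (hwz : κ w ≠ κ z) (nw : ¬ G.Adj s w)
    (nz : ¬ G.Adj s z) (ay : G.Adj s y) : G.Adj z y := by
  by_contra nzy
  obtain ⟨x0, hx0, k0, a0⟩ := h.nbr s hs w hw
  obtain ⟨x, hx, x', hx', kx, kx', ax, ax', axx'⟩ := h.cross (fun x => G.Adj s x) x0 hx0 w hw k0 a0 nw
  rw [k0] at kx kx'
  exact h.false_of_P4P1 x' x s y z axx'.symm ax.symm ay (fun e => ax' e.symm)
    (h.not_adj hx hy (by rw [kx, hyz]; exact hwz)) (h.not_adj hx' hy (by rw [kx', hyz]; exact hwz))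
    (h.not_adj hz hx' (by rw [kx']; exact hwz.symm)) (h.not_adj hz hx (by rw [kx]; exact hwz.symm))
    (fun e => nz e.symm) nzy

/-- A cover by two paths. -/
structure TwoPaths (G : SimpleGraph V) (S : Finset V) (κ : V → ι) (t1 t2 : SPath V)
    (a1 b1 a2 b2 : V) : Prop where
  sp1 : IsSP G S t1 a1 b1
  sp2 : IsSP G S t2 a2 b2
  count : ∀ v, t1.full.count v + t2.full.count v ≤ 1
  covers : ∀ v ∉ S, v ∈ t1.core ∨ v ∈ t2.core
  sep : ∀ x ∈ t1.core, ∀ y ∈ t2.core, x ∉ S → y ∉ S → κ x ≠ κ y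

section TwoPaths
variable {t1 t2 : SPath V} {a1 b1 a2 b2 : V}

omit [DecidableEq V] in
lemma SPath.mem_core_rev {t : SPath V} {v : V} : v ∈ t.rev.core ↔ v ∈ t.core := by
  simp [SPath.rev]

lemma TwoPaths.symm (h : TwoPaths G S κ t1 t2 a1 b1 a2 b2) : TwoPaths G S κ t2 t1 a2 b2 a1 b1 :=
  ⟨h.sp2, h.sp1, fun v => by rw [add_comm]; exact h.count v, fun v hv => (h.covers v hv).symm,
    fun x hx y hy hxS hyS => (h.sep y hy x hx hyS hxS).symm⟩

lemma TwoPaths.rev (h : TwoPaths G S κ t1 t2 a1 b1 a2 b2) : TwoPaths G S κ t1.rev t2 b1 a1 a2 b2 :=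
  ⟨h.sp1.rev, h.sp2, fun v => by rw [SPath.full_rev, List.count_reverse]; exact h.count v,
    fun v hv => by rw [SPath.mem_core_rev]; exact h.covers v hv,
    fun x hx y hy hxS hyS => h.sep x (SPath.mem_core_rev.1 hx) y hy hxS hyS⟩

/-- A cycle or path made of pieces from two paths covers everything. -/
lemma TwoPaths.covers_of (h : TwoPaths G S κ t1 t2 a1 b1 a2 b2) {c : List V}
    (h1 : ∀ v ∈ t1.core, v ∉ S → v ∈ c) (h2 : ∀ v ∈ t2.core, v ∉ S → v ∈ c) : ∀ v ∉ S, v ∈ c := by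
  intro v hv
  rcases h.covers v hv with e | e
  exacts [h1 v e hv, h2 v e hv]

/-- If `q1` is adjacent to `a2` and `p1` to `b2`, the cycle is easily found. -/
lemma TwoPaths.hasCycle_of_adj (h : TwoPaths G S κ t1 t2 a1 b1 a2 b2) (e1 : G.Adj t1.q a2)
    (e2 : G.Adj t1.p b2) : HasCycle G S := by
  refine ⟨t1.full ++ t2.core, _, _, h.sp1.full.append h.sp2.core e1, e2.symm, fun v => ?_,
    h.covers_of (fun v hv _ => by simp [SPath.full, hv]) fun v hv _ => by simp [hv]⟩
  have := h.count v
  simp only [SPath.full, List.count_append, List.count_cons] at this ⊢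
  omega

/-- A cycle through one end in `S` of each path. -/
lemma TwoPaths.hasCycle_of_adj_adj (h : TwoPaths G S κ t1 t2 a1 b1 a2 b2) (e1 : G.Adj t1.q a2)
    (e2 : G.Adj t2.q a1) : HasCycle G S := by
  refine ⟨(t1.core ++ [t1.q]) ++ (t2.core ++ [t2.q]), _, _,
    (h.sp1.core.concat h.sp1.adj_right.symm).append (h.sp2.core.concat h.sp2.adj_right.symm) e1, e2,
    fun v => ?_, h.covers_of (fun v hv _ => by simp [hv]) fun v hv _ => by simp [hv]⟩
  have := h.count v
  simp only [SPath.full, List.count_append, List.count_cons] at this ⊢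
  omega

/-- `q1` can be joined to the second path. -/
lemma TwoPaths.hasPath_of_adj (h : TwoPaths G S κ t1 t2 a1 b1 a2 b2) (e1 : G.Adj t1.q a2) :
    HasPath G S := by
  have hc := h.count
  simp only [SPath.full, List.count_append, List.count_cons] at hc
  refine ⟨t1.full ++ (t2.core ++ [t2.q]), _, _,
    h.sp1.full.append (h.sp2.core.concat h.sp2.adj_right.symm) e1, h.sp1.left, h.sp2.right, ?_,
    fun v => ?_, h.covers_of (fun v hv _ => by simp [SPath.full, hv]) fun v hv _ => by simp [hv]⟩
  · intro e
    have := hc t1.p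
    simp [e] at this
    omega
  · have := hc v
    simp only [SPath.full, List.count_append, List.count_cons] at this ⊢
    omega

lemma TwoPaths.exists_nbr [Fintype V] (hS : Setup G S κ) (h : TwoPaths G S κ t1 t2 a1 b1 a2 b2)
    {s : V} (hs : s ∈ S) : ∃ y ∈ t2.core, y ∉ S ∧ κ y = κ a2 ∧ G.Adj s y := by
  obtain ⟨y, hy, ky, ay⟩ := hS.nbr s hs a2 h.sp2.first
  refine ⟨y, (h.covers y hy).resolve_left fun hy1 => ?_, hy, ky, ay⟩
  exact h.sep y hy1 a2 h.sp2.core.head_mem hy h.sp2.first ky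

/-- A nonneighbour of `t2.q` in the other component makes its nonneighbours in the second path
adjacent to its neighbour `b2`, which is what a rotation needs. -/
lemma TwoPaths.exists_rot [Fintype V] (hS : Setup G S κ) (h : TwoPaths G S κ t1 t2 a1 b1 a2 b2)
    (hl : ∀ x ∈ t2.core, ∀ y ∈ t2.core, x ∉ S → y ∉ S → κ x = κ y) {w y : V} (hw : w ∈ t1.core)
    (hwS : w ∉ S) (nw : ¬ G.Adj t2.q w) (hy : y ∈ t2.core) (hya : y ≠ a2) :
    ∃ Y, Pth G Y y a2 ∧ (∀ v, Y.count v ≤ t2.core.count v + [t2.q].count v) ∧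
      ∀ v ∈ t2.core, v ∉ S → v ∈ Y :=
  h.sp2.exists_rot hy hya fun z hz hzS nz => hS.adj_of_not_adj h.sp2.right hwS h.sp2.last hzS
    (hl _ h.sp2.core.last_mem z hz h.sp2.last hzS) (h.sep w hw z hz hwS hzS) nw nz h.sp2.adj_right

lemma TwoPaths.hasPath_of_rot (h : TwoPaths G S κ t1 t2 a1 b1 a2 b2) {Y : List V} {y : V}
    (hY : Pth G Y y a2) (hYc : ∀ v, Y.count v ≤ t2.core.count v + [t2.q].count v)
    (hYm : ∀ v ∈ t2.core, v ∉ S → v ∈ Y) (e : G.Adj t1.q y) : HasPath G S := by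
  have hc := h.count
  simp only [SPath.full, List.count_append, List.count_cons] at hc
  refine ⟨t1.full ++ (Y ++ [t2.p]), _, _, h.sp1.full.append (hY.concat h.sp2.adj_left.symm) e,
    h.sp1.left, h.sp2.left, ?_, fun v => ?_,
    h.covers_of (fun v hv _ => by simp [SPath.full, hv]) fun v hv hvS => by simp [hYm v hv hvS]⟩
  · intro e
    have := hc t1.p
    simp [e] at this
    omega
  · have := hc v
    have := hYc v
    simp only [SPath.full, List.count_append, List.count_cons, List.count_nil] at this ⊢
    omega

lemma TwoPaths.hasCycle_of_rot (h : TwoPaths G S κ t1 t2 a1 b1 a2 b2) {Y : List V} {y : V}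
    (hY : Pth G Y y a2) (hYc : ∀ v, Y.count v ≤ t2.core.count v + [t2.q].count v)
    (hYm : ∀ v ∈ t2.core, v ∉ S → v ∈ Y) (e : G.Adj t1.q y) (e' : G.Adj t1.p a2) :
    HasCycle G S := by
  refine ⟨t1.full ++ Y, _, _, h.sp1.full.append hY e, e'.symm, fun v => ?_,
    h.covers_of (fun v hv _ => by simp [SPath.full, hv]) fun v hv hvS => by simp [hYm v hv hvS]⟩
  have := h.count v
  have := hYc v
  simp only [SPath.full, List.count_append, List.count_cons, List.count_nil] at *
  omega

/-- With two components, there is a path. -/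
lemma TwoPaths.hasPath [Fintype V] (hS : Setup G S κ) (h : TwoPaths G S κ t1 t2 a1 b1 a2 b2)
    (hl : ∀ x ∈ t2.core, ∀ y ∈ t2.core, x ∉ S → y ∉ S → κ x = κ y) : HasPath G S := by
  by_cases hw : ∀ w ∈ t1.core, w ∉ S → G.Adj t2.q w
  · exact h.symm.hasPath_of_adj (hw a1 h.sp1.core.head_mem h.sp1.first)
  push Not at hw
  obtain ⟨w, hw, hwS, nw⟩ := hw
  obtain ⟨y, hy, hyS, -, ay⟩ := h.exists_nbr hS h.sp1.right
  by_cases hya : y = a2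
  · exact h.hasPath_of_adj (hya ▸ ay)
  · obtain ⟨Y, hY, hYc, hYm⟩ := h.exists_rot hS hl hw hwS nw hy hya
    exact h.hasPath_of_rot hY hYc hYm ay

omit [DecidableEq V] in
lemma Pth.eq_of_same_ends {l : List V} {x y : V} (h : Pth G l x x) (hl : l.Nodup) (hy : y ∈ l) :
    y = x := by
  match l, h with
  | [], h => simp at hy
  | z :: l, h =>
    obtain rfl : z = x := by simpa using h.head
    rcases eq_or_ne l [] with rfl | hne
    · simpa using hy
    · have := h.last
      rw [List.getLast?_cons_of_ne_nil hne] at this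
      exact absurd (List.mem_of_getLast? this) (List.nodup_cons.1 hl).1

/-- Both paths are rotated. -/
lemma TwoPaths.hasCycle_of_two_rot (h : TwoPaths G S κ t1 t2 a1 b1 a2 b2) {Y1 Y2 : List V}
    {y1 y2 : V} (hY1 : Pth G Y1 y1 a1) (hY1c : ∀ v, Y1.count v ≤ t1.core.count v + [t1.q].count v)
    (hY1m : ∀ v ∈ t1.core, v ∉ S → v ∈ Y1) (hY2 : Pth G Y2 y2 a2)
    (hY2c : ∀ v, Y2.count v ≤ t2.core.count v + [t2.q].count v)
    (hY2m : ∀ v ∈ t2.core, v ∉ S → v ∈ Y2) (e1 : G.Adj t2.p y1) (e2 : G.Adj t1.p y2) :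
    HasCycle G S := by
  refine ⟨(t2.p :: Y1) ++ (t1.p :: Y2), _, _, (hY1.cons e1).append (hY2.cons e2)
    h.sp1.adj_left.symm, h.sp2.adj_left.symm, fun v => ?_,
    h.covers_of (fun v hv hvS => by simp [hY1m v hv hvS]) fun v hv hvS => by simp [hY2m v hv hvS]⟩
  have := h.count v
  have := hY1c v
  have := hY2c v
  simp only [SPath.full, List.count_append, List.count_cons, List.count_nil] at *
  omega

/-- If both conclusions fail, both paths are rotated: the one from `y1` to `a1` is entered from
`t2.p` and left to `t1.p`, the one from `y2` to `a2` is entered from `t1.p` and left to `t2.p`. -/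
lemma TwoPaths.hasCycle_of_helpers [Fintype V] (hS : Setup G S κ)
    (h : TwoPaths G S κ t1 t2 a1 b1 a2 b2)
    (hl1 : ∀ x ∈ t1.core, ∀ y ∈ t1.core, x ∉ S → y ∉ S → κ x = κ y)
    (hl2 : ∀ x ∈ t2.core, ∀ y ∈ t2.core, x ∉ S → y ∉ S → κ x = κ y)
    (n1 : ∃ w ∈ t2.core, w ∉ S ∧ ¬ G.Adj t1.q w) (n2 : ∃ w ∈ t1.core, w ∉ S ∧ ¬ G.Adj t2.q w)
    (hno : ¬ HasCycle G S) : (∀ y ∈ t1.core, y ∉ S → G.Adj t2.p y → y = a1) ∨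
      ∀ y ∈ t2.core, y ∉ S → G.Adj t1.p y → y = a2 := by
  by_contra! H
  obtain ⟨⟨y1, hy1, -, e1, ne1⟩, y2, hy2, -, e2, ne2⟩ := H
  obtain ⟨w1, hw1, hwS1, nw1⟩ := n1
  obtain ⟨w2, hw2, hwS2, nw2⟩ := n2
  obtain ⟨Y1, p1, q1, r1⟩ := h.symm.exists_rot hS hl1 hw1 hwS1 nw1 hy1 ne1
  obtain ⟨Y2, p2, q2, r2⟩ := h.exists_rot hS hl2 hw2 hwS2 nw2 hy2 ne2
  exact hno (h.hasCycle_of_two_rot p1 q1 r1 p2 q2 r2 e1 e2)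

/-- With two components, if three of the ends have nonneighbours in the other path, there is a
cycle. -/
lemma TwoPaths.hasCycle_of_exists_not_adj [Fintype V] (hS : Setup G S κ) (h : TwoPaths G S κ t1 t2 a1 b1 a2 b2)
    (hl1 : ∀ x ∈ t1.core, ∀ y ∈ t1.core, x ∉ S → y ∉ S → κ x = κ y)
    (hl2 : ∀ x ∈ t2.core, ∀ y ∈ t2.core, x ∉ S → y ∉ S → κ x = κ y)
    (n1 : ∃ w ∈ t2.core, w ∉ S ∧ ¬ G.Adj t1.p w) (n2 : ∃ w ∈ t2.core, w ∉ S ∧ ¬ G.Adj t1.q w)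
    (m1 : ∃ w ∈ t1.core, w ∉ S ∧ ¬ G.Adj t2.p w) : HasCycle G S := by
  by_contra hno
  obtain ⟨y, hy, hyS, -, ay⟩ := h.symm.exists_nbr hS h.sp2.left
  by_cases m2 : ∀ w ∈ t1.core, w ∉ S → G.Adj t2.q w
  · by_cases hya : y = a1
    · exact hno (h.rev.symm.hasCycle_of_adj (m2 b1 h.sp1.core.last_mem h.sp1.last) (hya ▸ ay))
    · obtain ⟨w, hw, hwS, nw⟩ := n2
      obtain ⟨Y, hY, hYc, hYm⟩ := h.symm.exists_rot hS hl1 hw hwS nw hy hya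
      exact hno (h.symm.rev.hasCycle_of_rot hY hYc hYm ay (m2 a1 h.sp1.core.head_mem h.sp1.first))
  push Not at m2
  have hmem : ∀ {t : SPath V} {s : V}, (∃ w ∈ t.core, w ∉ S ∧ ¬ G.Adj s w) →
      ∃ w ∈ t.rev.core, w ∉ S ∧ ¬ G.Adj s w := by
    rintro t s ⟨w, hw, r⟩
    exact ⟨w, SPath.mem_core_rev.2 hw, r⟩
  have hlr : ∀ {t : SPath V}, (∀ x ∈ t.core, ∀ y ∈ t.core, x ∉ S → y ∉ S → κ x = κ y) →
      ∀ x ∈ t.rev.core, ∀ y ∈ t.rev.core, x ∉ S → y ∉ S → κ x = κ y :=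
    fun hl x hx y hy => hl x (SPath.mem_core_rev.1 hx) y (SPath.mem_core_rev.1 hy)
  -- Now all four ends in `S` have nonneighbours in the other path, so every choice of directions of
  -- the two paths gives a restriction.
  have c1 := h.hasCycle_of_helpers hS hl1 hl2 n2 m2 hno
  have c2 := h.rev.hasCycle_of_helpers hS (hlr hl1) hl2 n1 (hmem m2) hno
  have c3 := h.symm.rev.symm.hasCycle_of_helpers hS hl1 (hlr hl2) (hmem n2) m1 hno
  have c4 := h.rev.symm.rev.symm.hasCycle_of_helpers hS (hlr hl1) (hlr hl2) (hmem n1) (hmem m1) hno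
  simp only [SPath.mem_core_rev] at c2 c3 c4
  -- If the two ends of the inner path coincided, it would be one vertex; but `s` has both a
  -- neighbour and a nonneighbour on it.
  have nab : ∀ {t1 t2 : SPath V} {a1 b1 a2 b2 s : V}, TwoPaths G S κ t1 t2 a1 b1 a2 b2 → s ∈ S →
      (∃ w ∈ t2.core, w ∉ S ∧ ¬ G.Adj s w) → a2 ≠ b2 := by
    rintro t1 t2 a1 b1 a2 b2 s h hs ⟨w, hw, -, nw⟩ rfl
    have hnd : t2.core.Nodup := by
      rw [List.nodup_iff_count_le_one]
      intro v
      have := h.count v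
      simp only [SPath.full, List.count_append, List.count_cons] at this
      omega
    obtain ⟨y, hy, -, -, ay⟩ := h.exists_nbr hS hs
    rw [h.sp2.core.eq_of_same_ends hnd hy] at ay
    exact nw (h.sp2.core.eq_of_same_ends hnd hw ▸ ay)
  have ab1 := nab h.symm h.sp2.left m1
  have ab2 := nab h h.sp1.left n1
  obtain ⟨z2, hz2, hzS2, -, e2⟩ := h.symm.exists_nbr hS h.sp2.left
  obtain ⟨z2', hz2', hzS2', -, e2'⟩ := h.symm.exists_nbr hS h.sp2.right
  obtain ⟨z1, hz1, hzS1, -, e1⟩ := h.exists_nbr hS h.sp1.left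
  obtain ⟨z1', hz1', hzS1', -, e1'⟩ := h.exists_nbr hS h.sp1.right
  -- No vertex of `S` can have the two distinct ends of a path as its only neighbour there. So the
  -- first alternative chosen settles the others, and both ends of one path attach to opposite ends
  -- of the other.
  rcases c1 with c1 | c1
  · have f1 := c1 z2 hz2 hzS2 e2
    rcases c2 with c2 | c2
    · exact ab1 (f1.symm.trans (c2 z2 hz2 hzS2 e2))
    have f2 := c2 z1' hz1' hzS1' e1'
    rcases c4 with c4 | c4
    · have f4 := c4 z2' hz2' hzS2' e2'
      exact hno (h.rev.symm.hasCycle_of_adj (f4 ▸ e2') (f1 ▸ e2))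
    · exact ab2 (f2.symm.trans (c4 z1' hz1' hzS1' e1'))
  · have f1 := c1 z1 hz1 hzS1 e1
    rcases c3 with c3 | c3
    · have f3 := c3 z2' hz2' hzS2' e2'
      rcases c4 with c4 | c4
      · exact ab1 (f3.symm.trans (c4 z2' hz2' hzS2' e2'))
      · have f4 := c4 z1' hz1' hzS1' e1'
        exact hno (h.symm.rev.symm.hasCycle_of_adj (f4 ▸ e1') (f1 ▸ e1))
    · exact ab2 (f1.symm.trans (c3 z1 hz1 hzS1 e1))

/-- With two components, there is a cycle. -/
lemma TwoPaths.hasCycle [Fintype V] (hS : Setup G S κ) (h : TwoPaths G S κ t1 t2 a1 b1 a2 b2)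
    (hl1 : ∀ x ∈ t1.core, ∀ y ∈ t1.core, x ∉ S → y ∉ S → κ x = κ y)
    (hl2 : ∀ x ∈ t2.core, ∀ y ∈ t2.core, x ∉ S → y ∉ S → κ x = κ y) : HasCycle G S := by
  have hlr : ∀ {t : SPath V}, (∀ x ∈ t.core, ∀ y ∈ t.core, x ∉ S → y ∉ S → κ x = κ y) →
      ∀ x ∈ t.rev.core, ∀ y ∈ t.rev.core, x ∉ S → y ∉ S → κ x = κ y :=
    fun hl x hx y hy => hl x (SPath.mem_core_rev.1 hx) y (SPath.mem_core_rev.1 hy)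
  have hmem : ∀ {t : SPath V} {s : V}, (∃ w ∈ t.core, w ∉ S ∧ ¬ G.Adj s w) →
      ∃ w ∈ t.rev.core, w ∉ S ∧ ¬ G.Adj s w := by
    rintro t s ⟨w, hw, r⟩
    exact ⟨w, SPath.mem_core_rev.2 hw, r⟩
  have ha1 := h.sp1.core.head_mem
  have hb1 := h.sp1.core.last_mem
  have ha2 := h.sp2.core.head_mem
  have hb2 := h.sp2.core.last_mem
  have key : ∀ {t : SPath V} (s : V), (∀ w ∈ t.core, w ∉ S → G.Adj s w) ∨
      ∃ w ∈ t.core, w ∉ S ∧ ¬ G.Adj s w := by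
    intro t s
    by_contra! H
    obtain ⟨⟨w, hw, hwS, nw⟩, hh⟩ := H
    exact nw (hh w hw hwS)
  -- Two ends of the same path complete to the other path, or one end of each path complete to the
  -- other, close a cycle at once. Otherwise at least three of the four have nonneighbours.
  rcases key (t := t2) t1.p with p1 | p1 <;> rcases key (t := t2) t1.q with q1 | q1
  · exact h.hasCycle_of_adj (q1 a2 ha2 h.sp2.first) (p1 b2 hb2 h.sp2.last)
  · rcases key (t := t1) t2.p with p2 | p2
    · exact h.rev.symm.rev.symm.hasCycle_of_adj_adj (p1 b2 hb2 h.sp2.last) (p2 b1 hb1 h.sp1.last)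
    rcases key (t := t1) t2.q with q2 | q2
    · exact h.rev.hasCycle_of_adj_adj (p1 a2 ha2 h.sp2.first) (q2 b1 hb1 h.sp1.last)
    exact h.rev.symm.hasCycle_of_exists_not_adj hS hl2 (hlr hl1) (hmem p2) (hmem q2) q1
  · rcases key (t := t1) t2.p with p2 | p2
    · exact h.symm.rev.symm.hasCycle_of_adj_adj (q1 b2 hb2 h.sp2.last) (p2 a1 ha1 h.sp1.first)
    rcases key (t := t1) t2.q with q2 | q2
    · exact h.hasCycle_of_adj_adj (q1 a2 ha2 h.sp2.first) (q2 a1 ha1 h.sp1.first)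
    exact h.symm.hasCycle_of_exists_not_adj hS hl2 hl1 p2 q2 p1
  · rcases key (t := t1) t2.p with p2 | p2
    · rcases key (t := t1) t2.q with q2 | q2
      · exact h.symm.hasCycle_of_adj (q2 a1 ha1 h.sp1.first) (p2 b1 hb1 h.sp1.last)
      · exact h.symm.rev.symm.hasCycle_of_exists_not_adj hS hl1 (hlr hl2) (hmem p1) (hmem q1) q2
    · exact h.hasCycle_of_exists_not_adj hS hl1 hl2 p1 q1 p2

/-- The path `t1` is left through `t1.q` to a neighbour `y` in `t2`. The return to `a1` is through
`t2.q` if `y = a2`, and otherwise through `t2.p` after a rotation, allowed by the missing edge to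
`b1`. -/
lemma TwoPaths.hasCycle_of_miss [Fintype V] (hS : Setup G S κ)
    (h : TwoPaths G S κ t1 t2 a1 b1 a2 b2)
    (hl2 : ∀ x ∈ t2.core, ∀ y ∈ t2.core, x ∉ S → y ∉ S → κ x = κ y)
    (e1 : G.Adj t2.p a1) (e2 : G.Adj t2.q a1) (n : ¬ G.Adj t2.q b1) : HasCycle G S := by
  obtain ⟨y, hy, hyS, -, ay⟩ := h.exists_nbr hS h.sp1.right
  by_cases hya : y = a2
  · exact h.hasCycle_of_adj_adj (hya ▸ ay) e2
  obtain ⟨Y, hY, hYc, hYm⟩ := h.exists_rot hS hl2 h.sp1.core.last_mem h.sp1.last n hy hya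
  refine ⟨(t1.core ++ [t1.q]) ++ (Y ++ [t2.p]), _, _,
    (h.sp1.core.concat h.sp1.adj_right.symm).append (hY.concat h.sp2.adj_left.symm) ay, e1,
    fun v => ?_, h.covers_of (fun v hv _ => by simp [hv]) fun v hv hvS => by simp [hYm v hv hvS]⟩
  have := h.count v
  have := hYc v
  simp only [SPath.full, List.count_append, List.count_cons, List.count_nil] at *
  omega

/-- If the first path has ends in different components, and each vertex of `S` is adjacent to one of
two vertices of different components, there are a cycle and a path. -/
lemma TwoPaths.hasCycle_and_hasPath [Fintype V] (hS : Setup G S κ)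
    (hmiss : ∀ s ∈ S, ∀ u ∉ S, ∀ v ∉ S, κ u ≠ κ v → G.Adj s u ∨ G.Adj s v)
    (h : TwoPaths G S κ t1 t2 a1 b1 a2 b2) (hab : κ a1 ≠ κ b1)
    (hl2 : ∀ x ∈ t2.core, ∀ y ∈ t2.core, x ∉ S → y ∉ S → κ x = κ y) :
    HasCycle G S ∧ HasPath G S := by
  refine ⟨?_, h.hasPath hS hl2⟩
  by_cases c1 : G.Adj t2.p a1 <;> by_cases c2 : G.Adj t2.q b1
  · exact h.rev.symm.hasCycle_of_adj c2 c1
  · exact h.hasCycle_of_miss hS hl2 c1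
      ((hmiss _ h.sp2.right a1 h.sp1.first b1 h.sp1.last hab).resolve_right c2) c2
  · have c3 := (hmiss _ h.sp2.left a1 h.sp1.first b1 h.sp1.last hab).resolve_left c1
    by_cases c4 : G.Adj t2.q a1
    · exact h.symm.hasCycle_of_adj c4 c3
    · exact h.rev.hasCycle_of_miss hS hl2 c3 c2 c4
  · have c3 := (hmiss _ h.sp2.left a1 h.sp1.first b1 h.sp1.last hab).resolve_left c1
    have c4 := (hmiss _ h.sp2.right a1 h.sp1.first b1 h.sp1.last hab).resolve_right c2
    exact h.symm.hasCycle_of_adj c4 c3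

end TwoPaths

/-- A cover by a path and a list of paths that stay in one component each. -/
structure ManyPaths (G : SimpleGraph V) (S : Finset V) (κ : V → ι) (t : SPath V) (a b : V)
    (P : List (SPath V)) : Prop where
  sp : IsSP G S t a b
  isSPath : ∀ u ∈ P, IsSPath G S κ u
  count : ∀ v, t.full.count v + (P.map SPath.full).flatten.count v ≤ 1
  covers : ∀ v ∉ S, v ∈ t.core ∨ ∃ u ∈ P, v ∈ u.core
  sep : ∀ u ∈ P, ∀ x ∈ t.core, ∀ y ∈ u.core, x ∉ S → y ∉ S → κ x ≠ κ y
  pairwise : P.Pairwise fun u u' => ∀ x ∈ u.core, ∀ y ∈ u'.core, x ∉ S → y ∉ S → κ x ≠ κ y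

lemma ManyPaths.perm {t : SPath V} {a b : V} {P P' : List (SPath V)} (h : ManyPaths G S κ t a b P)
    (p : P.Perm P') : ManyPaths G S κ t a b P' where
  sp := h.sp
  isSPath u hu := h.isSPath u (p.mem_iff.2 hu)
  count v := by rw [← (p.map _).flatten.count_eq]; exact h.count v
  covers v hv := (h.covers v hv).imp id fun ⟨u, hu, e⟩ => ⟨u, p.mem_iff.1 hu, e⟩
  sep u hu := h.sep u (p.mem_iff.2 hu)
  pairwise := (p.pairwise_iff fun h x hx y hy hxS hyS => (h y hy x hx hyS hxS).symm).1 h.pairwise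

/-- Linking the first two paths. -/
lemma ManyPaths.link {t u : SPath V} {a b a' b' : V} {P : List (SPath V)}
    (h : ManyPaths G S κ t a b (u :: P)) (hu : IsSP G S u a' b') (e : G.Adj t.p a') :
    ∃ t', ManyPaths G S κ t' b b' P ∧ κ b ≠ κ b' := by
  have hc := h.count
  simp only [List.map_cons, List.flatten_cons, SPath.full, List.count_append, List.count_cons] at hc
  have hpw := List.pairwise_cons.1 h.pairwise
  refine ⟨⟨t.q, (t.core.reverse ++ [t.p]) ++ u.core, u.q⟩, ⟨⟨h.sp.right, hu.right, ?_, h.sp.adj_right,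
    hu.adj_right, h.sp.last, hu.last⟩, fun w hw => h.isSPath w (by simp [hw]), fun v => ?_,
    fun v hv => ?_, ?_, hpw.2⟩, ?_⟩
  · exact (h.sp.core.reverse.concat h.sp.adj_left.symm).append hu.core e
  · have := hc v
    simp only [SPath.full, List.count_append, List.count_cons, List.count_nil, List.count_reverse]
    omega
  · rcases h.covers v hv with hv | ⟨w, hw, hv⟩
    · simp [hv]
    · rcases List.mem_cons.1 hw with rfl | hw
      · simp [hv]
      · exact .inr ⟨w, hw, hv⟩
  · intro w hw x hx y hy hxS hyS
    simp only [List.mem_append, List.mem_reverse, List.mem_singleton] at hx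
    rcases hx with (hx | rfl) | hx
    · exact h.sep w (by simp [hw]) x hx y hy hxS hyS
    · exact absurd h.sp.left hxS
    · exact hpw.1 w hw x hx y hy hxS hyS
  · exact h.sep u (by simp) b h.sp.core.last_mem b' hu.core.last_mem h.sp.last hu.last

/-- By `hmiss`, the end `t.p` is adjacent to the first inner vertex of one of any two listed paths,
so a link is always possible. Links give the growing path ends in different components, as the final
step with two paths requires; the disjunction covers the start, before any link. -/
lemma ManyPaths.hasCycle_and_hasPath [Fintype V] (hS : Setup G S κ)
    (hmiss : ∀ s ∈ S, ∀ u ∉ S, ∀ v ∉ S, κ u ≠ κ v → G.Adj s u ∨ G.Adj s v) :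
    ∀ (n : ℕ) {P : List (SPath V)} {t : SPath V} {a b : V}, P.length = n →
    ManyPaths G S κ t a b P → P ≠ [] → (2 ≤ P.length ∨ κ a ≠ κ b) →
    HasCycle G S ∧ HasPath G S := by
  intro n
  induction n with
  | zero => intro P t a b hn h hP; simp at hn; exact absurd hn hP
  | succ n ih =>
    intro P t a b hn h hP hab
    match P, hn, h, hab with
    | [u], hn, h, hab =>
      obtain ⟨a', b', hu⟩ := (h.isSPath u (by simp)).exists_isSP
      have h2 : TwoPaths G S κ t u a b a' b' :=
        ⟨h.sp, hu, fun v => by simpa using h.count v, fun v hv => by simpa using h.covers v hv,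
          h.sep u (by simp)⟩
      exact h2.hasCycle_and_hasPath hS hmiss (by simpa using hab) (h.isSPath u (by simp)).label
    | u :: u' :: P, hn, h, hab =>
      obtain ⟨c, d, hu⟩ := (h.isSPath u (by simp)).exists_isSP
      obtain ⟨c', d', hu'⟩ := (h.isSPath u' (by simp)).exists_isSP
      have hne : κ c ≠ κ c' := (List.pairwise_cons.1 h.pairwise).1 u' (by simp) c hu.core.head_mem c'
        hu'.core.head_mem hu.first hu'.first
      rcases hmiss t.p h.sp.left c hu.first c' hu'.first hne with e | e
      · obtain ⟨t', ht', hk⟩ := h.link hu e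
        exact ih (by simpa using hn) ht' (by simp) (.inr hk)
      · obtain ⟨t', ht', hk⟩ := (h.perm (List.Perm.swap u' u P)).link hu' e
        exact ih (by simpa using hn) ht' (by simp) (.inr hk)

theorem Setup.hasCycle_and_hasPath [Fintype V] (hS : Setup G S κ) : HasCycle G S ∧ HasPath G S := by
  obtain ⟨P, hP, hpw⟩ := hS.exists_cover_pairwise
  obtain ⟨v, hv⟩ := hS.exists_notMem
  obtain ⟨w, hw, hk⟩ := hS.other v hv
  obtain ⟨t, ht, hvt⟩ := hP.covers v hv
  obtain ⟨u, hu, hwu⟩ := hP.covers w hw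
  have hnd := List.nodup_iff_count_le_one.1 hP.nodup
  match P, hP, hpw, hnd with
  | [], hP, _, _ => simp at ht
  | [t'], hP, _, _ =>
    obtain rfl := List.mem_singleton.1 ht
    obtain rfl := List.mem_singleton.1 hu
    exact absurd ((hP.isSPath u (by simp)).label w hwu v hvt hw hv) hk
  | [t1, t2], hP, hpw, hnd =>
    have l1 := hP.isSPath t1 (by simp)
    have l2 := hP.isSPath t2 (by simp)
    obtain ⟨a, b, h1⟩ := l1.exists_isSP
    obtain ⟨c, d, h2⟩ := l2.exists_isSP
    have h : TwoPaths G S κ t1 t2 a b c d := by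
      refine ⟨h1, h2, fun v => by simpa using hnd v, fun v hv => by simpa using hP.covers v hv, ?_⟩
      exact (List.pairwise_cons.1 hpw).1 t2 (by simp)
    exact ⟨h.hasCycle hS l1.label l2.label, h.hasPath hS l2.label⟩
  | t1 :: t2 :: t3 :: P, hP, hpw, hnd =>
    obtain ⟨a, b, h1⟩ := (hP.isSPath t1 (by simp)).exists_isSP
    obtain ⟨c, d, h2⟩ := (hP.isSPath t2 (by simp)).exists_isSP
    obtain ⟨e, f, h3⟩ := (hP.isSPath t3 (by simp)).exists_isSP
    have hp1 := List.pairwise_cons.1 hpw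
    have hp2 := List.pairwise_cons.1 hp1.2
    have k12 := hp1.1 t2 (by simp) a h1.core.head_mem c h2.core.head_mem h1.first h2.first
    have k13 := hp1.1 t3 (by simp) a h1.core.head_mem e h3.core.head_mem h1.first h3.first
    have k23 := hp2.1 t3 (by simp) c h2.core.head_mem e h3.core.head_mem h2.first h3.first
    refine ManyPaths.hasCycle_and_hasPath hS ?_ _ rfl
      (⟨h1, fun u hu => hP.isSPath u (List.mem_cons_of_mem _ hu), fun v => by simpa using hnd v,
        fun v hv => ?_, hp1.1, hp1.2⟩ : ManyPaths G S κ t1 a b (t2 :: t3 :: P)) (by simp)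
      (.inl (by simp))
    · intro s hs x hx y hy hxy
      by_contra! H
      have main : ∀ z ∉ S, κ z ≠ κ x → κ z ≠ κ y → False := fun z hz hzx hzy =>
        hxy (hS.eq_of_not_adj hs hx hy hz hzx hzy H.1 H.2)
      rcases exists_ne_ne (κ x) (κ y) k12 k13 k23 with g | g | g
      exacts [main a h1.first g.1 g.2, main c h2.first g.1 g.2, main e h3.first g.1 g.2]
    · obtain ⟨u, hu, e⟩ := hP.covers v hv
      rcases List.mem_cons.1 hu with rfl | hu
      exacts [.inl e, .inr ⟨u, hu, e⟩]

end ToughGraph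

/-! ### From the graph-theoretic hypotheses to `Setup`, and from lists back to walks. -/

namespace ToughGraph
variable {V : Type*} {G : SimpleGraph V}

lemma Reachable.induct {Z : Set V} {P : V → Prop}
    (hP : ∀ v, v ∉ Z → ∀ w, w ∉ Z → G.Adj v w → P v → P w) {a b : (Zᶜ : Set V)}
    (h : (del G Z).Reachable a b) (ha : P a) : P b := by
  obtain ⟨p⟩ := h
  by_contra hb
  obtain ⟨d, -, h1, h2⟩ := p.exists_boundary_dart {v | P v} ha hb
  exact h2 (hP _ d.fst.2 _ d.snd.2 d.adj h1)

/-- One vertex is picked in each set; sets closed outside `Z` contain the whole components of their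
vertices, so these components are distinct. -/
lemma card_le_numComponents [Finite V] {Z : Set V} {B : Finset (Finset V)}
    (hne : ∀ K ∈ B, K.Nonempty) (hZ : ∀ K ∈ B, ∀ v ∈ K, v ∉ Z)
    (hd : ∀ K ∈ B, ∀ K' ∈ B, K ≠ K' → ∀ v ∈ K, v ∉ K')
    (hcl : ∀ K ∈ B, ∀ v ∈ K, ∀ w, G.Adj v w → w ∈ K ∨ w ∈ Z) :
    B.card ≤ numComponents (del G Z) := by
  choose g hg using hne
  have hinj : Function.Injective fun K : B =>
      (del G Z).connectedComponentMk ⟨g K K.2, hZ K K.2 _ (hg K K.2)⟩ := by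
    intro K K' h
    by_contra hKK
    have hr := SimpleGraph.ConnectedComponent.exact h
    have := Reachable.induct (P := (· ∈ K.1))
      (fun v _ w hw hvw hv => (hcl K K.2 v hv w hvw).resolve_right hw) hr (hg K K.2)
    exact hd K K.2 K' K'.2 (fun e => hKK (Subtype.ext e)) _ this (hg K' K'.2)
  simpa [numComponents] using Nat.card_le_card_of_injective _ hinj

lemma IsTough.le_ncard {Z : Set V} (h : IsTough G (9 / 2)) (hZ : IsCutset G Z) :
    9 * numComponents (del G Z) ≤ 2 * Z.ncard := by
  have h1 : ((9 / 2 : ℝ≥0) : ℝ≥0∞) ≤ (Z.ncard : ℝ≥0∞) / (numComponents (del G Z) : ℝ≥0∞) :=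
    le_trans h (iInf₂_le Z hZ)
  have h0 : (numComponents (del G Z) : ℝ≥0) ≠ 0 := by
    have : 2 ≤ numComponents (del G Z) := hZ
    exact_mod_cast (by omega : numComponents (del G Z) ≠ 0)
  have h2 : (9 / 2 : ℝ≥0) ≤ (Z.ncard : ℝ≥0) / (numComponents (del G Z) : ℝ≥0) := by
    rw [← ENNReal.coe_le_coe, ENNReal.coe_div h0]
    simpa using h1
  rw [div_le_div_iff₀ (by norm_num) (by positivity)] at h2
  have h3 : 9 * numComponents (del G Z) ≤ Z.ncard * 2 := by exact_mod_cast h2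
  omega

lemma isCutset_iff [Finite V] {Z : Set V} :
    IsCutset G Z ↔ ∃ a b : (Zᶜ : Set V), ¬ (del G Z).Reachable a b := by
  rw [IsCutset, numComponents, Nat.succ_le_iff, Finite.one_lt_card_iff_nontrivial]
  constructor
  · rintro ⟨c, d, h⟩
    induction c using SimpleGraph.ConnectedComponent.ind with | _ a
    induction d using SimpleGraph.ConnectedComponent.ind with | _ b
    exact ⟨a, b, fun hr => h (SimpleGraph.ConnectedComponent.sound hr)⟩
  · rintro ⟨a, b, h⟩
    exact ⟨_, _, fun e => h (SimpleGraph.ConnectedComponent.exact e)⟩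

/-- The adjacency pattern alone forces the five vertices to be distinct. -/
lemma IsFree.false_of_P4P1 (h : IsFree G P4unionP1) (a b c d e : V) (ab : G.Adj a b)
    (bc : G.Adj b c) (cd : G.Adj c d) (ac : ¬ G.Adj a c) (bd : ¬ G.Adj b d) (ad : ¬ G.Adj a d)
    (ea : ¬ G.Adj e a) (eb : ¬ G.Adj e b) (ec : ¬ G.Adj e c) (ed : ¬ G.Adj e d) : False := by
  have nae : a ≠ e := by rintro rfl; exact eb ab
  have nbe : b ≠ e := by rintro rfl; exact ea ab.symm
  have nce : c ≠ e := by rintro rfl; exact ed cd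
  have nde : d ≠ e := by rintro rfl; exact ec cd.symm
  have nac : a ≠ c := by rintro rfl; exact ad cd
  have nbd : b ≠ d := by rintro rfl; exact ad ab
  have nad : a ≠ d := by rintro rfl; exact ac cd.symm
  have ac' := mt G.adj_symm ac
  have bd' := mt G.adj_symm bd
  have ad' := mt G.adj_symm ad
  have ea' := mt G.adj_symm ea
  have eb' := mt G.adj_symm eb
  have ec' := mt G.adj_symm ec
  have ed' := mt G.adj_symm ed
  refine h ⟨⟨⟨Sum.elim ![a, b, c, d] ![e], ?_⟩, ?_⟩⟩
  · rintro (i | i) (j | j) hij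
    · congr 1
      fin_cases i <;> fin_cases j <;>
        simp [ab.ne, ab.ne', bc.ne, bc.ne', cd.ne, cd.ne', nac, nac.symm, nbd, nbd.symm, nad,
          nad.symm] at hij ⊢
    · fin_cases i <;> fin_cases j <;> simp [nae, nbe, nce, nde] at hij
    · fin_cases i; fin_cases j <;> simp [nae.symm, nbe.symm, nce.symm, nde.symm] at hij
    · exact congrArg _ (Subsingleton.elim _ _)
  · rintro (i | i) (j | j)
    · change G.Adj (![a, b, c, d] i) (![a, b, c, d] j) ↔ (SimpleGraph.pathGraph 4).Adj i j
      rw [SimpleGraph.pathGraph_adj]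
      fin_cases i <;> fin_cases j <;> simp [ab.symm, bc.symm, cd.symm, *]
    · obtain rfl := Subsingleton.elim j 0
      change G.Adj (![a, b, c, d] i) e ↔ _
      simp only [P4unionP1, SimpleGraph.sum_adj]
      fin_cases i <;> simp [*]
    · obtain rfl := Subsingleton.elim i 0
      change G.Adj e (![a, b, c, d] j) ↔ _
      simp only [P4unionP1, SimpleGraph.sum_adj]
      fin_cases j <;> simp [*]
    · obtain rfl := Subsingleton.elim i j
      exact iff_of_false G.irrefl (SimpleGraph.irrefl _)

open Classical in
/-- The component of `G - S` that contains a vertex, if there is one. -/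
noncomputable def compLabel (G : SimpleGraph V) (S : Set V) (v : V) :
    Option (del G S).ConnectedComponent :=
  if h : v ∉ S then some ((del G S).connectedComponentMk ⟨v, h⟩) else none

lemma compLabel_eq_iff {S : Set V} {v w : V} (hv : v ∉ S) (hw : w ∉ S) :
    compLabel G S v = compLabel G S w ↔
      (del G S).Reachable ⟨v, hv⟩ ⟨w, hw⟩ := by
  simp [compLabel, hv, hw]

lemma compLabel_eq_of_adj {S : Set V} {v w : V} (hv : v ∉ S) (hw : w ∉ S) (h : G.Adj v w) :
    compLabel G S v = compLabel G S w :=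
  (compLabel_eq_iff hv hw).2 (SimpleGraph.Adj.reachable (G := del G S) (by simpa using h))

lemma IsCutset.exists_compLabel_ne [Finite V] {S : Set V} (h : IsCutset G S) (v : V) :
    ∃ w, w ∉ S ∧ compLabel G S w ≠ compLabel G S v := by
  obtain ⟨a, b, hab⟩ := isCutset_iff.1 h
  have hab' : compLabel G S a ≠ compLabel G S b := fun e =>
    hab ((compLabel_eq_iff a.2 b.2).1 e)
  by_cases e : compLabel G S a = compLabel G S v
  · exact ⟨b, b.2, fun e' => hab' (e.trans e'.symm)⟩
  · exact ⟨a, a.2, e⟩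

/-- If `s` had no neighbour in the component of `v`, returning `s` to the graph would leave that
component separated, and `S \ {s}` would be a smaller cutset. -/
lemma IsMinimalCutset.exists_adj [Finite V] {S : Set V} (h : IsMinimalCutset G S) {s v : V}
    (hs : s ∈ S) (hv : v ∉ S) : ∃ x, x ∉ S ∧ compLabel G S x = compLabel G S v ∧ G.Adj s x := by
  by_contra! H
  obtain ⟨w, hw, hwv⟩ := IsCutset.exists_compLabel_ne h.prop v
  have hcut : IsCutset G (S \ {s}) := by
    refine isCutset_iff.2 ⟨⟨v, fun e => hv e.1⟩, ⟨w, fun e => hw e.1⟩, fun hr => ?_⟩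
    refine hwv (Reachable.induct (P := fun x => x ∉ S ∧ compLabel G S x = compLabel G S v)
      (fun x _ y hy hxy hx => ?_) hr ⟨hv, rfl⟩).2
    have hys : y ≠ s := by
      rintro rfl
      exact H x hx.1 hx.2 hxy.symm
    have hyS : y ∉ S := fun e => hy ⟨e, hys⟩
    exact ⟨hyS, (compLabel_eq_of_adj hx.1 hyS hxy).symm.trans hx.2⟩
  exact (h.le_of_le hcut Set.sdiff_subset hs).2 rfl

lemma IsMinimalCutset.setup [Fintype V] {S : Finset V} (hfree : IsFree G P4unionP1)
    (htough : IsTough G (9 / 2)) (hS : IsMinimalCutset G (S : Set V)) :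
    Setup G S (compLabel G (S : Set V)) where
  false_of_P4P1 := hfree.false_of_P4P1
  label v hv w hw h := compLabel_eq_of_adj (by simpa using hv) (by simpa using hw) h
  cross P v hv w hw h hPv hPw := by
    by_contra! H
    have hv' : v ∉ (S : Set V) := by simpa using hv
    have hr := (compLabel_eq_iff hv' (by simpa using hw)).1 h
    refine hPw (Reachable.induct
      (P := fun x => compLabel G (S : Set V) x = compLabel G (S : Set V) v ∧ P x)
      (fun x hx y hy hxy hPx => ?_) hr ⟨rfl, hPv⟩).2
    have e := (compLabel_eq_of_adj hx hy hxy).symm.trans hPx.1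
    refine ⟨e, by_contra fun hPy => ?_⟩
    exact H x (by simpa using hx) y (by simpa using hy) hPx.1 e hPx.2 hPy hxy
  nbr s hs v hv := by
    simpa using hS.exists_adj (s := s) (v := v) (by simpa using hs) (by simpa using hv)
  exists_notMem := by
    obtain ⟨a, -⟩ := isCutset_iff.1 hS.prop
    exact ⟨a, fun h => a.2 h⟩
  other v _ := by simpa using IsCutset.exists_compLabel_ne hS.prop v
  tough Z B hB hne hZ hd hcl := by
    have h1 := card_le_numComponents (Z := (Z : Set V)) hne (by simpa using hZ) hd
      (by simpa using hcl)
    have h2 := IsTough.le_ncard htough (le_trans hB h1)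
    rw [Set.ncard_coe_finset] at h2
    omega

lemma Pth.exists_isPath [DecidableEq V] {l : List V} {x y : V} (h : Pth G l x y)
    (hl : ∀ v, l.count v ≤ 1) : ∃ p : G.Walk x y, p.IsPath ∧ p.support = l := by
  have hx : l.head h.ne_nil = x := by
    have := h.head; rw [List.head?_eq_some_head h.ne_nil] at this; exact Option.some.inj this
  have hy : l.getLast h.ne_nil = y := by
    have := h.last; rw [List.getLast?_eq_some_getLast h.ne_nil] at this; exact Option.some.inj this
  have e := SimpleGraph.Walk.support_ofSupport h.ne_nil h.chain
  rw [← SimpleGraph.Walk.support_copy _ hx hy] at e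
  exact ⟨_, (SimpleGraph.Walk.isPath_def _).2
    (by rw [e]; exact List.nodup_iff_count_le_one.2 hl), e⟩

/-- A third vertex on the path ensures that the closing edge is not itself an edge of the path. -/
lemma isCycle_cons_of_isPath {x y : V} {p : G.Walk x y} (hp : p.IsPath) (h : G.Adj y x)
    (hv : ∃ v ∈ p.support, v ≠ x ∧ v ≠ y) : (SimpleGraph.Walk.cons h p).IsCycle := by
  refine (SimpleGraph.Walk.cons_isCycle_iff p h).2 ⟨hp, fun he => ?_⟩
  obtain ⟨v, hv, hvx, hvy⟩ := hv
  cases p with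
  | nil => exact h.ne rfl
  | @cons _ z _ hz q =>
    rw [SimpleGraph.Walk.cons_isPath_iff] at hp
    rw [SimpleGraph.Walk.edges_cons, List.mem_cons] at he
    rcases he with he | he
    · have : z = y := by
        have := h.ne
        simp only [Sym2.eq_iff] at he
        grind
      subst this
      have hq := SimpleGraph.Walk.nil_iff_support_eq.1 (SimpleGraph.Walk.isPath_iff_nil.1 hp.1)
      simp [hvx, hvy, hq] at hv
    · exact hp.2 (q.snd_mem_support_of_mem_edges he)

theorem exists_matched_pathCover_and_cycle [Fintype V] [DecidableEq V] {S : Finset V}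
    (hfree : IsFree G P4unionP1) (htough : IsTough G (9 / 2))
    (hS : IsMinimalCutset G (S : Set V)) :
    (∃ Q : PathCover G (S : Set V)ᶜ 1, Q.IsMatched S) ∧
      ∃ (v : V) (C : G.Walk v v), C.IsCycle ∧ ∀ w : V, w ∉ S → w ∈ C.support := by
  have hset := hS.setup hfree htough
  obtain ⟨⟨c, x, y, hc, hyx, hnd, hcov⟩, w, s, s', hw, hs, hs', hss, hwd, hwc⟩ :=
    hset.hasCycle_and_hasPath
  constructor
  · obtain ⟨p, hp, e⟩ := hw.exists_isPath hwd
    refine ⟨⟨fun _ => s, fun _ => s', fun _ => p, fun _ => hp,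
      fun i j hij => absurd (Subsingleton.elim i j) hij, fun v hv => ⟨0, ?_⟩⟩,
      fun _ => ⟨hss, hs, hs'⟩⟩
    rw [e]
    exact hwc v (by simpa using hv)
  · obtain ⟨p, hp, e⟩ := hc.exists_isPath hnd
    refine ⟨y, SimpleGraph.Walk.cons hyx p, isCycle_cons_of_isPath hp hyx ?_, fun v hv => ?_⟩
    -- Vertices of two components are nonadjacent, so both cannot lie among the adjacent vertices
    -- `x` and `y`.
    · by_contra! H
      rw [e] at H
      obtain ⟨v, hv⟩ := hset.exists_notMem
      obtain ⟨u, hu, huv⟩ := hset.other v hv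
      have hadj : ¬ G.Adj v u := fun h => huv (hset.label v hv u hu h).symm
      have hne : u ≠ v := fun h => huv (congrArg _ h)
      have h1 := H v (hcov v hv)
      have h2 := H u (hcov u hu)
      rcases eq_or_ne v x with rfl | hvx
      · exact hadj (h2 hne ▸ hyx.symm)
      · obtain rfl := h1 hvx
        rcases eq_or_ne u x with rfl | hux
        exacts [hadj hyx, hne (h2 hux)]
    · rw [SimpleGraph.Walk.support_cons, e]
      exact List.mem_cons_of_mem _ (hcov v hv)

end ToughGraph

theorem mainTheorem3 {V : Type*} [Finite V] (G : SimpleGraph V) (S : Set V)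
    (hfree : ToughGraph.IsFree G ToughGraph.P4unionP1)
    (htough : ToughGraph.IsTough G (9 / 2))
    (hS : ToughGraph.IsMinimalCutset G S) :
    (∃ Q : ToughGraph.PathCover G Sᶜ 1, Q.IsMatched S) ∧
      (∃ (v : V) (C : G.Walk v v), C.IsCycle ∧ ∀ w : V, w ∉ S → w ∈ C.support) := by
  classical
  have := Fintype.ofFinite V
  obtain ⟨S, rfl⟩ := S.toFinite.exists_finset_coe
  simpa using ToughGraph.exists_matched_pathCover_and_cycle hfree htough hS
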